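/- Let $I\subseteq\mathbb R$ be an open interval, let $f:I\to\mathbb R$ be smooth and nowhere zero, and let $L^4_1(f,0)=I\times\mathbb E^3$ with the Lorentzian metric $\tilde g=-dt^2+f(t)^2g_0$, where $g_0$ is the Euclidean metric of $\mathbb E^3$. Let $M$ be a smooth surface immersed in $L^4_1(f,0)$ whose induced metric is Riemannian (a space-like surface), and suppose that no nonempty open part of $M$ lies in a totally geodesic (nondegenerate) hypersurface of $L^4_1(f,0)$. Then the following are equivalent. (a) $M$ is minimal (its mean curvature vector vanishes identically) and of class $\mathcal A$, i.e. at every point the tangential part $T$ of $\partial/\partial t$ is an eigenvector (in particular $T\neq 0$) of every shape operator $A_\xi$, $\xi$ normal to $M$. (b) $M$ is locally congruent to a rotational surface $$\phi(u,v)=\bigl(u,\ \zeta_1(u)\cos v,\ \zeta_1(u)\sin v,\ \zeta_2(u)\bigr),$$ where $\zeta_1>0$ and $\zeta_2$ are smooth functions on an open interval $J\subseteq I$, $f^2(\zeta_1'^2+\zeta_2'^2)>1$ (so that $\phi$ is space-like), and $$f\zeta_1''=f'\zeta_1'\bigl(2f^2(\zeta_1'^2+\zeta_2'^2)-3\bigr)+\frac{f^2(\zeta_1'^2+\zeta_2'^2)-1}{f\zeta_1},\qquad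 f\zeta_2''=f'\zeta_2'\bigl(2f^2(\zeta_1'^2+\zeta_2'^2)-3\bigr).$$ Here "locally congruent" means: every point of $M$ has a neighbourhood with smooth coordinates $(u,v)$ in which the immersion, composed with an isometry of $L^4_1(f,0)$ onto itself that preserves the vector field $\partial/\partial t$, is given by such a $\phi(u,v)$. The functions $\zeta_1,\zeta_2$, the interval $J$ and the isometry may depend on the point. -/

import Mathlib

open scoped Manifold ContDiff

noncomputable section

namespace RobertsonWalker

/-- Euclidean space of dimension `n`. -/
abbrev E (n : ℕ) : Type := EuclideanSpace ℝ (Fin n)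

/-- The linear space `ℝ × 𝔼³` which contains the space-time as an open subset; all tangent spaces
of the space-time are identified with it. -/
abbrev W : Type := ℝ × E 3

/-- The set of points `I × 𝔼³` of the Robertson-Walker space-time `L⁴₁(f,0)`. -/
def spacetime (I : Set ℝ) : Set W := {P | P.1 ∈ I}

/-- The warped product metric `-dt² + f(t)² g₀` at the point `P`. -/
def metric (f : ℝ → ℝ) (P X Y : W) : ℝ :=
  -(X.1 * Y.1) + f P.1 ^ 2 * inner ℝ X.2 Y.2

/-- The comoving observer field `∂/∂t`. -/
def dt : W := (1, 0)

/-- The Christoffel tensor of the Levi-Civita connection `∇̃` of the metric with respect to the flat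
connection `∇⁰` of `ℝ × 𝔼³`, that is `∇̃_X Y = ∇⁰_X Y + christoffel f P X Y`, with
`christoffel f P X Y = (ln f)' (g̃(X̄,Ȳ) ∂/∂t + X₀ Ȳ + Y₀ X̄)`.
The two lemmas below show that it is the Levi-Civita connection. -/
def christoffel (f : ℝ → ℝ) (P X Y : W) : W :=
  (deriv f P.1 / f P.1) • (f P.1 ^ 2 * inner ℝ X.2 Y.2, X.1 • Y.2 + Y.1 • X.2)

/-- The connection is torsion-free. -/
theorem christoffel_symm (f : ℝ → ℝ) (P X Y : W) :
    christoffel f P X Y = christoffel f P Y X := by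
  unfold christoffel
  rw [real_inner_comm, add_comm (X.1 • Y.2)]

/-- The connection is compatible with the metric: the derivative of `g̃(Y,Z)` in the direction `X`,
for constant (i.e. `∇⁰`-parallel) `Y` and `Z`, is `g̃(∇̃_X Y, Z) + g̃(Y, ∇̃_X Z)`. -/
theorem christoffel_metric (f : ℝ → ℝ) (P X Y Z : W) (hf : DifferentiableAt ℝ f P.1)
    (h0 : f P.1 ≠ 0) :
    fderiv ℝ (fun Q : W => metric f Q Y Z) P X =
      metric f P (christoffel f P X Y) Z + metric f P Y (christoffel f P X Z) := by
  have h1 : HasFDerivAt (fun Q : W => f Q.1)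
      ((ContinuousLinearMap.toSpanSingleton ℝ (deriv f P.1)).comp (ContinuousLinearMap.fst ℝ ℝ (E 3))) P :=
    (hf.hasDerivAt.hasFDerivAt).comp P (hasFDerivAt_fst)
  have h2 : HasFDerivAt (fun Q : W => metric f Q Y Z) _ P :=
    ((h1.pow 2).mul_const (inner ℝ Y.2 Z.2)).const_add (-(Y.1 * Z.1))
  rw [h2.fderiv]
  simp [metric, christoffel, inner_add_left, inner_add_right, inner_smul_left, inner_smul_right]
  rw [real_inner_comm X.2 Y.2]
  field_simp
  ring

/-! ### Geometry of a parametrized submanifold `x : E n → L⁴₁(f,0)` at a parameter value `q`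

Tangent vectors of the submanifold are represented by vectors of the parameter space `E n`; such
a vector `v` corresponds to the vector `fderiv ℝ x q v` of the space-time. -/

/-- The induced metric `g`. -/
def inducedMetric (f : ℝ → ℝ) {n : ℕ} (x : E n → W) (q v w : E n) : ℝ :=
  metric f (x q) (fderiv ℝ x q v) (fderiv ℝ x q w)

/-- The induced metric is nondegenerate. -/
def IsNondegenerateAt (f : ℝ → ℝ) {n : ℕ} (x : E n → W) (q : E n) : Prop :=
  ∀ v : E n, (∀ w : E n, inducedMetric f x q v w = 0) → v = 0

/-- The induced metric is positive definite (so `x` is a space-like immersion at `q`). -/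
def IsSpacelikeAt (f : ℝ → ℝ) {n : ℕ} (x : E n → W) (q : E n) : Prop :=
  ∀ v : E n, v ≠ 0 → 0 < inducedMetric f x q v v

/-- The tangent vector that represents the linear functional `l` with respect to the induced
metric; see `sharp_spec`. -/
def sharp (f : ℝ → ℝ) {n : ℕ} (x : E n → W) (q : E n) (l : E n → ℝ) : E n :=
  Classical.epsilon fun v => ∀ w, inducedMetric f x q v w = l w

theorem sharp_spec (f : ℝ → ℝ) {n : ℕ} (x : E n → W) (q : E n) (h : IsNondegenerateAt f x q)
    (l : E n →ₗ[ℝ] ℝ) (w : E n) : inducedMetric f x q (sharp f x q l) w = l w := by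
  let B : E n →ₗ[ℝ] (E n →ₗ[ℝ] ℝ) := LinearMap.mk₂ ℝ (inducedMetric f x q)
    (by intros; simp [inducedMetric, metric, inner_add_left]; ring)
    (by intros; simp [inducedMetric, metric, inner_smul_left]; ring)
    (by intros; simp [inducedMetric, metric, inner_add_right]; ring)
    (by intros; simp [inducedMetric, metric, inner_smul_right]; ring)
  have hinj : Function.Injective B := by
    rw [injective_iff_map_eq_zero]
    intro v hv
    exact h v fun w => by simpa [B] using LinearMap.congr_fun hv w
  have hsurj : Function.Surjective B :=
    (LinearMap.injective_iff_surjective_of_finrank_eq_finrank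
      (by rw [Subspace.dual_finrank_eq (K := ℝ) (V := E n)])).1 hinj
  obtain ⟨v, hv⟩ := hsurj l
  have key : ∃ v, ∀ w, inducedMetric f x q v w = l w :=
    ⟨v, fun w => by simpa [B] using LinearMap.congr_fun hv w⟩
  exact Classical.epsilon_spec key w

/-- The tangential part of a vector `X` of the space-time at `x q`. -/
def tangentPart (f : ℝ → ℝ) {n : ℕ} (x : E n → W) (q : E n) (X : W) : E n :=
  sharp f x q fun w => metric f (x q) X (fderiv ℝ x q w)

/-- The normal part of a vector `X` of the space-time at `x q`. -/
def normalPart (f : ℝ → ℝ) {n : ℕ} (x : E n → W) (q : E n) (X : W) : W :=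
  X - fderiv ℝ x q (tangentPart f x q X)

/-- `ξ` is a normal vector. -/
def IsNormal (f : ℝ → ℝ) {n : ℕ} (x : E n → W) (q : E n) (ξ : W) : Prop :=
  ∀ w : E n, metric f (x q) ξ (fderiv ℝ x q w) = 0

/-- The second fundamental form `h(v,w) = (∇̃_v w)^⊥`, by the Gauss formula (for `v`, `w` extended
as constant combinations of the coordinate fields). -/
def secondFundamentalForm (f : ℝ → ℝ) {n : ℕ} (x : E n → W) (q v w : E n) : W :=
  normalPart f x q
    (fderiv ℝ (fderiv ℝ x) q v w + christoffel f (x q) (fderiv ℝ x q v) (fderiv ℝ x q w))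

/-- The shape operator `A_ξ`, determined by `g(A_ξ v, w) = g̃(h(v,w), ξ)`. -/
def shapeOperator (f : ℝ → ℝ) {n : ℕ} (x : E n → W) (q : E n) (ξ : W) (v : E n) : E n :=
  sharp f x q fun w => metric f (x q) (secondFundamentalForm f x q v w) ξ

/-- The matrix of the induced metric in the coordinate frame. -/
def gram (f : ℝ → ℝ) {n : ℕ} (x : E n → W) (q : E n) : Matrix (Fin n) (Fin n) ℝ :=
  Matrix.of fun i j =>
    inducedMetric f x q (EuclideanSpace.single i 1) (EuclideanSpace.single j 1)

/-- The mean curvature vector `H = (1/n) tr h = (1/n) ∑ gⁱʲ h(∂ᵢ,∂ⱼ)`. -/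
def meanCurvature (f : ℝ → ℝ) {n : ℕ} (x : E n → W) (q : E n) : W :=
  (1 / (n : ℝ)) • ∑ i, ∑ j, (gram f x q)⁻¹ i j •
    secondFundamentalForm f x q (EuclideanSpace.single i 1) (EuclideanSpace.single j 1)

/-- The tangential part `T` of `∂/∂t` is an eigenvector (in particular nonzero) of every
shape operator. -/
def IsClassAAt (f : ℝ → ℝ) {n : ℕ} (x : E n → W) (q : E n) : Prop :=
  tangentPart f x q dt ≠ 0 ∧
    ∀ ξ : W, IsNormal f x q ξ →
      ∃ c : ℝ, shapeOperator f x q ξ (tangentPart f x q dt) = c • tangentPart f x q dt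

/-- `y : D → L⁴₁(f,0)`, with `D` open in `ℝ³`, parametrizes a (nondegenerate) totally geodesic
hypersurface. -/
structure IsTotallyGeodesicHypersurface (f : ℝ → ℝ) (I : Set ℝ) (D : Set (E 3))
    (y : E 3 → W) : Prop where
  isOpen : IsOpen D
  smooth : ContDiffOn ℝ ∞ y D
  mapsTo : Set.MapsTo y D (spacetime I)
  nondegenerate : ∀ q ∈ D, IsNondegenerateAt f y q
  totallyGeodesic : ∀ q ∈ D, ∀ v w : E 3, secondFundamentalForm f y q v w = 0

/-! ### Space-like surfaces

A surface is a smooth 2-manifold `M` with a smooth map `φ` into the space-time. Its geometry is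
that of the local parametrizations `φ ∘ e.symm`, where `e` runs over all smooth charts of `M`. -/

section Surface

variable {M : Type*} [TopologicalSpace M] [ChartedSpace (E 2) M]

/-- `φ : M → L⁴₁(f,0)` is a smooth immersion of a 2-manifold whose induced metric is Riemannian. -/
structure IsSpacelikeSurface (f : ℝ → ℝ) (I : Set ℝ) (φ : M → W) : Prop where
  smooth : ContMDiff (𝓡 2) 𝓘(ℝ, W) ∞ φ
  mem : ∀ p, φ p ∈ spacetime I
  spacelike : ∀ e ∈ IsManifold.maximalAtlas (𝓡 2) ∞ M, ∀ q ∈ e.target,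
    IsSpacelikeAt f (φ ∘ e.symm) q

/-- The mean curvature vector vanishes everywhere. -/
def IsMinimal (f : ℝ → ℝ) (φ : M → W) : Prop :=
  ∀ e ∈ IsManifold.maximalAtlas (𝓡 2) ∞ M, ∀ q ∈ e.target, meanCurvature f (φ ∘ e.symm) q = 0

/-- The surface is of class `𝒜`. -/
def IsClassA (f : ℝ → ℝ) (φ : M → W) : Prop :=
  ∀ e ∈ IsManifold.maximalAtlas (𝓡 2) ∞ M, ∀ q ∈ e.target, IsClassAAt f (φ ∘ e.symm) q

/-- Some nonempty open part of the surface lies in a totally geodesic hypersurface. -/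
def HasTotallyGeodesicPart (f : ℝ → ℝ) (I : Set ℝ) (φ : M → W) : Prop :=
  ∃ U : Set M, IsOpen U ∧ U.Nonempty ∧ ∃ (D : Set (E 3)) (y : E 3 → W),
    IsTotallyGeodesicHypersurface f I D y ∧ φ '' U ⊆ y '' D

/-- `Ψ` restricts to an isometry of `L⁴₁(f,0)` onto itself which preserves `∂/∂t`. -/
structure IsCongruence (f : ℝ → ℝ) (I : Set ℝ) (Ψ : W → W) : Prop where
  bijOn : Set.BijOn Ψ (spacetime I) (spacetime I)
  smooth : ContDiffOn ℝ ∞ Ψ (spacetime I)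
  isometry : ∀ P ∈ spacetime I, ∀ X Y : W,
    metric f (Ψ P) (fderiv ℝ Ψ P X) (fderiv ℝ Ψ P Y) = metric f P X Y
  observer : ∀ P ∈ spacetime I, fderiv ℝ Ψ P dt = dt

/-- The rotational surface `(u, ζ₁(u) cos v, ζ₁(u) sin v, ζ₂(u))`. -/
def rotational (ζ₁ ζ₂ : ℝ → ℝ) (q : E 2) : W :=
  (q 0, !₂[ζ₁ (q 0) * Real.cos (q 1), ζ₁ (q 0) * Real.sin (q 1), ζ₂ (q 0)])

/-- `ζ₁ > 0` and `ζ₂` are smooth functions on the open interval `J ⊆ I`, the rotational surface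
that they define is space-like, and they solve
`f ζ₁'' = f' ζ₁' (2 f² (ζ₁'² + ζ₂'²) - 3) + (f² (ζ₁'² + ζ₂'²) - 1) / (f ζ₁)`,
`f ζ₂'' = f' ζ₂' (2 f² (ζ₁'² + ζ₂'²) - 3)`. -/
structure IsMinimalProfile (f : ℝ → ℝ) (I J : Set ℝ) (ζ₁ ζ₂ : ℝ → ℝ) : Prop where
  isOpen : IsOpen J
  ordConnected : J.OrdConnected
  subset : J ⊆ I
  smooth₁ : ContDiffOn ℝ ∞ ζ₁ J
  smooth₂ : ContDiffOn ℝ ∞ ζ₂ J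
  pos : ∀ u ∈ J, 0 < ζ₁ u
  spacelike : ∀ u ∈ J, 1 < f u ^ 2 * (deriv ζ₁ u ^ 2 + deriv ζ₂ u ^ 2)
  ode₁ : ∀ u ∈ J, f u * deriv (deriv ζ₁) u =
    deriv f u * deriv ζ₁ u * (2 * f u ^ 2 * (deriv ζ₁ u ^ 2 + deriv ζ₂ u ^ 2) - 3)
      + (f u ^ 2 * (deriv ζ₁ u ^ 2 + deriv ζ₂ u ^ 2) - 1) / (f u * ζ₁ u)
  ode₂ : ∀ u ∈ J, f u * deriv (deriv ζ₂) u =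
    deriv f u * deriv ζ₂ u * (2 * f u ^ 2 * (deriv ζ₁ u ^ 2 + deriv ζ₂ u ^ 2) - 3)

/-- Around every point of `M` there is a smooth chart with coordinates `(u,v)` in which `φ` is, up
to a congruence of the space-time, a rotational surface whose profile solves the system above. -/
def IsLocallyRotationalMinimal (f : ℝ → ℝ) (I : Set ℝ) (φ : M → W) : Prop :=
  ∀ p : M, ∃ e ∈ IsManifold.maximalAtlas (𝓡 2) ∞ M, p ∈ e.source ∧
    ∃ (J : Set ℝ) (ζ₁ ζ₂ : ℝ → ℝ) (Ψ : W → W),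
      IsMinimalProfile f I J ζ₁ ζ₂ ∧ IsCongruence f I Ψ ∧
        ∀ q ∈ e.target, q 0 ∈ J ∧ Ψ (φ (e.symm q)) = rotational ζ₁ ζ₂ q

end Surface

end RobertsonWalker

end

noncomputable section

namespace RobertsonWalker

open Filter Topology

/-! ### Pointwise algebra -/

/-! Write the surface locally as `x = (t, X)`. Since `T ≠ 0`, the differential of `t` never
vanishes, so the level curves of `t` foliate the surface. Choose fields `a`, `b` with `a(t) = 1`,
`b(t) = 0`, `|b(X)| = 1` and `a(X) ⟂ b(X)`, and put `P = a(X)`, `w = b(X)`, `n = b(w)`, `τ = ⟨P,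
n⟩`. Then `T` is a multiple of `a`, and class `𝒜` says that `∇̃_a b` is tangent. The Christoffel
term of `(a, b)` is already a multiple of `w`, so this amounts to `a(w) = 0`. Minimality becomes an
equation `a(P) = c P - κ n` with `κ = |P|² - f⁻² > 0` (`exists_isAdaptedFrame`).

Together these force `[a, b] = τ b`, `b(P) = -τ w` and `a(n) = τ n`. The coefficients `c` and `κ`
are constant along `b`; differentiating the minimality equation along `b` therefore shows that
`b(n)` is a multiple of `w`, namely `-|n|² w` (`along_b_n`). So the level curves have constant
curvature `|n|` and lie in planes: they are arcs of circles or lines. Moreover `|n|²` satisfies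
`a(g) = 2τ g`, `b(g) = 0`, so on a convex domain it vanishes everywhere or nowhere.

If `n = 0`, then `w` is constant and a linear equation keeps `P` perpendicular to a fixed vector:
the surface lies in `ℝ ×` a plane, which is totally geodesic and excluded (`exists_plane`). If `n ≠
0`, the circles have radius `r = 1/|n|` and their planes share one normal `m`. Their centres lie on
one line parallel to `m`, so the surface is rotational about it (`exists_isCylindrical`). The radius
and the height depend on `t` only, and the components of the minimality equation normal and parallel
to the axis are the two profile equations. The inverse function theorem makes time and angle into a
chart (`exists_chart`).

Conversely, on a rotational surface `∇̃_{∂u} ∂v` is a multiple of `∂v`, which gives class `𝒜`, and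
the profile equations make the trace of `∇̃` tangent. Both facts are transported to an arbitrary
chart: isometries preserve the connection (`christoffel_map`), and a change of parameters adds only
tangent terms (`accel_comp`). -/

theorem metric_add_left (f : ℝ → ℝ) (P X Y Z : W) :
    metric f P (X + Y) Z = metric f P X Z + metric f P Y Z := by
  simp [metric, inner_add_left]; ring

theorem metric_smul_left (f : ℝ → ℝ) (P : W) (c : ℝ) (X Z : W) :
    metric f P (c • X) Z = c * metric f P X Z := by
  simp [metric, inner_smul_left]; ring

theorem metric_comm (f : ℝ → ℝ) (P X Y : W) : metric f P X Y = metric f P Y X := by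
  simp only [metric, real_inner_comm, mul_comm]

theorem metric_add_right (f : ℝ → ℝ) (P X Y Z : W) :
    metric f P Z (X + Y) = metric f P Z X + metric f P Z Y := by
  simp only [metric_comm f P Z, metric_add_left]

theorem metric_smul_right (f : ℝ → ℝ) (P : W) (c : ℝ) (X Z : W) :
    metric f P Z (c • X) = c * metric f P Z X := by
  simp only [metric_comm f P Z, metric_smul_left]

theorem metric_neg_left (f : ℝ → ℝ) (P X Z : W) : metric f P (-X) Z = -metric f P X Z := by
  simpa using metric_smul_left f P (-1) X Z

theorem metric_sub_left (f : ℝ → ℝ) (P X Y Z : W) :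
    metric f P (X - Y) Z = metric f P X Z - metric f P Y Z := by
  rw [sub_eq_add_neg, metric_add_left, metric_neg_left, sub_eq_add_neg]

/-- The metric of the space-time is nondegenerate. -/
theorem eq_zero_of_metric_eq_zero {f : ℝ → ℝ} {P X : W} (h0 : f P.1 ≠ 0)
    (h : ∀ Y, metric f P X Y = 0) : X = 0 := by
  have h1 := h (1, 0)
  have h2 := h (0, X.2)
  simp [metric, h0] at h1 h2
  exact Prod.ext h1 h2

section Pointwise

variable {f : ℝ → ℝ} {n : ℕ} {x : E n → W} {q : E n}

theorem inducedMetric_comm (f : ℝ → ℝ) (x : E n → W) (q v w : E n) :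
    inducedMetric f x q v w = inducedMetric f x q w v := metric_comm _ _ _ _

theorem inducedMetric_add_left (f : ℝ → ℝ) (x : E n → W) (q v v' w : E n) :
    inducedMetric f x q (v + v') w = inducedMetric f x q v w + inducedMetric f x q v' w := by
  simp only [inducedMetric, map_add, metric_add_left]

theorem inducedMetric_smul_left (f : ℝ → ℝ) (x : E n → W) (q : E n) (c : ℝ) (v w : E n) :
    inducedMetric f x q (c • v) w = c * inducedMetric f x q v w := by
  simp only [inducedMetric, map_smul, metric_smul_left]

theorem inducedMetric_sub_left (f : ℝ → ℝ) (x : E n → W) (q v v' w : E n) :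
    inducedMetric f x q (v - v') w = inducedMetric f x q v w - inducedMetric f x q v' w := by
  simp only [inducedMetric, map_sub, metric_sub_left]

theorem inducedMetric_add_right (f : ℝ → ℝ) (x : E n → W) (q v v' w : E n) :
    inducedMetric f x q w (v + v') = inducedMetric f x q w v + inducedMetric f x q w v' := by
  simp only [inducedMetric_comm f x q w, inducedMetric_add_left]

theorem inducedMetric_smul_right (f : ℝ → ℝ) (x : E n → W) (q : E n) (c : ℝ) (v w : E n) :
    inducedMetric f x q w (c • v) = c * inducedMetric f x q w v := by
  simp only [inducedMetric_comm f x q w, inducedMetric_smul_left]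

theorem IsSpacelikeAt.isNondegenerateAt (h : IsSpacelikeAt f x q) : IsNondegenerateAt f x q := by
  intro v hv
  by_contra h0
  exact (h v h0).ne' (hv v)

theorem tangentPart_spec (h : IsNondegenerateAt f x q) (X : W) (w : E n) :
    inducedMetric f x q (tangentPart f x q X) w = metric f (x q) X (fderiv ℝ x q w) :=
  sharp_spec f x q h
    { toFun := fun w => metric f (x q) X (fderiv ℝ x q w)
      map_add' := by simp [metric_add_right]
      map_smul' := by simp [metric_smul_right] } w

theorem eq_tangentPart (h : IsNondegenerateAt f x q) {X : W} {v : E n}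
    (hv : ∀ w, inducedMetric f x q v w = metric f (x q) X (fderiv ℝ x q w)) :
    tangentPart f x q X = v := by
  rw [← sub_eq_zero]
  refine h _ fun w => ?_
  rw [inducedMetric_sub_left, tangentPart_spec h, hv, sub_self]

theorem tangentPart_add (h : IsNondegenerateAt f x q) (X Y : W) :
    tangentPart f x q (X + Y) = tangentPart f x q X + tangentPart f x q Y :=
  eq_tangentPart h fun w => by
    rw [inducedMetric_add_left, tangentPart_spec h, tangentPart_spec h, metric_add_left]

theorem tangentPart_smul (h : IsNondegenerateAt f x q) (c : ℝ) (X : W) :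
    tangentPart f x q (c • X) = c • tangentPart f x q X :=
  eq_tangentPart h fun w => by
    rw [inducedMetric_smul_left, tangentPart_spec h, metric_smul_left]

theorem normalPart_add (h : IsNondegenerateAt f x q) (X Y : W) :
    normalPart f x q (X + Y) = normalPart f x q X + normalPart f x q Y := by
  simp only [normalPart, tangentPart_add h, map_add]; abel

theorem normalPart_smul (h : IsNondegenerateAt f x q) (c : ℝ) (X : W) :
    normalPart f x q (c • X) = c • normalPart f x q X := by
  simp only [normalPart, tangentPart_smul h, map_smul, smul_sub]

theorem isNormal_normalPart (h : IsNondegenerateAt f x q) (X : W) :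
    IsNormal f x q (normalPart f x q X) := fun w => by
  rw [normalPart, metric_sub_left, ← tangentPart_spec h]
  exact sub_self _

/-- This turns every vanishing statement about `h` or `H` into tangency of an explicit vector, so
that the projections defined by choice need not be computed. -/
theorem normalPart_eq_zero_iff (h : IsNondegenerateAt f x q) {X : W} :
    normalPart f x q X = 0 ↔ ∃ v, fderiv ℝ x q v = X := by
  constructor
  · intro h0
    exact ⟨_, (sub_eq_zero.1 h0).symm⟩
  · rintro ⟨v, rfl⟩
    rw [normalPart, eq_tangentPart h (v := v) fun w => rfl, sub_self]

/-- The full second derivative `∇̃_v w`. -/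
def accel (f : ℝ → ℝ) (x : E n → W) (q v w : E n) : W :=
  fderiv ℝ (fderiv ℝ x) q v w + christoffel f (x q) (fderiv ℝ x q v) (fderiv ℝ x q w)

theorem christoffel_add_left (f : ℝ → ℝ) (P X X' Y : W) :
    christoffel f P (X + X') Y = christoffel f P X Y + christoffel f P X' Y := by
  unfold christoffel
  rw [← smul_add]
  congr 1
  ext1
  · simp [inner_add_left]; ring
  · simp [add_smul]; abel

theorem christoffel_smul_left (f : ℝ → ℝ) (P X Y : W) (c : ℝ) :
    christoffel f P (c • X) Y = c • christoffel f P X Y := by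
  unfold christoffel
  rw [smul_comm c]
  congr 1
  ext1
  · simp [inner_smul_left]; ring
  · simp only [Prod.smul_fst, Prod.smul_snd, Prod.smul_mk, smul_add, smul_smul, smul_eq_mul]
    rw [mul_comm Y.1]

theorem christoffel_add_right (f : ℝ → ℝ) (P X X' Y : W) :
    christoffel f P Y (X + X') = christoffel f P Y X + christoffel f P Y X' := by
  simp only [christoffel_symm f P Y, christoffel_add_left]

theorem christoffel_smul_right (f : ℝ → ℝ) (P X Y : W) (c : ℝ) :
    christoffel f P Y (c • X) = c • christoffel f P Y X := by
  simp only [christoffel_symm f P Y, christoffel_smul_left]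

theorem accel_add_left (f : ℝ → ℝ) (x : E n → W) (q v v' w : E n) :
    accel f x q (v + v') w = accel f x q v w + accel f x q v' w := by
  simp only [accel, map_add, christoffel_add_left, add_apply]; abel

theorem accel_add_right (f : ℝ → ℝ) (x : E n → W) (q v v' w : E n) :
    accel f x q w (v + v') = accel f x q w v + accel f x q w v' := by
  simp only [accel, map_add, christoffel_add_right]; abel

theorem accel_smul_left (f : ℝ → ℝ) (x : E n → W) (q v w : E n) (c : ℝ) :
    accel f x q (c • v) w = c • accel f x q v w := by
  simp only [accel, map_smul, christoffel_smul_left, smul_apply, smul_add]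

theorem accel_smul_right (f : ℝ → ℝ) (x : E n → W) (q v w : E n) (c : ℝ) :
    accel f x q w (c • v) = c • accel f x q w v := by
  simp only [accel, map_smul, christoffel_smul_right, smul_add]

theorem accel_comm (hx : IsSymmSndFDerivAt ℝ x q) (v w : E n) :
    accel f x q v w = accel f x q w v := by
  rw [accel, accel, hx, christoffel_symm]

theorem secondFundamentalForm_eq_zero_iff (h : IsNondegenerateAt f x q) {v w : E n} :
    secondFundamentalForm f x q v w = 0 ↔ ∃ u, fderiv ℝ x q u = accel f x q v w :=
  normalPart_eq_zero_iff h

theorem shapeOperator_spec (h : IsNondegenerateAt f x q) (ξ : W) (v w : E n) :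
    inducedMetric f x q (shapeOperator f x q ξ v) w =
      metric f (x q) (secondFundamentalForm f x q v w) ξ :=
  sharp_spec f x q h
    { toFun := fun w => metric f (x q) (secondFundamentalForm f x q v w) ξ
      map_add' := fun w w' => by
        change metric f _ (normalPart f x q (accel f x q v (w + w'))) ξ = _
        rw [accel_add_right, normalPart_add h, metric_add_left]; rfl
      map_smul' := fun c w => by
        change metric f _ (normalPart f x q (accel f x q v (c • w))) ξ = _
        rw [accel_smul_right, normalPart_smul h, metric_smul_left]; rfl } w

/-- Every vector splits into a normal and a tangential part, so a normal vector orthogonal to all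
normal vectors is orthogonal to everything, and the ambient metric is nondegenerate. -/
theorem eq_zero_of_isNormal (h0 : f (x q).1 ≠ 0) (h : IsNondegenerateAt f x q) {η : W}
    (hη : IsNormal f x q η) (hηη : ∀ ξ, IsNormal f x q ξ → metric f (x q) η ξ = 0) : η = 0 := by
  refine eq_zero_of_metric_eq_zero h0 fun Y => ?_
  have hY : Y = normalPart f x q Y + fderiv ℝ x q (tangentPart f x q Y) := by simp [normalPart]
  rw [hY, metric_add_right, hηη _ (isNormal_normalPart h Y), hη, add_zero]

end Pointwise

/-! ### Minimality and class `𝒜` in an orthogonal tangent frame -/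

section Surface

variable {f : ℝ → ℝ} {x : E 2 → W} {q : E 2}

/-- Cramer's rule. -/
theorem exists_add_smul_eq {a b : E 2} (hΔ : a 0 * b 1 - a 1 * b 0 ≠ 0) (v : E 2) :
    ∃ α β : ℝ, α • a + β • b = v := by
  refine ⟨(v 0 * b 1 - v 1 * b 0) / (a 0 * b 1 - a 1 * b 0),
    (a 0 * v 1 - a 1 * v 0) / (a 0 * b 1 - a 1 * b 0), ?_⟩
  ext i
  fin_cases i <;> simp <;> rw [div_mul_eq_mul_div, div_mul_eq_mul_div, ← add_div, div_eq_iff hΔ] <;>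
    ring

theorem eq_single_add_single (v : E 2) :
    v = v 0 • EuclideanSpace.single 0 1 + v 1 • EuclideanSpace.single 1 1 := by
  ext i
  fin_cases i <;> simp

/-- A vanishing determinant would make each coordinate of `b`, times `a`, a multiple of `b`. Pairing
with `a` then kills that coordinate, by orthogonality and positivity. -/
theorem det_ne_zero_of_orthogonal (h : IsSpacelikeAt f x q) {a b : E 2} (ha : a ≠ 0) (hb : b ≠ 0)
    (hab : inducedMetric f x q a b = 0) : a 0 * b 1 - a 1 * b 0 ≠ 0 := by
  intro h0
  have h1 : b 1 • a = a 1 • b := by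
    ext i
    fin_cases i
    · simp; linarith
    · simp; ring
  have h2 : b 0 • a = a 0 • b := by
    ext i
    fin_cases i
    · simp; ring
    · simp; linarith
  have key : ∀ s r : ℝ, s • a = r • b → s = 0 := by
    intro s r hsr
    have := congrArg (fun v => inducedMetric f x q v a) hsr
    simp only [inducedMetric_smul_left, inducedMetric_comm f x q b a, hab, mul_zero] at this
    exact (mul_eq_zero.1 this).resolve_right (h a ha).ne'
  apply hb
  ext i
  fin_cases i
  · exact key _ _ h2
  · exact key _ _ h1

/-- In an orthogonal frame the inverse metric is `a ⊗ a / g(a,a) + b ⊗ b / g(b,b)`, so the trace of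
`h` needs no Gram matrix. The symmetry of the second derivative merges the two mixed terms. -/
theorem meanCurvature_eq_zero_iff (hsym : IsSymmSndFDerivAt ℝ x q) (h : IsSpacelikeAt f x q)
    {a b : E 2} (ha : a ≠ 0) (hb : b ≠ 0) (hab : inducedMetric f x q a b = 0) :
    meanCurvature f x q = 0 ↔ ∃ v, fderiv ℝ x q v =
      (inducedMetric f x q a a)⁻¹ • accel f x q a a +
        (inducedMetric f x q b b)⁻¹ • accel f x q b b := by
  have hΔ := det_ne_zero_of_orthogonal h ha hb hab
  have hpa := (h a ha).ne'
  have hpb := (h b hb).ne'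
  have hn := h.isNondegenerateAt
  set e₀ : E 2 := EuclideanSpace.single 0 1 with he₀
  set e₁ : E 2 := EuclideanSpace.single 1 1 with he₁
  set g₀₀ := inducedMetric f x q e₀ e₀ with h00
  set g₀₁ := inducedMetric f x q e₀ e₁ with h01
  set g₁₁ := inducedMetric f x q e₁ e₁ with h11
  have h10 : inducedMetric f x q e₁ e₀ = g₀₁ := inducedMetric_comm _ _ _ _ _
  have hg : ∀ v w : E 2, inducedMetric f x q v w =
      v 0 * w 0 * g₀₀ + (v 0 * w 1 + v 1 * w 0) * g₀₁ + v 1 * w 1 * g₁₁ := by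
    intro v w
    conv_lhs => rw [eq_single_add_single v, eq_single_add_single w]
    simp only [inducedMetric_add_left, inducedMetric_add_right, inducedMetric_smul_left,
      inducedMetric_smul_right, ← he₀, ← he₁, h10, ← h00, ← h01, ← h11]
    ring
  have hB : ∀ v : E 2, accel f x q v v = (v 0 * v 0) • accel f x q e₀ e₀ +
      (2 * (v 0 * v 1)) • accel f x q e₀ e₁ + (v 1 * v 1) • accel f x q e₁ e₁ := by
    intro v
    conv_lhs => rw [eq_single_add_single v]
    simp only [accel_add_left, accel_add_right, accel_smul_left, accel_smul_right, ← he₀, ← he₁,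
      accel_comm hsym e₁ e₀]
    module
  -- By orthogonality the Gram determinant of `(a, b)` is `g(a,a) g(b,b)`; it is also the coordinate
  -- Gram determinant times the squared determinant of the change of frame.
  have hdet : g₀₀ * g₁₁ - g₀₁ * g₀₁ ≠ 0 := by
    have : inducedMetric f x q a a * inducedMetric f x q b b =
        (g₀₀ * g₁₁ - g₀₁ * g₀₁) * (a 0 * b 1 - a 1 * b 0) ^ 2 := by
      rw [hg] at hab
      rw [hg, hg]
      linear_combination (a 0 * b 0 * g₀₀ + (a 0 * b 1 + a 1 * b 0) * g₀₁ + a 1 * b 1 * g₁₁) * hab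
    intro h0
    rw [h0, zero_mul] at this
    exact mul_ne_zero hpa hpb this
  have hgram : gram f x q = !![g₀₀, g₀₁; g₀₁, g₁₁] := by
    ext i j
    fin_cases i <;> fin_cases j <;> simp [gram, ← he₀, ← he₁, h10, h00, h01, h11]
  have hinv : (gram f x q)⁻¹ = (g₀₀ * g₁₁ - g₀₁ * g₀₁)⁻¹ • !![g₁₁, -g₀₁; -g₀₁, g₀₀] := by
    rw [hgram, Matrix.inv_def, Matrix.adjugate_fin_two_of, Matrix.det_fin_two_of,
      Ring.inverse_eq_inv']
  have hH : meanCurvature f x q = (1 / 2 : ℝ) • normalPart f x q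
      ((inducedMetric f x q a a)⁻¹ • accel f x q a a +
        (inducedMetric f x q b b)⁻¹ • accel f x q b b) := by
    have hs : ∀ v w, secondFundamentalForm f x q v w = normalPart f x q (accel f x q v w) :=
      fun v w => rfl
    simp only [meanCurvature, Fin.sum_univ_two, hinv, hs, ← he₀, ← he₁, Nat.cast_ofNat]
    simp only [← normalPart_smul hn, ← normalPart_add hn]
    congr 2
    rw [accel_comm hsym e₁ e₀, hB a, hB b]
    simp only [Matrix.smul_apply, Matrix.of_apply, Matrix.cons_val', Matrix.cons_val_zero,
      Matrix.cons_val_one, Matrix.cons_val_fin_one, smul_eq_mul]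
    set α := inducedMetric f x q a a with hα
    set β := inducedMetric f x q b b with hβ
    have hprod : α * β = (g₀₀ * g₁₁ - g₀₁ * g₀₁) * (a 0 * b 1 - a 1 * b 0) ^ 2 := by
      rw [hg] at hab
      rw [hα, hβ, hg, hg]
      linear_combination (a 0 * b 0 * g₀₀ + (a 0 * b 1 + a 1 * b 0) * g₀₁ + a 1 * b 1 * g₁₁) * hab
    have hdinv : (g₀₀ * g₁₁ - g₀₁ * g₀₁)⁻¹ = (a 0 * b 1 - a 1 * b 0) ^ 2 / (α * β) := by
      rw [hprod]; field_simp
    -- The next three identities are the entries of the inverse metric expressed through `a` and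
    -- `b`.
    have e11 : (g₀₀ * g₁₁ - g₀₁ * g₀₁)⁻¹ * g₁₁ = α⁻¹ * (a 0 * a 0) + β⁻¹ * (b 0 * b 0) := by
      rw [hdinv]
      field_simp
      rw [hα, hβ, hg, hg]
      rw [hg] at hab
      linear_combination (-2 * a 0 * b 0) * hab
    have e01 : (g₀₀ * g₁₁ - g₀₁ * g₀₁)⁻¹ * -g₀₁ = α⁻¹ * (a 0 * a 1) + β⁻¹ * (b 0 * b 1) := by
      rw [hdinv]
      field_simp
      rw [hα, hβ, hg, hg]
      rw [hg] at hab
      linear_combination (-(a 0 * b 1 + a 1 * b 0)) * hab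
    have e00 : (g₀₀ * g₁₁ - g₀₁ * g₀₁)⁻¹ * g₀₀ = α⁻¹ * (a 1 * a 1) + β⁻¹ * (b 1 * b 1) := by
      rw [hdinv]
      field_simp
      rw [hα, hβ, hg, hg]
      rw [hg] at hab
      linear_combination (-2 * a 1 * b 1) * hab
    rw [e11, e01, e00]
    module
  rw [hH, smul_eq_zero, or_iff_right (by norm_num), normalPart_eq_zero_iff hn]

theorem metric_dt (f : ℝ → ℝ) (P X : W) : metric f P dt X = -X.1 := by
  simp [metric, dt]

/-- Since `g(T, ·) = -dt`, the vector `T` is orthogonal to `b` and hence a nonzero multiple of `a`.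
In a plane, `T` is an eigenvector of `A_ξ` exactly when `g(A_ξ T, b) = ⟨h(T,b), ξ⟩` vanishes; for
all normal `ξ` this says `h(a,b) = 0`. -/
theorem isClassAAt_iff (h0 : f (x q).1 ≠ 0) (h : IsSpacelikeAt f x q) {a b : E 2}
    (ha : (fderiv ℝ x q a).1 ≠ 0) (hb : (fderiv ℝ x q b).1 = 0) (hb0 : b ≠ 0)
    (hab : inducedMetric f x q a b = 0) :
    IsClassAAt f x q ↔ ∃ v, fderiv ℝ x q v = accel f x q a b := by
  have hn := h.isNondegenerateAt
  have ha0 : a ≠ 0 := by rintro rfl; simp at ha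
  set T := tangentPart f x q dt with hT
  have hTs : ∀ w, inducedMetric f x q T w = -(fderiv ℝ x q w).1 := fun w => by
    rw [hT, tangentPart_spec hn, metric_dt]
  have hT0 : T ≠ 0 := by
    intro hT0
    have := hTs a
    rw [hT0] at this
    simp [inducedMetric, metric] at this
    exact ha this
  obtain ⟨α, β, hαβ⟩ := exists_add_smul_eq (det_ne_zero_of_orthogonal h ha0 hb0 hab) T
  have hβ : β = 0 := by
    have := hTs b
    rw [← hαβ, inducedMetric_add_left, inducedMetric_smul_left, inducedMetric_smul_left, hab,
      hb, mul_zero, zero_add, neg_zero] at this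
    exact (mul_eq_zero.1 this).resolve_right (h b hb0).ne'
  have hTa : T = α • a := by rw [← hαβ, hβ, zero_smul, add_zero]
  have hα : α ≠ 0 := by rintro rfl; exact hT0 (by rw [hTa, zero_smul])
  have hTb : inducedMetric f x q T b = 0 := by rw [hTs, hb, neg_zero]
  have hsT : secondFundamentalForm f x q T b = α • secondFundamentalForm f x q a b := by
    change normalPart f x q (accel f x q T b) = α • normalPart f x q (accel f x q a b)
    rw [hTa, accel_smul_left, normalPart_smul hn]
  rw [← secondFundamentalForm_eq_zero_iff hn]
  constructor
  · rintro ⟨-, hA⟩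
    have : secondFundamentalForm f x q T b = 0 := by
      refine eq_zero_of_isNormal h0 hn (isNormal_normalPart hn _) fun ξ hξ => ?_
      obtain ⟨c, hc⟩ := hA ξ hξ
      rw [← shapeOperator_spec hn, hc, inducedMetric_smul_left, ← hT, hTb, mul_zero]
    rw [hsT] at this
    exact (smul_eq_zero.1 this).resolve_left hα
  · intro hs
    refine ⟨hT0, fun ξ _ => ?_⟩
    rw [hs, smul_zero] at hsT
    obtain ⟨s, r, hsr⟩ := exists_add_smul_eq (det_ne_zero_of_orthogonal h hT0 hb0 hTb)
      (shapeOperator f x q ξ T)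
    have h1 := shapeOperator_spec hn ξ T b
    rw [hsT, ← hsr, inducedMetric_add_left, inducedMetric_smul_left, inducedMetric_smul_left, hTb,
      mul_zero, zero_add] at h1
    have h2 : metric f (x q) 0 ξ = 0 := by simp [metric]
    rw [h2] at h1
    have hr : r = 0 := (mul_eq_zero.1 h1).resolve_right (h b hb0).ne'
    exact ⟨s, by rw [← hT, ← hsr, hr, zero_smul, add_zero]⟩

end Surface

/-! ### Reparametrizations and isometries -/

theorem two_le_infty : (2 : WithTop ℕ∞) ≤ ∞ := WithTop.coe_le_coe.2 (le_top : (2 : ℕ∞) ≤ ⊤)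

theorem fderiv_fderiv_comp {F G H : Type*} [NormedAddCommGroup F] [NormedSpace ℝ F]
    [NormedAddCommGroup G] [NormedSpace ℝ G] [NormedAddCommGroup H] [NormedSpace ℝ H]
    {g : G → H} {h : F → G} {q : F} (hg : ContDiffAt ℝ 2 g (h q)) (hh : ContDiffAt ℝ 2 h q)
    (v w : F) :
    fderiv ℝ (fderiv ℝ (g ∘ h)) q v w =
      fderiv ℝ (fderiv ℝ g) (h q) (fderiv ℝ h q v) (fderiv ℝ h q w) +
        fderiv ℝ g (h q) (fderiv ℝ (fderiv ℝ h) q v w) := by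
  have hg1 : ∀ᶠ y in 𝓝 q, DifferentiableAt ℝ g (h y) :=
    hh.continuousAt.eventually ((hg.eventually (by simp)).mono fun y hy =>
      hy.differentiableAt (by simp))
  have hh1 : ∀ᶠ y in 𝓝 q, DifferentiableAt ℝ h y :=
    (hh.eventually (by simp)).mono fun y hy => hy.differentiableAt (by simp)
  have heq : fderiv ℝ (g ∘ h) =ᶠ[𝓝 q] fun y => (fderiv ℝ g (h y)).comp (fderiv ℝ h y) := by
    filter_upwards [hg1, hh1] with y h1 h2
    exact fderiv_comp y h1 h2
  have hg2 : HasFDerivAt (fderiv ℝ g) (fderiv ℝ (fderiv ℝ g) (h q)) (h q) :=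
    ((hg.fderiv_right (m := 1) (by norm_num)).differentiableAt (by simp)).hasFDerivAt
  have hh2 : HasFDerivAt (fderiv ℝ h) (fderiv ℝ (fderiv ℝ h) q) q :=
    ((hh.fderiv_right (m := 1) (by norm_num)).differentiableAt (by simp)).hasFDerivAt
  have hh3 : HasFDerivAt h (fderiv ℝ h q) q := (hh.differentiableAt (by simp)).hasFDerivAt
  rw [heq.fderiv_eq, (HasFDerivAt.clm_comp (c := fun y => fderiv ℝ g (h y)) (hg2.comp q hh3) hh2).fderiv]
  simp [add_comm]

/-- The term produced by the second derivative of `ψ` is tangent to the surface. Tangency of `∇̃` is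
therefore independent of the parametrization. -/
theorem accel_comp (f : ℝ → ℝ) {m n : ℕ} {x : E n → W} {ψ : E m → E n} {q : E m}
    (hx : ContDiffAt ℝ 2 x (ψ q)) (hψ : ContDiffAt ℝ 2 ψ q) (v w : E m) :
    accel f (x ∘ ψ) q v w = accel f x (ψ q) (fderiv ℝ ψ q v) (fderiv ℝ ψ q w) +
      fderiv ℝ x (ψ q) (fderiv ℝ (fderiv ℝ ψ) q v w) := by
  simp only [accel, fderiv_fderiv_comp hx hψ,
    fderiv_comp q (hx.differentiableAt (by simp)) (hψ.differentiableAt (by simp)),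
    ContinuousLinearMap.comp_apply, Function.comp_apply]
  abel

/-- The connection is compatible with the metric along curves. -/
theorem hasDerivAt_metric {f : ℝ → ℝ} {p A B : ℝ → W} {p' A' B' : W} {s : ℝ}
    (hf : DifferentiableAt ℝ f (p s).1) (h0 : f (p s).1 ≠ 0)
    (hp : HasDerivAt p p' s) (hA : HasDerivAt A A' s) (hB : HasDerivAt B B' s) :
    HasDerivAt (fun s => metric f (p s) (A s) (B s))
      (metric f (p s) (A' + christoffel f (p s) p' (A s)) (B s) +
        metric f (p s) (A s) (B' + christoffel f (p s) p' (B s))) s := by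
  have hfp : HasDerivAt (fun s => f (p s).1) (deriv f (p s).1 * p'.1) s :=
    
    hf.hasDerivAt.comp s ((ContinuousLinearMap.fst ℝ ℝ (E 3)).hasFDerivAt.comp_hasDerivAt s hp)
  have hA₁ : HasDerivAt (fun s => (A s).1) A'.1 s := (ContinuousLinearMap.fst ℝ ℝ (E 3)).hasFDerivAt.comp_hasDerivAt s hA
  have hB₁ : HasDerivAt (fun s => (B s).1) B'.1 s := (ContinuousLinearMap.fst ℝ ℝ (E 3)).hasFDerivAt.comp_hasDerivAt s hB
  have hA₂ : HasDerivAt (fun s => (A s).2) A'.2 s := (ContinuousLinearMap.snd ℝ ℝ (E 3)).hasFDerivAt.comp_hasDerivAt s hA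
  have hB₂ : HasDerivAt (fun s => (B s).2) B'.2 s := (ContinuousLinearMap.snd ℝ ℝ (E 3)).hasFDerivAt.comp_hasDerivAt s hB
  have h := ((hA₁.mul hB₁).neg).add ((hfp.pow 2).mul (hA₂.inner ℝ hB₂))
  refine h.congr_deriv ?_
  simp only [metric, christoffel, Prod.fst_add, Prod.snd_add, Prod.smul_fst, Prod.smul_snd,
    inner_add_left, inner_add_right, inner_smul_left, inner_smul_right, smul_eq_mul,
    real_inner_comm p'.2, Pi.pow_apply, conj_trivial]
  field_simp
  push_cast
  ring

/-- An isometry preserves the Levi-Civita connection. -/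
theorem christoffel_map {f : ℝ → ℝ} {Ψ : W → W} {P : W} (hΨ : ContDiffAt ℝ 2 Ψ P)
    (hf : DifferentiableAt ℝ f P.1) (h0 : f P.1 ≠ 0)
    (hf' : DifferentiableAt ℝ f (Ψ P).1) (h0' : f (Ψ P).1 ≠ 0)
    (hiso : ∀ᶠ Q in 𝓝 P, ∀ X Y, metric f (Ψ Q) (fderiv ℝ Ψ Q X) (fderiv ℝ Ψ Q Y) = metric f Q X Y)
    (X Y : W) :
    fderiv ℝ (fderiv ℝ Ψ) P X Y + christoffel f (Ψ P) (fderiv ℝ Ψ P X) (fderiv ℝ Ψ P Y) =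
      fderiv ℝ Ψ P (christoffel f P X Y) := by
  have hsym : IsSymmSndFDerivAt ℝ Ψ P := hΨ.isSymmSndFDerivAt (by simp)
  have hisoP := hiso.self_of_nhds
  -- `S` measures how far `Ψ` is from carrying one connection to the other. It is symmetric in its
  -- first two arguments because both connections are torsion-free, and skew in the last two by
  -- differentiating the isometry condition along the line `P + s Z`.
  let S : W → W → W → ℝ := fun Z X Y => metric f (Ψ P) (fderiv ℝ (fderiv ℝ Ψ) P Z X +
    christoffel f (Ψ P) (fderiv ℝ Ψ P Z) (fderiv ℝ Ψ P X)) (fderiv ℝ Ψ P Y) -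
      metric f P (christoffel f P Z X) Y
  have hS1 : ∀ Z X Y, S Z X Y = S X Z Y := fun Z X Y => by
    simp only [S, hsym Z X, christoffel_symm f _ (fderiv ℝ Ψ P Z), christoffel_symm f P Z]
  have hS2 : ∀ Z X Y, S Z X Y = -S Z Y X := by
    intro Z X Y
    have hγ : HasDerivAt (fun s : ℝ => P + s • Z) Z 0 := by
      simpa using ((hasDerivAt_id (0 : ℝ)).smul_const Z).const_add P
    have hP : P + (0 : ℝ) • Z = P := by simp
    have hd : HasFDerivAt (fderiv ℝ Ψ) (fderiv ℝ (fderiv ℝ Ψ) P) (P + (0 : ℝ) • Z) := by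
      rw [hP]
      exact ((hΨ.fderiv_right (m := 1) (by norm_num)).differentiableAt (by simp)).hasFDerivAt
    have hd0 : HasFDerivAt Ψ (fderiv ℝ Ψ P) (P + (0 : ℝ) • Z) := by
      rw [hP]
      exact (hΨ.differentiableAt (by simp)).hasFDerivAt
    have hd1 := hd.comp_hasDerivAt (0 : ℝ) hγ
    have hA : ∀ V : W, HasDerivAt (fun s : ℝ => fderiv ℝ Ψ (P + s • Z) V)
        (fderiv ℝ (fderiv ℝ Ψ) P Z V) 0 := fun V => by
      simpa using hd1.clm_apply (hasDerivAt_const (0 : ℝ) V)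
    have hL := hasDerivAt_metric (f := f) (p := fun s : ℝ => Ψ (P + s • Z)) (by simpa using hf')
      (by simpa using h0') (hd0.comp_hasDerivAt (0 : ℝ) hγ) (hA X) (hA Y)
    have hR := hasDerivAt_metric (f := f) (p := fun s : ℝ => P + s • Z) (by simpa using hf)
      (by simpa using h0) hγ (hasDerivAt_const (0 : ℝ) X) (hasDerivAt_const (0 : ℝ) Y)
    have hcont : Tendsto (fun s : ℝ => P + s • Z) (𝓝 0) (𝓝 P) := by
      simpa using hγ.continuousAt.tendsto
    have heq : (fun s : ℝ => metric f (Ψ (P + s • Z)) (fderiv ℝ Ψ (P + s • Z) X)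
        (fderiv ℝ Ψ (P + s • Z) Y)) =ᶠ[𝓝 0] fun s : ℝ => metric f (P + s • Z) X Y :=
      (hcont.eventually hiso).mono fun s hs => hs X Y
    have := hL.unique (hR.congr_of_eventuallyEq heq)
    simp only [zero_smul, add_zero, zero_add] at this
    simp only [S]
    rw [metric_comm f (Ψ P) _ (fderiv ℝ Ψ P X), metric_comm f P (christoffel f P Z Y)]
    linarith
  -- A trilinear expression symmetric in one pair of neighbouring arguments and skew in the other
  -- vanishes, as in the uniqueness of the Levi-Civita connection.
  have hS : ∀ Z X Y, S Z X Y = 0 := fun Z X Y => by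
    have h1 := hS2 Z X Y
    have h2 := hS1 Z Y X
    have h3 := hS2 Y Z X
    have h4 := hS1 Y X Z
    have h5 := hS2 X Y Z
    have h6 := hS1 X Z Y
    linarith
  have hinj : Function.Injective (fderiv ℝ Ψ P) := by
    rw [injective_iff_map_eq_zero]
    intro V hV
    refine eq_zero_of_metric_eq_zero h0 fun Y => ?_
    rw [← hisoP, hV]
    simp [metric]
  have hsurj : Function.Surjective (fderiv ℝ Ψ P) :=
    LinearMap.injective_iff_surjective (f := (fderiv ℝ Ψ P : W →ₗ[ℝ] W)) |>.1 hinj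
  rw [← sub_eq_zero]
  refine eq_zero_of_metric_eq_zero h0' fun V => ?_
  obtain ⟨V, rfl⟩ := hsurj V
  rw [metric_sub_left, hisoP]
  exact hS X Y V

/-! ### Congruences preserving the observer field -/

section Congruence

variable {f : ℝ → ℝ} {I : Set ℝ} {Ψ : W → W}

theorem isOpen_spacetime (hI : IsOpen I) : IsOpen (spacetime I) := hI.preimage continuous_fst

theorem IsCongruence.contDiffAt (hΨ : IsCongruence f I Ψ) (hI : IsOpen I) {P : W}
    (hP : P ∈ spacetime I) : ContDiffAt ℝ ∞ Ψ P :=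
  hΨ.smooth.contDiffAt ((isOpen_spacetime hI).mem_nhds hP)

/-- Pairing with `∂/∂t` reads off minus the time component, and both the pairing and `∂/∂t` are
preserved. -/
theorem IsCongruence.fst_fderiv (hΨ : IsCongruence f I Ψ) {P : W} (hP : P ∈ spacetime I) (Y : W) :
    (fderiv ℝ Ψ P Y).1 = Y.1 := by
  have := hΨ.isometry P hP dt Y
  rw [hΨ.observer P hP, metric_dt, metric_dt] at this
  exact neg_injective this

theorem IsCongruence.fderiv_injective (hΨ : IsCongruence f I Ψ) (hf0 : ∀ t ∈ I, f t ≠ 0) {P : W}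
    (hP : P ∈ spacetime I) : Function.Injective (fderiv ℝ Ψ P) := by
  rw [injective_iff_map_eq_zero]
  intro V hV
  refine eq_zero_of_metric_eq_zero (hf0 _ hP) fun Y => ?_
  rw [← hΨ.isometry P hP, hV]
  simp [metric]

theorem IsCongruence.accel (hΨ : IsCongruence f I Ψ) (hI : IsOpen I) (hf : ContDiffOn ℝ ∞ f I)
    (hf0 : ∀ t ∈ I, f t ≠ 0) {n : ℕ} {x : E n → W} {q : E n} (hx : ContDiffAt ℝ 2 x q)
    (hq : x q ∈ spacetime I) (v w : E n) :
    accel f (Ψ ∘ x) q v w = fderiv ℝ Ψ (x q) (accel f x q v w) := by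
  have hd : ∀ t ∈ I, DifferentiableAt ℝ f t := fun t ht =>
    (hf.contDiffAt (hI.mem_nhds ht)).differentiableAt (by simp)
  have hΨ2 : ContDiffAt ℝ 2 Ψ (x q) := (hΨ.contDiffAt hI hq).of_le two_le_infty
  have hq' : Ψ (x q) ∈ spacetime I := hΨ.bijOn.mapsTo hq
  have h := christoffel_map hΨ2 (hd _ hq) (hf0 _ hq) (hd _ hq') (hf0 _ hq')
    (Filter.mem_of_superset ((isOpen_spacetime hI).mem_nhds hq) hΨ.isometry)
    (fderiv ℝ x q v) (fderiv ℝ x q w)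
  simp only [RobertsonWalker.accel, map_add, ← h, fderiv_fderiv_comp hΨ2 hx,
    fderiv_comp q (hΨ2.differentiableAt (by simp)) (hx.differentiableAt (by simp)),
    ContinuousLinearMap.comp_apply, Function.comp_apply]
  abel

end Congruence

/-! ### Rotational surfaces -/

theorem hasDerivAt_coord {m : ℕ} {g : ℝ → E m} {g' : E m} {s : ℝ} (hg : HasDerivAt g g' s)
    (i : Fin m) : HasDerivAt (fun s => g s i) (g' i) s :=
  (EuclideanSpace.proj i : E m →L[ℝ] ℝ).hasFDerivAt.comp_hasDerivAt s hg

theorem hasDerivAt_vec3 {a b c : ℝ → ℝ} {a' b' c' s : ℝ} (ha : HasDerivAt a a' s)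
    (hb : HasDerivAt b b' s) (hc : HasDerivAt c c' s) :
    HasDerivAt (fun s => (!₂[a s, b s, c s] : E 3)) !₂[a', b', c'] s := by
  have h : HasDerivAt (fun s => ![a s, b s, c s]) ![a', b', c'] s := by
    rw [hasDerivAt_pi]
    intro i
    fin_cases i
    exacts [ha, hb, hc]
  exact (EuclideanSpace.equiv (Fin 3) ℝ).symm.hasFDerivAt.comp_hasDerivAt s h

theorem contDiffAt_vec3 {F : Type*} [NormedAddCommGroup F] [NormedSpace ℝ F] {n : WithTop ℕ∞}
    {a b c : F → ℝ} {q : F} (ha : ContDiffAt ℝ n a q)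
    (hb : ContDiffAt ℝ n b q) (hc : ContDiffAt ℝ n c q) :
    ContDiffAt ℝ n (fun s => (!₂[a s, b s, c s] : E 3)) q := by
  rw [contDiffAt_euclidean]
  intro i
  fin_cases i
  exacts [ha, hb, hc]

theorem contDiff_coord {m : ℕ} (n : WithTop ℕ∞) (i : Fin m) : ContDiff ℝ n fun q : E m => q i :=
  contDiff_euclidean.1 contDiff_id i

theorem hasDerivAt_line {F : Type*} [NormedAddCommGroup F] [NormedSpace ℝ F] (q v : F) :
    HasDerivAt (fun s : ℝ => q + s • v) v 0 := by
  simpa using ((hasDerivAt_id (0 : ℝ)).smul_const v).const_add q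

/-- Derivatives of explicit maps are computed by one-variable rules along the lines `q + s v`; the
next lemma does the same for second derivatives. -/
theorem fderiv_eq_of_hasDerivAt {F G : Type*} [NormedAddCommGroup F] [NormedSpace ℝ F]
    [NormedAddCommGroup G] [NormedSpace ℝ G] {g : F → G} {q v : F} {d : G}
    (hg : DifferentiableAt ℝ g q) (hd : HasDerivAt (fun s : ℝ => g (q + s • v)) d 0) :
    fderiv ℝ g q v = d := by
  have h : HasFDerivAt g (fderiv ℝ g q) (q + (0 : ℝ) • v) := by simpa using hg.hasFDerivAt
  exact (h.comp_hasDerivAt (0 : ℝ) (hasDerivAt_line q v)).unique hd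

theorem fderiv_fderiv_eq_of_hasDerivAt {F G : Type*} [NormedAddCommGroup F] [NormedSpace ℝ F]
    [NormedAddCommGroup G] [NormedSpace ℝ G] {g : F → G} {g' : F → G} {q v w : F} {d : G}
    (hg : ContDiffAt ℝ 2 g q) (hg' : ∀ᶠ y in 𝓝 q, fderiv ℝ g y w = g' y)
    (hd : HasDerivAt (fun s : ℝ => g' (q + s • v)) d 0) :
    fderiv ℝ (fderiv ℝ g) q v w = d := by
  have h1 : DifferentiableAt ℝ (fderiv ℝ g) q :=
    (hg.fderiv_right (m := 1) (by norm_num)).differentiableAt (by simp)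
  have h2 : fderiv ℝ (fun y => fderiv ℝ g y w) q v = fderiv ℝ (fderiv ℝ g) q v w := by
    rw [(h1.hasFDerivAt.clm_apply (hasFDerivAt_const w q)).fderiv]
    simp
  rw [← h2]
  refine fderiv_eq_of_hasDerivAt (h1.clm_apply (differentiableAt_const w)) ?_
  have hc : Tendsto (fun s : ℝ => q + s • v) (𝓝 0) (𝓝 q) := by
    simpa using (hasDerivAt_line q v).continuousAt.tendsto
  exact hd.congr_of_eventuallyEq (hc.eventually hg')

section Rotational

variable {f : ℝ → ℝ} {I J : Set ℝ} {ζ₁ ζ₂ : ℝ → ℝ}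

theorem contDiffAt_rotational {n : WithTop ℕ∞} {q : E 2} (h₁ : ContDiffAt ℝ n ζ₁ (q 0))
    (h₂ : ContDiffAt ℝ n ζ₂ (q 0)) : ContDiffAt ℝ n (rotational ζ₁ ζ₂) q := by
  have c0 : ContDiffAt ℝ n (fun q : E 2 => q 0) q := (contDiff_coord n 0).contDiffAt
  have c1 : ContDiffAt ℝ n (fun q : E 2 => q 1) q := (contDiff_coord n 1).contDiffAt
  have g₁ : ContDiffAt ℝ n (fun q : E 2 => ζ₁ (q 0)) q := h₁.comp q c0
  have g₂ : ContDiffAt ℝ n (fun q : E 2 => ζ₂ (q 0)) q := h₂.comp q c0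
  exact c0.prodMk (contDiffAt_vec3 (g₁.mul c1.cos) (g₁.mul c1.sin) g₂)

theorem fderiv_rotational {q : E 2} (h₁ : ContDiffAt ℝ 2 ζ₁ (q 0))
    (h₂ : ContDiffAt ℝ 2 ζ₂ (q 0)) (v : E 2) :
    fderiv ℝ (rotational ζ₁ ζ₂) q v =
      (v 0, !₂[deriv ζ₁ (q 0) * v 0 * Real.cos (q 1) - ζ₁ (q 0) * Real.sin (q 1) * v 1,
        deriv ζ₁ (q 0) * v 0 * Real.sin (q 1) + ζ₁ (q 0) * Real.cos (q 1) * v 1,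
        deriv ζ₂ (q 0) * v 0]) := by
  refine fderiv_eq_of_hasDerivAt ((contDiffAt_rotational h₁ h₂).differentiableAt (by simp)) ?_
  have l : ∀ i, HasDerivAt (fun s : ℝ => (q + s • v) i) (v i) 0 :=
    hasDerivAt_coord (hasDerivAt_line q v)
  have d₁ : HasDerivAt (fun s : ℝ => ζ₁ ((q + s • v) 0)) (deriv ζ₁ (q 0) * v 0) 0 :=
    HasDerivAt.comp (0 : ℝ) (by simpa using (h₁.differentiableAt (by simp)).hasDerivAt) (l 0)
  have d₂ : HasDerivAt (fun s : ℝ => ζ₂ ((q + s • v) 0)) (deriv ζ₂ (q 0) * v 0) 0 :=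
    HasDerivAt.comp (0 : ℝ) (by simpa using (h₂.differentiableAt (by simp)).hasDerivAt) (l 0)
  refine ((l 0).prodMk (hasDerivAt_vec3 (d₁.mul (l 1).cos) (d₁.mul (l 1).sin) d₂)).congr_deriv ?_
  ext i
  · rfl
  · fin_cases i
    · simp; ring
    · simp; ring
    · rfl

theorem fderiv_fderiv_rotational {q : E 2} (h₁ : ContDiffAt ℝ 2 ζ₁ (q 0))
    (h₂ : ContDiffAt ℝ 2 ζ₂ (q 0)) (v w : E 2) :
    fderiv ℝ (fderiv ℝ (rotational ζ₁ ζ₂)) q v w =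
      (0, !₂[(deriv (deriv ζ₁) (q 0) * v 0 * Real.cos (q 1) -
            deriv ζ₁ (q 0) * Real.sin (q 1) * v 1) * w 0 -
          (deriv ζ₁ (q 0) * v 0 * Real.sin (q 1) + ζ₁ (q 0) * Real.cos (q 1) * v 1) * w 1,
        (deriv (deriv ζ₁) (q 0) * v 0 * Real.sin (q 1) +
            deriv ζ₁ (q 0) * Real.cos (q 1) * v 1) * w 0 +
          (deriv ζ₁ (q 0) * v 0 * Real.cos (q 1) - ζ₁ (q 0) * Real.sin (q 1) * v 1) * w 1,
        deriv (deriv ζ₂) (q 0) * v 0 * w 0]) := by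
  have hc : Continuous fun y : E 2 => y 0 := (contDiff_coord 0 0).continuous
  have hev : ∀ᶠ y in nhds q, fderiv ℝ (rotational ζ₁ ζ₂) y w =
      (w 0, !₂[deriv ζ₁ (y 0) * w 0 * Real.cos (y 1) - ζ₁ (y 0) * Real.sin (y 1) * w 1,
        deriv ζ₁ (y 0) * w 0 * Real.sin (y 1) + ζ₁ (y 0) * Real.cos (y 1) * w 1,
        deriv ζ₂ (y 0) * w 0]) := by
    filter_upwards [hc.continuousAt.eventually (h₁.eventually (by simp)),
      hc.continuousAt.eventually (h₂.eventually (by simp))] with y hy₁ hy₂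
    exact fderiv_rotational hy₁ hy₂ w
  refine fderiv_fderiv_eq_of_hasDerivAt
    (contDiffAt_rotational h₁ h₂) hev ?_
  have l : ∀ i, HasDerivAt (fun s : ℝ => (q + s • v) i) (v i) 0 :=
    hasDerivAt_coord (hasDerivAt_line q v)
  have key : ∀ ζ : ℝ → ℝ, DifferentiableAt ℝ ζ (q 0) →
      HasDerivAt (fun s : ℝ => ζ ((q + s • v) 0)) (deriv ζ (q 0) * v 0) 0 := fun ζ hζ =>
    HasDerivAt.comp (0 : ℝ) (by simpa using hζ.hasDerivAt) (l 0)
  have hd : ∀ ζ : ℝ → ℝ, ContDiffAt ℝ 2 ζ (q 0) → DifferentiableAt ℝ (deriv ζ) (q 0) :=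
    fun ζ hζ => (((hζ.fderiv_right (m := 1)
      (by norm_num)).differentiableAt (by simp)).clm_apply
        (differentiableAt_const (1 : ℝ))).congr_of_eventuallyEq (.of_forall fun _ => by simp)
  have d₁ := key _ (h₁.differentiableAt (by simp))
  have e₁ := key _ (hd _ h₁)
  have e₂ := key _ (hd _ h₂)
  refine ((hasDerivAt_const (0 : ℝ) (w 0)).prodMk (hasDerivAt_vec3
    ((((e₁.mul_const (w 0)).mul (l 1).cos).sub ((d₁.mul (l 1).sin).mul_const (w 1))))
    ((((e₁.mul_const (w 0)).mul (l 1).sin).add ((d₁.mul (l 1).cos).mul_const (w 1))))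
    (e₂.mul_const (w 0)))).congr_deriv ?_
  ext i
  · rfl
  · fin_cases i
    · simp; ring
    · simp; ring
    · simp

/-- Rotating does not change the direction of the parallels, up to the factor of the radius:
`∇̃_{∂u} ∂v = (ζ₁'/ζ₁ + f'/f) ∂v`. No profile equation enters. -/
theorem rotational_tangent {q : E 2} (h₁ : ContDiffAt ℝ 2 ζ₁ (q 0))
    (h₂ : ContDiffAt ℝ 2 ζ₂ (q 0)) (hpos : 0 < ζ₁ (q 0)) :
    ∃ v, fderiv ℝ (rotational ζ₁ ζ₂) q v =
      accel f (rotational ζ₁ ζ₂) q (EuclideanSpace.single 0 1) (EuclideanSpace.single 1 1) := by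
  refine ⟨(deriv ζ₁ (q 0) / ζ₁ (q 0) + deriv f (q 0) / f (q 0)) • EuclideanSpace.single 1 1, ?_⟩
  rw [accel, fderiv_fderiv_rotational h₁ h₂]
  simp only [fderiv_rotational h₁ h₂, christoffel, rotational]
  ext i
  · simp [EuclideanSpace.inner_eq_star_dotProduct, Fin.sum_univ_three, dotProduct]
    exact Or.inr (Or.inr (by ring))
  · fin_cases i
    · simp; field_simp; ring
    · simp; field_simp
    · simp

theorem inducedMetric_rotational {q : E 2} (h₁ : ContDiffAt ℝ 2 ζ₁ (q 0))
    (h₂ : ContDiffAt ℝ 2 ζ₂ (q 0)) (v w : E 2) :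
    inducedMetric f (rotational ζ₁ ζ₂) q v w =
      (f (q 0) ^ 2 * (deriv ζ₁ (q 0) ^ 2 + deriv ζ₂ (q 0) ^ 2) - 1) * (v 0 * w 0) +
        f (q 0) ^ 2 * ζ₁ (q 0) ^ 2 * (v 1 * w 1) := by
  simp only [inducedMetric, metric, fderiv_rotational h₁ h₂, rotational]
  simp [EuclideanSpace.inner_eq_star_dotProduct, Fin.sum_univ_three, dotProduct]
  linear_combination (f (q 0) ^ 2 * (deriv ζ₁ (q 0) ^ 2 * (v 0 * w 0) + ζ₁ (q 0) ^ 2 * (v 1 * w 1)))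
    * Real.sin_sq_add_cos_sq (q 1)

/-- The trace of `∇̃` in the orthogonal frame `∂u`, `∂v` is a multiple of `∂u`: its time component
determines the multiple, and the profile equations are what the spatial components then require. -/
theorem rotational_minimal {q : E 2} (h₁ : ContDiffAt ℝ 2 ζ₁ (q 0))
    (h₂ : ContDiffAt ℝ 2 ζ₂ (q 0)) (hζ : IsMinimalProfile f I J ζ₁ ζ₂) (hq : q 0 ∈ J)
    (h0 : f (q 0) ≠ 0) :
    ∃ v, fderiv ℝ (rotational ζ₁ ζ₂) q v =
      (f (q 0) ^ 2 * (deriv ζ₁ (q 0) ^ 2 + deriv ζ₂ (q 0) ^ 2) - 1)⁻¹ •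
        accel f (rotational ζ₁ ζ₂) q (EuclideanSpace.single 0 1) (EuclideanSpace.single 0 1) +
      (f (q 0) ^ 2 * ζ₁ (q 0) ^ 2)⁻¹ •
        accel f (rotational ζ₁ ζ₂) q (EuclideanSpace.single 1 1) (EuclideanSpace.single 1 1) := by
  have hpos := (hζ.pos _ hq).ne'
  have hE := (sub_pos.2 (hζ.spacelike _ hq)).ne'
  have o₁ := hζ.ode₁ _ hq
  have o₂ := hζ.ode₂ _ hq
  rw [accel, accel, fderiv_fderiv_rotational h₁ h₂, fderiv_fderiv_rotational h₁ h₂]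
  simp only [fderiv_rotational h₁ h₂, christoffel]
  simp only [rotational]
  have hcs := Real.sin_sq_add_cos_sq (q 1)
  generalize Real.sin (q 1) = sn at *
  generalize Real.cos (q 1) = cs at *
  generalize deriv (deriv ζ₁) (q 0) = z₁'' at *
  generalize deriv (deriv ζ₂) (q 0) = z₂'' at *
  generalize deriv ζ₁ (q 0) = z₁' at *
  generalize deriv ζ₂ (q 0) = z₂' at *
  generalize ζ₁ (q 0) = z₁ at *
  generalize deriv f (q 0) = f' at *
  generalize f (q 0) = t at *
  have e₁ : z₁'' = (f' * z₁' * (2 * t ^ 2 * (z₁' ^ 2 + z₂' ^ 2) - 3)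
      + (t ^ 2 * (z₁' ^ 2 + z₂' ^ 2) - 1) / (t * z₁)) / t := by
    rw [eq_div_iff h0, ← o₁, mul_comm]
  have e₂ : z₂'' = (f' * z₂' * (2 * t ^ 2 * (z₁' ^ 2 + z₂' ^ 2) - 3)) / t := by
    rw [eq_div_iff h0, ← o₂, mul_comm]
  obtain ⟨d, hd⟩ : ∃ d, d = t ^ 2 * (z₁' ^ 2 + z₂' ^ 2) - 1 := ⟨_, rfl⟩
  rw [← hd] at hE
  -- The coefficient is the time component of the right-hand side. Its two summands are the
  -- Christoffel contributions of `(∂u, ∂u)` and `(∂v, ∂v)`, divided by the squared lengths.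
  refine ⟨(f' * t * (z₁' ^ 2 + z₂' ^ 2) / d + f' / t) • EuclideanSpace.single 0 1, ?_⟩
  rw [← hd]
  have hL : z₁' ^ 2 + z₂' ^ 2 = (d + 1) / t ^ 2 := by rw [hd]; field_simp; ring
  have hL2 : 2 * t ^ 2 * (z₁' ^ 2 + z₂' ^ 2) = 2 * (d + 1) := by rw [hL]; field_simp
  have hL3 : t ^ 2 * (z₁' ^ 2 + z₂' ^ 2) - 1 = d := hd.symm
  rw [hL2, hL3] at e₁
  rw [hL2] at e₂
  have hI₁ : ‖(!₂[z₁' * cs, z₁' * sn, z₂'] : E 3)‖ ^ 2 = (d + 1) / t ^ 2 := by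
    rw [← hL, EuclideanSpace.norm_sq_eq]
    simp [Fin.sum_univ_three]
    linear_combination z₁' ^ 2 * hcs
  have hI₂ : ‖(!₂[-(sn * z₁), cs * z₁, 0] : E 3)‖ ^ 2 = z₁ ^ 2 := by
    rw [EuclideanSpace.norm_sq_eq]
    simp [Fin.sum_univ_three]
    linear_combination z₁ ^ 2 * hcs
  ext i
  · simp [hL]
    field_simp
    rw [hI₁, hI₂]
    field_simp
  · rw [hL, e₁, e₂]
    fin_cases i
    · simp; field_simp; ring
    · simp; field_simp; ring
    · simp; field_simp; ring

end Rotational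

/-! ### Rotational surfaces with minimal profile are minimal and of class `𝒜` -/


theorem accel_congr {f : ℝ → ℝ} {n : ℕ} {x y : E n → W} {q : E n} (h : x =ᶠ[𝓝 q] y) :
    accel f x q = accel f y q := by
  unfold accel
  rw [h.fderiv.fderiv_eq, h.fderiv_eq, h.eq_of_nhds]

section Transfer

variable {f : ℝ → ℝ} {I : Set ℝ} {Ψ : W → W} {m n : ℕ} {x : E m → W} {R : E n → W}
  {ψ : E m → E n} {q : E m}

theorem IsCongruence.fderiv_fderiv (hΨ : IsCongruence f I Ψ) (hI : IsOpen I)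
    (hx : DifferentiableAt ℝ x q) (hq : x q ∈ spacetime I) (hR : DifferentiableAt ℝ R (ψ q))
    (hψ : DifferentiableAt ℝ ψ q) (h : Ψ ∘ x =ᶠ[𝓝 q] R ∘ ψ) (v : E m) :
    fderiv ℝ Ψ (x q) (fderiv ℝ x q v) = fderiv ℝ R (ψ q) (fderiv ℝ ψ q v) := by
  have h1 := fderiv_comp q ((hΨ.contDiffAt hI hq).differentiableAt (by simp)) hx
  have h2 := fderiv_comp q hR hψ
  rw [h.fderiv_eq, h2] at h1
  exact (congrArg (fun L : E m →L[ℝ] W => L v) h1).symm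

theorem IsCongruence.inducedMetric (hΨ : IsCongruence f I Ψ) (hI : IsOpen I)
    (hx : DifferentiableAt ℝ x q) (hq : x q ∈ spacetime I) (hR : DifferentiableAt ℝ R (ψ q))
    (hψ : DifferentiableAt ℝ ψ q) (h : Ψ ∘ x =ᶠ[𝓝 q] R ∘ ψ) (v w : E m) :
    inducedMetric f x q v w = inducedMetric f R (ψ q) (fderiv ℝ ψ q v) (fderiv ℝ ψ q w) := by
  have hq' : Ψ (x q) = R (ψ q) := h.eq_of_nhds
  unfold RobertsonWalker.inducedMetric
  rw [← hΨ.isometry _ hq, hΨ.fderiv_fderiv hI hx hq hR hψ h, hΨ.fderiv_fderiv hI hx hq hR hψ h, hq']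

theorem IsCongruence.fderiv_accel (hΨ : IsCongruence f I Ψ) (hI : IsOpen I)
    (hf : ContDiffOn ℝ ∞ f I) (hf0 : ∀ t ∈ I, f t ≠ 0)
    (hx : ContDiffAt ℝ 2 x q) (hq : x q ∈ spacetime I) (hR : ContDiffAt ℝ 2 R (ψ q))
    (hψ : ContDiffAt ℝ 2 ψ q) (h : Ψ ∘ x =ᶠ[𝓝 q] R ∘ ψ) (v w : E m) :
    fderiv ℝ Ψ (x q) (RobertsonWalker.accel f x q v w) =
      RobertsonWalker.accel f R (ψ q) (fderiv ℝ ψ q v) (fderiv ℝ ψ q w) +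
        fderiv ℝ R (ψ q) (fderiv ℝ (fderiv ℝ ψ) q v w) := by
  rw [← hΨ.accel hI hf hf0 hx hq, accel_congr h, accel_comp f hR hψ]

end Transfer

section Atlas

variable {M : Type*} [TopologicalSpace M] [ChartedSpace (E 2) M]

theorem contDiffOn_transition [IsManifold (𝓡 2) ∞ M] {e e' : OpenPartialHomeomorph M (E 2)}
    (he : e ∈ IsManifold.maximalAtlas (𝓡 2) ∞ M) (he' : e' ∈ IsManifold.maximalAtlas (𝓡 2) ∞ M) :
    ContDiffOn ℝ ∞ (e' ∘ e.symm) (e.symm ≫ₕ e').source := by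
  have h := IsManifold.compatible_of_mem_maximalAtlas he he'
  rw [contDiffGroupoid, mem_groupoid_of_pregroupoid] at h
  simpa [contDiffPregroupoid] using h.1

theorem IsSpacelikeSurface.contDiffAt [IsManifold (𝓡 2) ∞ M] {f : ℝ → ℝ} {I : Set ℝ} {φ : M → W}
    (hφ : IsSpacelikeSurface f I φ) {e : OpenPartialHomeomorph M (E 2)}
    (he : e ∈ IsManifold.maximalAtlas (𝓡 2) ∞ M) {q : E 2} (hq : q ∈ e.target) :
    ContDiffAt ℝ ∞ (φ ∘ e.symm) q := by
  have h : ContMDiffOn (𝓡 2) 𝓘(ℝ, W) ∞ (φ ∘ e.symm) e.target :=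
    hφ.smooth.comp_contMDiffOn (contMDiffOn_symm_of_mem_maximalAtlas he)
  exact (contMDiffOn_iff_contDiffOn.1 h).contDiffAt (e.open_target.mem_nhds hq)

/-- The conditions are required in every chart, whereas the rotational form is given in one. The
transition map `ψ` and the congruence `Ψ` relate the two parametrizations, and the tangency
statements for `rotational` are pulled back through both. -/
theorem isMinimal_and_isClassA_of_isLocallyRotationalMinimal [IsManifold (𝓡 2) ∞ M]
    {f : ℝ → ℝ} {I : Set ℝ} {φ : M → W}
    (hI : IsOpen I) (hf : ContDiffOn ℝ ∞ f I) (hf0 : ∀ t ∈ I, f t ≠ 0)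
    (hφ : IsSpacelikeSurface f I φ) (h : IsLocallyRotationalMinimal f I φ)
    {e : OpenPartialHomeomorph M (E 2)} (he : e ∈ IsManifold.maximalAtlas (𝓡 2) ∞ M) {q : E 2}
    (hq : q ∈ e.target) :
    meanCurvature f (φ ∘ e.symm) q = 0 ∧ IsClassAAt f (φ ∘ e.symm) q := by
  obtain ⟨e', he', hp, J, ζ₁, ζ₂, Ψ, hζ, hΨ, hrot⟩ := h (e.symm q)
  set x := φ ∘ e.symm with hxdef
  set ψ := e' ∘ e.symm with hψdef
  set R := rotational ζ₁ ζ₂ with hRdef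
  have hxq : x q ∈ spacetime I := hφ.mem _
  have hx : ContDiffAt ℝ 2 x q := (hφ.contDiffAt he hq).of_le two_le_infty
  have hqs : q ∈ (e.symm ≫ₕ e').source := by simp [hq, hp]
  have hψ : ContDiffAt ℝ 2 ψ q := ((contDiffOn_transition he he').contDiffAt
    ((e.symm ≫ₕ e').open_source.mem_nhds hqs)).of_le two_le_infty
  have hψt : ψ q ∈ (e'.symm ≫ₕ e).source := by
    have h2 : e'.symm (ψ q) = e.symm q := e'.left_inv hp
    simp [hψdef, hp, e.map_target hq]
  have hχ : ContDiffAt ℝ 2 (e ∘ e'.symm) (ψ q) := ((contDiffOn_transition he' he).contDiffAt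
    ((e'.symm ≫ₕ e).open_source.mem_nhds hψt)).of_le two_le_infty
  have hψχ : ψ ∘ (e ∘ e'.symm) =ᶠ[𝓝 (ψ q)] id := by
    filter_upwards [(e'.symm ≫ₕ e).open_source.mem_nhds hψt] with y hy
    have h1 : y ∈ e'.target ∧ e'.symm y ∈ e.source := by simpa using hy
    simp [hψdef, e.left_inv h1.2, e'.right_inv h1.1]
  have hχq : (e ∘ e'.symm) (ψ q) = q := by
    simp [hψdef, e'.left_inv hp, e.right_inv hq]
  have hsurj : ∀ v, fderiv ℝ ψ q (fderiv ℝ (e ∘ e'.symm) (ψ q) v) = v := by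
    intro v
    have h1 := fderiv_comp (ψ q) (g := ψ) (f := e ∘ e'.symm)
      (by rw [hχq]; exact hψ.differentiableAt (by simp)) (hχ.differentiableAt (by simp))
    rw [hψχ.fderiv_eq, hχq, fderiv_id] at h1
    exact (congrArg (fun L : E 2 →L[ℝ] E 2 => L v) h1).symm
  -- `a` and `b` represent `∂u` and `∂v` of the rotational chart in the given chart.
  obtain ⟨a, ha⟩ : ∃ a, fderiv ℝ ψ q a = EuclideanSpace.single 0 1 := ⟨_, hsurj _⟩
  obtain ⟨b, hb⟩ : ∃ b, fderiv ℝ ψ q b = EuclideanSpace.single 1 1 := ⟨_, hsurj _⟩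
  have heq : Ψ ∘ x =ᶠ[𝓝 q] R ∘ ψ := by
    filter_upwards [(e.symm ≫ₕ e').open_source.mem_nhds hqs] with y hy
    have h1 : y ∈ e.target ∧ e.symm y ∈ e'.source := by simpa using hy
    have := (hrot (ψ y) (e'.map_source h1.2)).2
    rw [hψdef, Function.comp_apply, e'.left_inv h1.2] at this
    exact this
  have hJ : ψ q 0 ∈ J := (hrot (ψ q) (e'.map_source hp)).1
  have h₁ : ContDiffAt ℝ 2 ζ₁ (ψ q 0) :=
    (hζ.smooth₁.contDiffAt (hζ.isOpen.mem_nhds hJ)).of_le two_le_infty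
  have h₂ : ContDiffAt ℝ 2 ζ₂ (ψ q 0) :=
    (hζ.smooth₂.contDiffAt (hζ.isOpen.mem_nhds hJ)).of_le two_le_infty
  have hR : ContDiffAt ℝ 2 R (ψ q) := contDiffAt_rotational h₁ h₂
  have hf0q : f (ψ q 0) ≠ 0 := hf0 _ (hζ.subset hJ)
  have hmet : ∀ v w, inducedMetric f x q v w = _ := fun v w =>
    (hΨ.inducedMetric hI (hx.differentiableAt (by simp)) hxq (hR.differentiableAt (by simp))
      (hψ.differentiableAt (by simp)) heq v w).trans (inducedMetric_rotational h₁ h₂ _ _)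
  have hder : ∀ v, fderiv ℝ Ψ (x q) (fderiv ℝ x q v) = fderiv ℝ R (ψ q) (fderiv ℝ ψ q v) :=
    hΨ.fderiv_fderiv hI (hx.differentiableAt (by simp)) hxq (hR.differentiableAt (by simp))
      (hψ.differentiableAt (by simp)) heq
  have hacc := hΨ.fderiv_accel hI hf hf0 hx hxq hR hψ heq
  have hsp : IsSpacelikeAt f x q := hφ.spacelike e he q hq
  have ha0 : a ≠ 0 := by
    rintro rfl
    simpa using congrArg (fun v : E 2 => v 0) ha
  have hb0 : b ≠ 0 := by
    rintro rfl
    simpa using congrArg (fun v : E 2 => v 1) hb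
  have hab : inducedMetric f x q a b = 0 := by
    rw [hmet, ha, hb]; simp
  have htime : ∀ v, (fderiv ℝ x q v).1 = fderiv ℝ ψ q v 0 := fun v => by
    rw [← hΨ.fst_fderiv hxq, hder, fderiv_rotational h₁ h₂]
  -- Tangency can be tested after applying `Ψ`, whose differential is injective.
  have hlift : ∀ (X : W) (u : E 2), fderiv ℝ R (ψ q) u = fderiv ℝ Ψ (x q) X →
      ∃ v, fderiv ℝ x q v = X := fun X u hu => by
    refine ⟨fderiv ℝ (e ∘ e'.symm) (ψ q) u, hΨ.fderiv_injective hf0 hxq ?_⟩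
    rw [hder, hsurj, hu]
  constructor
  · rw [meanCurvature_eq_zero_iff (hx.isSymmSndFDerivAt (by simp)) hsp ha0 hb0 hab]
    obtain ⟨v, hv⟩ := rotational_minimal h₁ h₂ hζ hJ hf0q
    have haa : inducedMetric f x q a a =
        f (ψ q 0) ^ 2 * (deriv ζ₁ (ψ q 0) ^ 2 + deriv ζ₂ (ψ q 0) ^ 2) - 1 := by
      rw [hmet, ha]; simp
    have hbb : inducedMetric f x q b b = f (ψ q 0) ^ 2 * ζ₁ (ψ q 0) ^ 2 := by
      rw [hmet, hb]; simp
    -- The added vector accounts for the tangent second-order terms of the change of parameters.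
    refine hlift _ (v + ((inducedMetric f x q a a)⁻¹ • fderiv ℝ (fderiv ℝ ψ) q a a +
      (inducedMetric f x q b b)⁻¹ • fderiv ℝ (fderiv ℝ ψ) q b b)) ?_
    rw [map_add, hv, map_add, map_add, map_smul, map_smul, map_smul, map_smul, hacc, hacc, ha, hb,
      haa, hbb]
    module
  · rw [isClassAAt_iff (hf0 _ hxq) hsp (by rw [htime, ha]; simp) (by rw [htime, hb]; simp) hb0 hab]
    obtain ⟨v, hv⟩ := rotational_tangent (f := f) h₁ h₂ (hζ.pos _ hJ)
    refine hlift _ (v + fderiv ℝ (fderiv ℝ ψ) q a b) ?_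
    rw [map_add, hv, hacc, ha, hb]

end Atlas

/-! ### Derivatives along vector fields -/


/-- The derivative of `F` along the vector field `a`. -/
def along {V G : Type*} [NormedAddCommGroup V] [NormedSpace ℝ V] [NormedAddCommGroup G]
    [NormedSpace ℝ G] (a : V → V) (F : V → G) (q : V) : G := fderiv ℝ F q (a q)

section Along

variable {V G : Type*} [NormedAddCommGroup V] [NormedSpace ℝ V] [NormedAddCommGroup G]
  [NormedSpace ℝ G] {U : Set V} {a b : V → V} {F F' : V → G} {q : V}

theorem along_congr (hU : IsOpen U) (h : ∀ q ∈ U, F q = F' q) (hq : q ∈ U) :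
    along a F q = along a F' q := by
  have : F =ᶠ[𝓝 q] F' := Filter.mem_of_superset (hU.mem_nhds hq) h
  rw [along, this.fderiv_eq, along]

theorem along_const (c : G) : along a (fun _ => c) q = 0 := by simp [along]

theorem along_eq_zero_of_const (hU : IsOpen U) {c : G} (h : ∀ q ∈ U, F q = c) (hq : q ∈ U) :
    along a F q = 0 := by
  rw [along_congr (F' := fun _ => c) hU h hq, along_const]

theorem along_add (hF : DifferentiableAt ℝ F q) (hF' : DifferentiableAt ℝ F' q) :
    along a (fun y => F y + F' y) q = along a F q + along a F' q := by
  simp [along, fderiv_fun_add hF hF']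

theorem along_sub (hF : DifferentiableAt ℝ F q) (hF' : DifferentiableAt ℝ F' q) :
    along a (fun y => F y - F' y) q = along a F q - along a F' q := by
  simp [along, fderiv_fun_sub hF hF']

theorem along_smul {c : V → ℝ} (hc : DifferentiableAt ℝ c q) (hF : DifferentiableAt ℝ F q) :
    along a (fun y => c y • F y) q = along a c q • F q + c q • along a F q := by
  simp [along, fderiv_fun_smul hc hF, add_comm]

theorem along_mul {c d : V → ℝ} (hc : DifferentiableAt ℝ c q) (hd : DifferentiableAt ℝ d q) :
    along a (fun y => c y * d y) q = along a c q * d q + c q * along a d q :=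
  along_smul hc hd

theorem along_inner {F F' : V → E 3} (hF : DifferentiableAt ℝ F q)
    (hF' : DifferentiableAt ℝ F' q) :
    along a (fun y => inner ℝ (F y) (F' y)) q =
      inner ℝ (along a F q) (F' q) + inner ℝ (F q) (along a F' q) := by
  simp [along, fderiv_inner_apply ℝ hF hF', add_comm]

theorem along_inner_const {F : V → E 3} (hF : DifferentiableAt ℝ F q) (m : E 3) :
    along a (fun y => inner ℝ (F y) m) q = inner ℝ (along a F q) m := by
  rw [along_inner hF (differentiableAt_const m), along_const, inner_zero_right, add_zero]

theorem along_comp {c : V → ℝ} {g : ℝ → ℝ} (hg : DifferentiableAt ℝ g (c q))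
    (hc : DifferentiableAt ℝ c q) :
    along a (fun y => g (c y)) q = deriv g (c q) * along a c q := by
  have := (hg.hasDerivAt.comp_hasFDerivAt q hc.hasFDerivAt).fderiv
  simp only [Function.comp_def] at this
  simp [along, this]

theorem contDiffOn_along (hU : IsOpen U) (ha : ContDiffOn ℝ ∞ a U) (hF : ContDiffOn ℝ ∞ F U) :
    ContDiffOn ℝ ∞ (along a F) U :=
  (hF.fderiv_of_isOpen hU le_rfl).clm_apply ha

theorem differentiableAt_of_contDiffOn (hU : IsOpen U) (hF : ContDiffOn ℝ ∞ F U) (hq : q ∈ U) :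
    DifferentiableAt ℝ F q :=
  (hF.contDiffAt (hU.mem_nhds hq)).differentiableAt (by simp)

theorem along_along (ha : DifferentiableAt ℝ b q) (hF : ContDiffAt ℝ 2 F q) :
    along a (along b F) q =
      fderiv ℝ (fderiv ℝ F) q (a q) (b q) + fderiv ℝ F q (fderiv ℝ b q (a q)) := by
  have h1 : DifferentiableAt ℝ (fderiv ℝ F) q :=
    (hF.fderiv_right (m := 1) (by norm_num)).differentiableAt (by simp)
  have h2 : HasFDerivAt (along b F) _ q := h1.hasFDerivAt.clm_apply ha.hasFDerivAt
  rw [along, h2.fderiv]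
  simp [add_comm]

/-- The right-hand side is the derivative of `F` along the Lie bracket `[a, b]`; the second
derivatives of `F` cancel by symmetry. -/
theorem along_commutator (ha : DifferentiableAt ℝ a q) (hb : DifferentiableAt ℝ b q)
    (hF : ContDiffAt ℝ 2 F q) :
    along a (along b F) q - along b (along a F) q =
      fderiv ℝ F q (fderiv ℝ b q (a q) - fderiv ℝ a q (b q)) := by
  have hs : IsSymmSndFDerivAt ℝ F q := hF.isSymmSndFDerivAt (by simp)
  rw [along_along hb hF, along_along ha hF, hs (b q) (a q), map_sub]
  abel

/-- A solution of a linear total differential equation that vanishes at a point vanishes. -/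
theorem eq_zero_of_fderiv_eq_smul (hU : IsOpen U) (hc : Convex ℝ U) {g : V → ℝ}
    (hg : DifferentiableOn ℝ g U) {k : V → V →L[ℝ] ℝ} (hk : ContinuousOn k U)
    (h : ∀ q ∈ U, fderiv ℝ g q = g q • k q) {p : V} (hp : p ∈ U) (h0 : g p = 0) (hq : q ∈ U) :
    g q = 0 := by
  let γ : ℝ → V := fun s => p + s • (q - p)
  have hγU : ∀ s ∈ Set.Icc (0 : ℝ) 1, γ s ∈ U := fun s hs => hc.add_smul_sub_mem hp hq hs
  have hγ : ∀ s, HasDerivAt γ (q - p) s := fun s => by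
    have h := ((hasDerivAt_id s).smul_const (q - p)).const_add p
    rw [one_smul] at h
    exact h
  have hγc : Continuous γ := continuous_iff_continuousAt.2 fun s => (hγ s).continuousAt
  have hd : ∀ s ∈ Set.Icc (0 : ℝ) 1,
      HasDerivAt (fun s => g (γ s)) (g (γ s) * k (γ s) (q - p)) s := fun s hs => by
    have h1 := ((hg.differentiableAt (hU.mem_nhds (hγU s hs))).hasFDerivAt).comp_hasDerivAt s (hγ s)
    rw [h _ (hγU s hs)] at h1
    exact h1
  have hkc : ContinuousOn (fun s => k (γ s) (q - p)) (Set.Icc 0 1) :=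
    (hk.comp hγc.continuousOn hγU).clm_apply continuousOn_const
  -- On the segment from `p` to `q` the coefficient is bounded by compactness, and Grönwall's
  -- inequality applies.
  obtain ⟨K, hK⟩ := isCompact_Icc.exists_bound_of_continuousOn hkc
  have := eq_zero_of_abs_deriv_le_mul_abs_self_of_eq_zero_right (f := fun s => g (γ s)) (K := K)
    (a := 0) (b := 1) (fun s hs => (hd s hs).continuousAt.continuousWithinAt)
    (fun s hs => (hd s (Set.Ico_subset_Icc_self hs)).hasDerivWithinAt) (by simpa [γ] using h0)
    (fun s hs => by
      rw [norm_mul, mul_comm]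
      exact mul_le_mul_of_nonneg_right (hK s (Set.Ico_subset_Icc_self hs)) (norm_nonneg _))
    1 (by simp)
  simpa [γ] using this

end Along

/-! ### Adapted frames of minimal surfaces of class `𝒜` -/


/-- A frame `a`, `b` on the open subset `U` of the parameter plane adapted to the minimal surface
`(t, X)` of class `𝒜`: `b` is the unit tangent of the level curves of `t`, `a` is orthogonal to `b`
with `dt(a) = 1`. -/
structure IsAdaptedFrame (f : ℝ → ℝ) (I : Set ℝ) (U : Set (E 2)) (t : E 2 → ℝ) (X : E 2 → E 3)
    (a b : E 2 → E 2) : Prop where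
  isOpen : IsOpen U
  smooth_t : ContDiffOn ℝ ∞ t U
  smooth_X : ContDiffOn ℝ ∞ X U
  smooth_a : ContDiffOn ℝ ∞ a U
  smooth_b : ContDiffOn ℝ ∞ b U
  mem : ∀ q ∈ U, t q ∈ I
  along_a_t : ∀ q ∈ U, along a t q = 1
  along_b_t : ∀ q ∈ U, along b t q = 0
  unit : ∀ q ∈ U, inner ℝ (along b X q) (along b X q) = 1
  orthogonal : ∀ q ∈ U, inner ℝ (along a X q) (along b X q) = 0
  spacelike : ∀ q ∈ U, 1 < f (t q) ^ 2 * inner ℝ (along a X q) (along a X q)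
  classA : ∀ q ∈ U, along a (along b X) q = 0
  minimal : ∀ q ∈ U, along a (along a X) q =
    (deriv f (t q) / f (t q) * (2 * f (t q) ^ 2 * inner ℝ (along a X q) (along a X q) - 3)) •
        along a X q -
      (inner ℝ (along a X q) (along a X q) - ((f (t q)) ^ 2)⁻¹) • along b (along b X) q

namespace IsAdaptedFrame

variable {f : ℝ → ℝ} {I : Set ℝ} {U : Set (E 2)} {t : E 2 → ℝ} {X : E 2 → E 3}
  {a b : E 2 → E 2} (h : IsAdaptedFrame f I U t X a b) {q : E 2}

theorem mono {V : Set (E 2)} (h : IsAdaptedFrame f I U t X a b) (hV : IsOpen V) (hVU : V ⊆ U) :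
    IsAdaptedFrame f I V t X a b where
  isOpen := hV
  smooth_t := h.smooth_t.mono hVU
  smooth_X := h.smooth_X.mono hVU
  smooth_a := h.smooth_a.mono hVU
  smooth_b := h.smooth_b.mono hVU
  mem q hq := h.mem q (hVU hq)
  along_a_t q hq := h.along_a_t q (hVU hq)
  along_b_t q hq := h.along_b_t q (hVU hq)
  unit q hq := h.unit q (hVU hq)
  orthogonal q hq := h.orthogonal q (hVU hq)
  spacelike q hq := h.spacelike q (hVU hq)
  classA q hq := h.classA q (hVU hq)
  minimal q hq := h.minimal q (hVU hq)

include h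

theorem diff {G : Type*} [NormedAddCommGroup G] [NormedSpace ℝ G] {F : E 2 → G}
    (hF : ContDiffOn ℝ ∞ F U) (hq : q ∈ U) : DifferentiableAt ℝ F q :=
  differentiableAt_of_contDiffOn h.isOpen hF hq

theorem contDiffAt_two {G : Type*} [NormedAddCommGroup G] [NormedSpace ℝ G] {F : E 2 → G}
    (hF : ContDiffOn ℝ ∞ F U) (hq : q ∈ U) : ContDiffAt ℝ 2 F q :=
  (hF.contDiffAt (h.isOpen.mem_nhds hq)).of_le two_le_infty

theorem smooth_along_a {G : Type*} [NormedAddCommGroup G] [NormedSpace ℝ G] {F : E 2 → G}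
    (hF : ContDiffOn ℝ ∞ F U) : ContDiffOn ℝ ∞ (along a F) U :=
  contDiffOn_along h.isOpen h.smooth_a hF

theorem smooth_along_b {G : Type*} [NormedAddCommGroup G] [NormedSpace ℝ G] {F : E 2 → G}
    (hF : ContDiffOn ℝ ∞ F U) : ContDiffOn ℝ ∞ (along b F) U :=
  contDiffOn_along h.isOpen h.smooth_b hF

theorem smooth_w : ContDiffOn ℝ ∞ (along b X) U := h.smooth_along_b h.smooth_X
theorem smooth_P : ContDiffOn ℝ ∞ (along a X) U := h.smooth_along_a h.smooth_X
theorem smooth_n : ContDiffOn ℝ ∞ (along b (along b X)) U := h.smooth_along_b h.smooth_w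

/-- Vectors are determined by their components in the frame. -/
theorem exists_coeff (hq : q ∈ U) (v : E 2) : ∃ β : ℝ, v = fderiv ℝ t q v • a q + β • b q := by
  have ha := h.along_a_t q hq
  have hb := h.along_b_t q hq
  have hb0 : b q ≠ 0 := by
    intro h0
    have := h.unit q hq
    simp [along, h0] at this
  have hΔ : a q 0 * b q 1 - a q 1 * b q 0 ≠ 0 := by
    intro h0
    have h1 : b q 1 • a q = a q 1 • b q := by
      ext i
      fin_cases i
      · simp; linarith
      · simp; ring
    have h2 : b q 0 • a q = a q 0 • b q := by
      ext i
      fin_cases i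
      · simp; ring
      · simp; linarith
    have h3 := congrArg (fderiv ℝ t q) h1
    have h4 := congrArg (fderiv ℝ t q) h2
    rw [along] at ha hb
    rw [map_smul, map_smul, ha, hb] at h3 h4
    apply hb0
    ext i
    fin_cases i
    · simpa using h4
    · simpa using h3
  obtain ⟨α, β, hαβ⟩ := exists_add_smul_eq hΔ v
  refine ⟨β, ?_⟩
  rw [along] at ha hb
  have : fderiv ℝ t q v = α := by
    rw [← hαβ, map_add, map_smul, map_smul, ha, hb]; simp
  rw [this, hαβ]

theorem fderiv_apply {G : Type*} [NormedAddCommGroup G] [NormedSpace ℝ G] {F : E 2 → G}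
    (hq : q ∈ U) (hb : along b F q = 0) (v : E 2) :
    fderiv ℝ F q v = fderiv ℝ t q v • along a F q := by
  obtain ⟨β, hβ⟩ := h.exists_coeff hq v
  conv_lhs => rw [hβ]
  rw [along] at hb
  rw [map_add, map_smul, map_smul, hb, smul_zero, add_zero, along]

theorem eq_of_along_eq_zero {G : Type*} [NormedAddCommGroup G] [NormedSpace ℝ G] {F : E 2 → G}
    (hc : Convex ℝ U) (hF : ContDiffOn ℝ ∞ F U) (ha : ∀ q ∈ U, along a F q = 0)
    (hb : ∀ q ∈ U, along b F q = 0) {p : E 2} (hp : p ∈ U) (hq : q ∈ U) : F q = F p := by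
  refine h.isOpen.is_const_of_fderiv_eq_zero (𝕜 := ℝ) hc.isPreconnected
    (hF.differentiableOn (by simp)) (fun y hy => ?_) hq hp
  ext1 v
  rw [h.fderiv_apply hy (hb y hy), ha y hy, smul_zero]
  rfl

/-- Uniqueness for the linear equation `a(g) = σ g`, `b(g) = 0`. -/
theorem eq_zero_of_along_eq_mul (hc : Convex ℝ U) {g σ : E 2 → ℝ} (hg : ContDiffOn ℝ ∞ g U)
    (hσ : ContinuousOn σ U) (ha : ∀ q ∈ U, along a g q = σ q * g q)
    (hb : ∀ q ∈ U, along b g q = 0) {p : E 2} (hp : p ∈ U) (h0 : g p = 0) (hq : q ∈ U) :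
    g q = 0 := by
  refine eq_zero_of_fderiv_eq_smul h.isOpen hc (hg.differentiableOn (by simp))
    (k := fun q => σ q • fderiv ℝ t q)
    (hσ.smul (h.smooth_t.continuousOn_fderiv_of_isOpen h.isOpen (by simp)))
    (fun y hy => ?_) hp h0 hq
  ext1 v
  rw [h.fderiv_apply hy (hb y hy), ha y hy]
  simp only [smul_apply, smul_eq_mul]
  ring

theorem inner_n_w (hq : q ∈ U) : inner ℝ (along b (along b X) q) (along b X q) = 0 := by
  have h1 := along_eq_zero_of_const (a := b) h.isOpen h.unit hq
  rw [along_inner (h.diff h.smooth_w hq) (h.diff h.smooth_w hq),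
    real_inner_comm (along b (along b X) q)] at h1
  linarith

/-- The bracket `[a, b]` annihilates `t`, because `a(t)` and `b(t)` are constant, so it equals `τ
b`. Applied to `X` it gives `-b(P)` by class `𝒜`. Pairing with `w` and differentiating `⟨P, w⟩ = 0`
along `b` yields `τ = ⟨P, n⟩`. -/
theorem commutator {G : Type*} [NormedAddCommGroup G] [NormedSpace ℝ G] {F : E 2 → G}
    (hF : ContDiffOn ℝ ∞ F U) (hq : q ∈ U) :
    along a (along b F) q = along b (along a F) q +
      inner ℝ (along a X q) (along b (along b X) q) • along b F q := by
  have hda := h.diff h.smooth_a hq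
  have hdb := h.diff h.smooth_b hq
  obtain ⟨τ, hτ⟩ := h.exists_coeff hq (fderiv ℝ b q (a q) - fderiv ℝ a q (b q))
  have ht := along_commutator hda hdb (h.contDiffAt_two h.smooth_t hq)
  rw [along_eq_zero_of_const h.isOpen h.along_b_t hq,
    along_eq_zero_of_const h.isOpen h.along_a_t hq, sub_zero] at ht
  rw [← ht, zero_smul, zero_add] at hτ
  have hX := along_commutator hda hdb (h.contDiffAt_two h.smooth_X hq)
  rw [hτ, map_smul, h.classA q hq, zero_sub] at hX
  have hPw := along_eq_zero_of_const (a := b) h.isOpen h.orthogonal hq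
  rw [along_inner (h.diff h.smooth_P hq) (h.diff h.smooth_w hq)] at hPw
  have hτ' : τ = inner ℝ (along a X q) (along b (along b X) q) := by
    have h1 := congrArg (fun Y => inner ℝ Y (along b X q)) hX
    simp only [inner_neg_left, inner_smul_left] at h1
    have h2 : inner ℝ (fderiv ℝ X q (b q)) (along b X q) = (1 : ℝ) := h.unit q hq
    rw [h2] at h1
    simp at h1
    linarith
  have hFc := along_commutator hda hdb (h.contDiffAt_two hF hq)
  rw [hτ, map_smul, hτ', sub_eq_iff_eq_add'] at hFc
  exact hFc

theorem along_b_P (hq : q ∈ U) : along b (along a X) q =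
    -(inner ℝ (along a X q) (along b (along b X) q) • along b X q) := by
  have h1 := h.commutator h.smooth_X hq
  rw [h.classA q hq] at h1
  exact eq_neg_of_add_eq_zero_left h1.symm

theorem along_a_n (hq : q ∈ U) : along a (along b (along b X)) q =
    inner ℝ (along a X q) (along b (along b X) q) • along b (along b X) q := by
  rw [h.commutator h.smooth_w hq, along_eq_zero_of_const h.isOpen h.classA hq, zero_add]

theorem along_b_inner_P (hq : q ∈ U) :
    along b (fun y => inner ℝ (along a X y) (along a X y)) q = (0 : ℝ) := by
  rw [along_inner (h.diff h.smooth_P hq) (h.diff h.smooth_P hq), h.along_b_P hq,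
    inner_neg_left, inner_neg_right, inner_smul_left, inner_smul_right, h.orthogonal q hq,
    real_inner_comm (along a X q) (along b X q), h.orthogonal q hq]
  simp

theorem along_b_comp_t {g : ℝ → ℝ} (hg : DifferentiableAt ℝ g (t q)) (hq : q ∈ U) :
    along b (fun y => g (t y)) q = 0 := by
  rw [along_comp hg (h.diff h.smooth_t hq), h.along_b_t q hq, mul_zero]

/-- The level curves are plane curves: `b(n)` has no component outside `w`. This comes from
computing `b(a(P))` both from the minimality equation and from the commutator. -/
theorem along_b_n (hI : IsOpen I) (hf : ContDiffOn ℝ ∞ f I) (hf0 : ∀ t ∈ I, f t ≠ 0)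
    (hq : q ∈ U) : along b (along b (along b X)) q =
      -(inner ℝ (along b (along b X) q) (along b (along b X) q) • along b X q) := by
  have ht := h.mem q hq
  have hfd : DifferentiableAt ℝ f (t q) :=
    (hf.contDiffAt (hI.mem_nhds ht)).differentiableAt (by simp)
  have hf'd : DifferentiableAt ℝ (deriv f) (t q) :=
    ((hf.deriv_of_isOpen (m := ∞) hI le_rfl).contDiffAt (hI.mem_nhds ht)).differentiableAt (by simp)
  have dP := h.diff h.smooth_P hq
  have dn := h.diff h.smooth_n hq
  have dw := h.diff h.smooth_w hq
  have dt := h.diff h.smooth_t hq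
  have dL : DifferentiableAt ℝ (fun y => inner ℝ (along a X y) (along a X y)) q := dP.inner ℝ dP
  have dτ : DifferentiableAt ℝ (fun y => inner ℝ (along a X y) (along b (along b X) y)) q :=
    dP.inner ℝ dn
  have dg1 : DifferentiableAt ℝ (fun s => deriv f s / f s) (t q) := hf'd.div hfd (hf0 _ ht)
  have dg2 : DifferentiableAt ℝ (fun s => 2 * f s ^ 2) (t q) := (hfd.pow 2).const_mul 2
  have dg3 : DifferentiableAt ℝ (fun s => (f s ^ 2)⁻¹) (t q) :=
    (hfd.pow 2).inv (pow_ne_zero 2 (hf0 _ ht))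
  have e1 : DifferentiableAt ℝ (fun y => deriv f (t y) / f (t y)) q := dg1.comp q dt
  have e2 : DifferentiableAt ℝ (fun y => 2 * f (t y) ^ 2) q := dg2.comp q dt
  have e3 : DifferentiableAt ℝ (fun y => (f (t y) ^ 2)⁻¹) q := dg3.comp q dt
  have e2L : DifferentiableAt ℝ
      (fun y => 2 * f (t y) ^ 2 * inner ℝ (along a X y) (along a X y)) q := e2.mul dL
  have e23 : DifferentiableAt ℝ
      (fun y => 2 * f (t y) ^ 2 * inner ℝ (along a X y) (along a X y) - 3) q := e2L.sub_const 3
  have ec : DifferentiableAt ℝ (fun y => deriv f (t y) / f (t y) *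
      (2 * f (t y) ^ 2 * inner ℝ (along a X y) (along a X y) - 3)) q := e1.mul e23
  have eκ : DifferentiableAt ℝ
      (fun y => inner ℝ (along a X y) (along a X y) - (f (t y) ^ 2)⁻¹) q := dL.sub e3
  -- the coefficients are constant along `b`
  have hc : along b (fun y => deriv f (t y) / f (t y) *
      (2 * f (t y) ^ 2 * inner ℝ (along a X y) (along a X y) - 3)) q = 0 := by
    rw [along_mul e1 e23, h.along_b_comp_t dg1 hq, along_sub e2L
      (differentiableAt_const _), along_mul e2 dL, h.along_b_comp_t dg2 hq, h.along_b_inner_P hq,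
      along_const]
    simp
  have hκ : along b (fun y => inner ℝ (along a X y) (along a X y) - (f (t y) ^ 2)⁻¹) q = 0 := by
    rw [along_sub dL e3, h.along_b_comp_t dg3 hq, h.along_b_inner_P hq, sub_zero]
  have h1 := along_congr (a := b) h.isOpen h.minimal hq
  rw [along_sub (F := fun y => _ • along a X y) (F' := fun y => _ • along b (along b X) y)
      (ec.smul dP) (eκ.smul dn), along_smul ec dP,
    along_smul eκ dn, hc, hκ, zero_smul, zero_smul, zero_add, zero_add,
    h.along_b_P hq] at h1
  -- Apart from `κ b(n)`, every term of the resulting equation is a multiple of `w`: `b(P) = -τ w`,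
  -- and `a(b(P)) = -a(τ) w` because `a(w) = 0`.
  have h2 := h.commutator h.smooth_P hq
  have h3 := along_congr (a := a) h.isOpen (fun y hy => h.along_b_P hy) hq
  have h4 : along a (fun y => -(inner ℝ (along a X y) (along b (along b X) y) • along b X y)) q =
      -(along a (fun y => inner ℝ (along a X y) (along b (along b X) y)) q • along b X q) := by
    have := along_smul (a := a) dτ dw
    rw [h.classA q hq, smul_zero, add_zero] at this
    rw [← this, along, along]
    simp [fderiv_fun_neg]
  rw [h3, h4, h1, h.along_b_P hq] at h2
  -- Space-likeness, `f² |P|² > 1`, is what allows division by `κ`.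
  have hκ0 : inner ℝ (along a X q) (along a X q) - (f (t q) ^ 2)⁻¹ ≠ 0 := by
    have hs := h.spacelike q hq
    have hpos : 0 < f (t q) ^ 2 := by have := hf0 _ ht; positivity
    rw [sub_ne_zero]
    intro h0
    rw [h0, mul_inv_cancel₀ hpos.ne'] at hs
    exact lt_irrefl _ hs
  obtain ⟨s, hs⟩ : ∃ s : ℝ, along b (along b (along b X)) q = s • along b X q := by
    set κ := inner ℝ (along a X q) (along a X q) - (f (t q) ^ 2)⁻¹ with hκdef
    refine ⟨κ⁻¹ * (along a (fun y => inner ℝ (along a X y) (along b (along b X) y)) q -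
      deriv f (t q) / f (t q) * (2 * f (t q) ^ 2 * inner ℝ (along a X q) (along a X q) - 3) *
        inner ℝ (along a X q) (along b (along b X) q) -
      inner ℝ (along a X q) (along b (along b X) q) ^ 2), ?_⟩
    rw [mul_smul, eq_inv_smul_iff₀ hκ0]
    rw [← sub_eq_zero] at h2 ⊢
    rw [← h2]
    module
  -- The factor is found by differentiating `⟨n, w⟩ = 0` along `b`.
  have h5 := along_eq_zero_of_const (a := b) h.isOpen (fun y hy => h.inner_n_w hy) hq
  rw [along_inner dn dw, hs, inner_smul_left, h.unit q hq] at h5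
  rw [hs, ← neg_smul]
  congr 1
  simp at h5 ⊢
  linarith

theorem along_b_inner_n (hI : IsOpen I) (hf : ContDiffOn ℝ ∞ f I) (hf0 : ∀ t ∈ I, f t ≠ 0)
    (hq : q ∈ U) :
    along b (fun y => inner ℝ (along b (along b X) y) (along b (along b X) y)) q = (0 : ℝ) := by
  rw [along_inner (h.diff h.smooth_n hq) (h.diff h.smooth_n hq), h.along_b_n hI hf hf0 hq,
    inner_neg_left, inner_neg_right, inner_smul_left, inner_smul_right, h.inner_n_w hq,
    real_inner_comm (along b (along b X) q) (along b X q), h.inner_n_w hq]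
  simp

theorem along_a_inner_n (hq : q ∈ U) :
    along a (fun y => inner ℝ (along b (along b X) y) (along b (along b X) y)) q =
      2 * inner ℝ (along a X q) (along b (along b X) q) *
        inner ℝ (along b (along b X) q) (along b (along b X) q) := by
  rw [along_inner (h.diff h.smooth_n hq) (h.diff h.smooth_n hq), h.along_a_n hq, inner_smul_left,
    inner_smul_right, conj_trivial]
  ring

theorem continuousOn_tau :
    ContinuousOn (fun q => inner ℝ (along a X q) (along b (along b X) q)) U :=
  (h.smooth_P.inner ℝ h.smooth_n).continuousOn

end IsAdaptedFrame

/-! ### Orthonormal frames of `𝔼³`; straight and circular level curves -/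

theorem exists_orthonormalBasis_pair {u v : E 3} (hu : inner ℝ u u = (1 : ℝ))
    (hv : inner ℝ v v = (1 : ℝ)) (huv : inner ℝ u v = (0 : ℝ)) :
    ∃ β : OrthonormalBasis (Fin 3) ℝ (E 3), β 0 = u ∧ β 1 = v := by
  have hu1 : ‖u‖ = 1 := by
    rw [norm_eq_sqrt_real_inner, hu, Real.sqrt_one]
  have hv1 : ‖v‖ = 1 := by
    rw [norm_eq_sqrt_real_inner, hv, Real.sqrt_one]
  have hs : Orthonormal ℝ (Set.domRestrict ({0, 1} : Set (Fin 3)) ![u, v, 0]) := by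
    constructor
    · rintro ⟨i, rfl | rfl⟩
      exacts [hu1, hv1]
    · rintro ⟨i, rfl | rfl⟩ ⟨j, rfl | rfl⟩ hij
      exacts [absurd rfl hij, huv, (real_inner_comm u v).trans huv, absurd rfl hij]
  obtain ⟨β, hβ⟩ := hs.exists_orthonormalBasis_extension_of_card_eq (by simp)
  exact ⟨β, hβ 0 (by simp), hβ 1 (by simp)⟩

theorem eq_of_orthonormal_triple {u v m : E 3} (hu : inner ℝ u u = (1 : ℝ))
    (hv : inner ℝ v v = (1 : ℝ)) (hm : inner ℝ m m = (1 : ℝ)) (huv : inner ℝ u v = (0 : ℝ))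
    (hum : inner ℝ u m = (0 : ℝ)) (hvm : inner ℝ v m = (0 : ℝ)) (y : E 3) :
    y = inner ℝ y u • u + inner ℝ y v • v + inner ℝ y m • m := by
  have hs : Orthonormal ℝ ![u, v, m] := by
    rw [orthonormal_iff_ite]
    intro i j
    fin_cases i <;> fin_cases j
    exacts [hu, huv, hum, (real_inner_comm u v).trans huv, hv, hvm, (real_inner_comm u m).trans hum,
      (real_inner_comm v m).trans hvm, hm]
  obtain ⟨β, hβ⟩ := (hs.comp _ Subtype.val_injective).exists_orthonormalBasis_extension_of_card_eq
    (s := Set.univ) (by simp)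
  have h0 : β 0 = u := hβ 0 trivial
  have h1 : β 1 = v := hβ 1 trivial
  have h2 : β 2 = m := hβ 2 trivial
  have := β.sum_repr' y
  rw [Fin.sum_univ_three, h0, h1, h2] at this
  rw [real_inner_comm u, real_inner_comm v, real_inner_comm m, this]

namespace IsAdaptedFrame

variable {f : ℝ → ℝ} {I : Set ℝ} {U : Set (E 2)} {t : E 2 → ℝ} {X : E 2 → E 3}
  {a b : E 2 → E 2} {p : E 2}

/-- The function `|n|²` solves `a(g) = 2τ g`, `b(g) = 0`, so a zero at one point spreads over the
convex domain. Whether the level curves are straight is thus decided at one point. -/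
theorem inner_n_eq_zero (h : IsAdaptedFrame f I U t X a b) (hI : IsOpen I)
    (hf : ContDiffOn ℝ ∞ f I) (hf0 : ∀ t ∈ I, f t ≠ 0) (hc : Convex ℝ U) (hp : p ∈ U)
    (h0 : inner ℝ (along b (along b X) p) (along b (along b X) p) = (0 : ℝ)) {q : E 2}
    (hq : q ∈ U) : inner ℝ (along b (along b X) q) (along b (along b X) q) = (0 : ℝ) :=
  h.eq_zero_of_along_eq_mul hc
    (g := fun q => inner ℝ (along b (along b X) q) (along b (along b X) q))
    (h.smooth_n.inner ℝ h.smooth_n) (continuousOn_const.mul h.continuousOn_tau)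
    (fun _ hq => h.along_a_inner_n hq) (fun _ hq => h.along_b_inner_n hI hf hf0 hq) hp h0 hq

/-- If the unit tangents of the level curves are stationary, the surface lies in `ℝ ×` a plane. -/
theorem exists_plane (h : IsAdaptedFrame f I U t X a b) (hI : IsOpen I)
    (hf : ContDiffOn ℝ ∞ f I) (hf0 : ∀ t ∈ I, f t ≠ 0) (hc : Convex ℝ U) (hp : p ∈ U)
    (h0 : along b (along b X) p = 0) :
    ∃ β : OrthonormalBasis (Fin 3) ℝ (E 3), ∀ q ∈ U, inner ℝ (X q) (β 2) = inner ℝ (X p) (β 2) := by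
  have hn : ∀ q ∈ U, along b (along b X) q = 0 := fun q hq =>
    inner_self_eq_zero.1 (h.inner_n_eq_zero hI hf hf0 hc hp (by rw [h0, inner_zero_left]) hq)
  have hw : ∀ q ∈ U, along b X q = along b X p := fun q hq =>
    h.eq_of_along_eq_zero hc h.smooth_w h.classA hn hp hq
  have hPpos : 0 < inner ℝ (along a X p) (along a X p) := by
    have := h.spacelike p hp
    by_contra hneg
    nlinarith [sq_nonneg (f (t p))]
  have hP0 : ‖along a X p‖ ≠ 0 := by
    rw [real_inner_self_eq_norm_sq] at hPpos
    intro h1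
    simp [h1] at hPpos
  -- `β 2` is normal to the plane spanned by `w` and `P` at `p`; that plane will contain all spatial
  -- tangent directions.
  obtain ⟨β, hβ0, hβ1⟩ := exists_orthonormalBasis_pair (u := along b X p)
    (v := ‖along a X p‖⁻¹ • along a X p) (h.unit p hp)
    (by rw [inner_smul_left, inner_smul_right, real_inner_self_eq_norm_sq, conj_trivial]
        field_simp)
    (by rw [inner_smul_right, real_inner_comm, h.orthogonal p hp, mul_zero])
  have hwm : ∀ q ∈ U, inner ℝ (along b X q) (β 2) = (0 : ℝ) := fun q hq => by
    rw [hw q hq, ← hβ0, β.inner_eq_ite]; simp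
  have hPm0 : inner ℝ (along a X p) (β 2) = (0 : ℝ) := by
    have : inner ℝ (β 1) (β 2) = (0 : ℝ) := by rw [β.inner_eq_ite]; simp
    rw [hβ1, inner_smul_left] at this
    exact (mul_eq_zero.1 this).resolve_left (by simpa using hP0)
  have htI : Set.MapsTo t U I := h.mem
  have hfc : ContinuousOn (fun q => f (t q)) U :=
    hf.continuousOn.comp h.smooth_t.continuousOn htI
  have hf'c : ContinuousOn (fun q => deriv f (t q)) U :=
    (hf.continuousOn_deriv_of_isOpen hI (by simp)).comp h.smooth_t.continuousOn htI
  -- With `n = 0` minimality reduces to `a(P) = c P`, a linear equation for `⟨P, β 2⟩`, while `b(P)`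
  -- is a multiple of `w`, which is orthogonal to `β 2`.
  have hPm : ∀ q ∈ U, inner ℝ (along a X q) (β 2) = (0 : ℝ) := fun q hq => by
    refine h.eq_zero_of_along_eq_mul hc (g := fun q => inner ℝ (along a X q) (β 2))
      (h.smooth_P.inner ℝ contDiffOn_const)
      (((hf'c.div hfc fun q hq => hf0 _ (h.mem q hq))).mul
        (((continuousOn_const (c := (2 : ℝ))).mul (hfc.pow 2)).mul
          (h.smooth_P.inner ℝ h.smooth_P).continuousOn |>.sub (continuousOn_const (c := (3 : ℝ)))))
      (fun q hq => ?_) (fun q hq => ?_) hp hPm0 hq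
    · rw [along_inner_const (h.diff h.smooth_P hq), h.minimal q hq, hn q hq, smul_zero, sub_zero,
        inner_smul_left, conj_trivial]
      rfl
    · rw [along_inner_const (h.diff h.smooth_P hq), h.along_b_P hq, inner_neg_left,
        inner_smul_left, hwm q hq, mul_zero, neg_zero]
  refine ⟨β, fun q hq => ?_⟩
  exact h.eq_of_along_eq_zero hc (F := fun q => inner ℝ (X q) (β 2))
    (h.smooth_X.inner ℝ contDiffOn_const)
    (fun q hq => by rw [along_inner_const (h.diff h.smooth_X hq), hPm q hq])
    (fun q hq => by rw [along_inner_const (h.diff h.smooth_X hq), hwm q hq]) hp hq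

end IsAdaptedFrame

/-- The functions `r`, `z`, `θ` on `V` are cylindrical coordinates of the surface `(t, X)`, of which
`r` and `z` are functions of `t` only that solve the equations of a minimal profile. -/
structure IsCylindrical (f : ℝ → ℝ) (V : Set (E 2)) (t : E 2 → ℝ) (X : E 2 → E 3)
    (a b : E 2 → E 2) (β : OrthonormalBasis (Fin 3) ℝ (E 3)) (x₀ : E 3) (r z θ : E 2 → ℝ) :
    Prop where
  smooth_r : ContDiffOn ℝ ∞ r V
  smooth_z : ContDiffOn ℝ ∞ z V
  smooth_θ : ContDiffOn ℝ ∞ θ V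
  pos : ∀ q ∈ V, 0 < r q
  eq : ∀ q ∈ V, X q =
    x₀ + (r q * Real.cos (θ q)) • β 0 + (r q * Real.sin (θ q)) • β 1 + z q • β 2
  along_b_r : ∀ q ∈ V, along b r q = 0
  along_b_z : ∀ q ∈ V, along b z q = 0
  along_a_θ : ∀ q ∈ V, along a θ q = 0
  along_b_θ : ∀ q ∈ V, along b θ q ≠ 0
  spacelike : ∀ q ∈ V, 1 < f (t q) ^ 2 * (along a r q ^ 2 + along a z q ^ 2)
  ode_r : ∀ q ∈ V, f (t q) * along a (along a r) q =
    deriv f (t q) * along a r q * (2 * f (t q) ^ 2 * (along a r q ^ 2 + along a z q ^ 2) - 3) +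
      (f (t q) ^ 2 * (along a r q ^ 2 + along a z q ^ 2) - 1) / (f (t q) * r q)
  ode_z : ∀ q ∈ V, f (t q) * along a (along a z) q =
    deriv f (t q) * along a z q * (2 * f (t q) ^ 2 * (along a r q ^ 2 + along a z q ^ 2) - 3)

/-- With `r = 1/|n|` the unit normal `ν = r n` of the level circle is constant along `a`, as is `w`,
and along `b` the pair `(w, ν)` rotates in its own plane. That plane is therefore fixed, with normal
`m`. Along `a` the radius changes by `-⟨P, ν⟩` and the height by `⟨P, m⟩`, so the centre moves only
along the axis. -/
theorem IsAdaptedFrame.exists_isCylindrical {f : ℝ → ℝ} {I : Set ℝ} {U : Set (E 2)} {t : E 2 → ℝ}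
    {X : E 2 → E 3} {a b : E 2 → E 2} {p : E 2} (h : IsAdaptedFrame f I U t X a b) (hI : IsOpen I)
    (hf : ContDiffOn ℝ ∞ f I) (hf0 : ∀ t ∈ I, f t ≠ 0) (hc : Convex ℝ U) (hp : p ∈ U)
    (h0 : along b (along b X) p ≠ 0) :
    ∃ V ⊆ U, IsOpen V ∧ p ∈ V ∧ ∃ β x₀ r z θ, IsCylindrical f V t X a b β x₀ r z θ ∧ θ p = 0 := by
  obtain ⟨w, hw⟩ : ∃ w, w = along b X := ⟨_, rfl⟩
  obtain ⟨P, hP⟩ : ∃ P, P = along a X := ⟨_, rfl⟩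
  obtain ⟨n, hn⟩ : ∃ n, n = along b w := ⟨_, rfl⟩
  have hnw : n = along b (along b X) := by rw [hn, hw]
  have sw : ContDiffOn ℝ ∞ w U := hw ▸ h.smooth_w
  have sP : ContDiffOn ℝ ∞ P U := hP ▸ h.smooth_P
  have sn : ContDiffOn ℝ ∞ n U := hnw ▸ h.smooth_n
  have cτ : ContinuousOn (fun q => inner ℝ (P q) (n q)) U := (sP.inner ℝ sn).continuousOn
  have aw : ∀ q ∈ U, along a w q = 0 := fun q hq => hw ▸ h.classA q hq
  have an : ∀ q ∈ U, along a n q = inner ℝ (P q) (n q) • n q := fun q hq => by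
    rw [hnw, hP]; exact h.along_a_n hq
  have bn : ∀ q ∈ U, along b n q = -(inner ℝ (n q) (n q) • w q) := fun q hq => by
    rw [hnw, hw]; exact h.along_b_n hI hf hf0 hq
  have aP : ∀ q ∈ U, along a P q =
      (deriv f (t q) / f (t q) * (2 * f (t q) ^ 2 * inner ℝ (P q) (P q) - 3)) • P q -
        (inner ℝ (P q) (P q) - ((f (t q)) ^ 2)⁻¹) • n q := fun q hq => by
    rw [hnw, hP]; exact h.minimal q hq
  have ww : ∀ q ∈ U, inner ℝ (w q) (w q) = (1 : ℝ) := fun q hq => hw ▸ h.unit q hq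
  have Pw : ∀ q ∈ U, inner ℝ (P q) (w q) = (0 : ℝ) := fun q hq => by
    rw [hw, hP]; exact h.orthogonal q hq
  have nw : ∀ q ∈ U, inner ℝ (n q) (w q) = (0 : ℝ) := fun q hq => by
    rw [hnw, hw]; exact h.inner_n_w hq
  have aN : ∀ q ∈ U, along a (fun y => inner ℝ (n y) (n y)) q =
      2 * inner ℝ (P q) (n q) * inner ℝ (n q) (n q) := fun q hq => by
    rw [hnw, hP]; exact h.along_a_inner_n hq
  have bN : ∀ q ∈ U, along b (fun y => inner ℝ (n y) (n y)) q = (0 : ℝ) := fun q hq => by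
    rw [hnw]; exact h.along_b_inner_n hI hf hf0 hq
  have Npos : ∀ q ∈ U, 0 < inner ℝ (n q) (n q) := fun q hq => by
    refine lt_of_le_of_ne real_inner_self_nonneg fun hq0 => h0 ?_
    rw [hnw] at hq0
    exact inner_self_eq_zero.1 (h.inner_n_eq_zero hI hf hf0 hc hq hq0.symm hp)
  have hsp : ∀ q ∈ U, 1 < f (t q) ^ 2 * inner ℝ (P q) (P q) := fun q hq => hP ▸ h.spacelike q hq
  have sN : ContDiffOn ℝ ∞ (fun q => inner ℝ (n q) (n q)) U := sn.inner ℝ sn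
  -- the radius
  obtain ⟨r, hr⟩ : ∃ r : E 2 → ℝ, r = fun q => (√(inner ℝ (n q) (n q)))⁻¹ := ⟨_, rfl⟩
  have sr : ContDiffOn ℝ ∞ r U := by
    rw [hr]
    exact (sN.sqrt fun q hq => (Npos q hq).ne').inv fun q hq => (Real.sqrt_pos.2 (Npos q hq)).ne'
  have rpos : ∀ q ∈ U, 0 < r q := fun q hq => by
    rw [hr]; exact inv_pos.2 (Real.sqrt_pos.2 (Npos q hq))
  have rN : ∀ q ∈ U, r q * r q * inner ℝ (n q) (n q) = 1 := fun q hq => by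
    have := Real.mul_self_sqrt (Npos q hq).le
    have h2 := (Real.sqrt_pos.2 (Npos q hq)).ne'
    simp only [hr]
    nth_rewrite 3 [← this]
    field_simp
  have drN : ∀ (c : E 2 → E 2) (q) (_ : q ∈ U), (along c r q * r q + r q * along c r q) *
      inner ℝ (n q) (n q) + r q * r q * along c (fun y => inner ℝ (n y) (n y)) q = 0 := by
    intro c q hq
    have h1 := along_eq_zero_of_const (a := c) h.isOpen rN hq
    have dr := h.diff sr hq
    have drr : DifferentiableAt ℝ (fun y => r y * r y) q := dr.mul dr
    rwa [along_mul drr (h.diff sN hq), along_mul dr dr] at h1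
  have ar : ∀ q ∈ U, along a r q = -(inner ℝ (P q) (n q) * r q) := fun q hq => by
    have h1 := drN a q hq
    rw [aN q hq] at h1
    have h2 := (mul_pos (rpos q hq) (Npos q hq)).ne'
    apply mul_left_cancel₀ h2
    linear_combination h1 / 2
  have br : ∀ q ∈ U, along b r q = 0 := fun q hq => by
    have h1 := drN b q hq
    rw [bN q hq] at h1
    have h2 := (mul_pos (rpos q hq) (Npos q hq)).ne'
    apply mul_left_cancel₀ h2
    linear_combination h1 / 2
  -- the unit normals of the level curves
  obtain ⟨ν, hν⟩ : ∃ ν : E 2 → E 3, ν = fun q => r q • n q := ⟨_, rfl⟩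
  have sν : ContDiffOn ℝ ∞ ν U := hν ▸ sr.smul sn
  have aν : ∀ q ∈ U, along a ν q = 0 := fun q hq => by
    rw [hν, along_smul (h.diff sr hq) (h.diff sn hq), ar q hq, an q hq]
    module
  have bν : ∀ q ∈ U, along b ν q = -((r q)⁻¹ • w q) := fun q hq => by
    rw [hν, along_smul (h.diff sr hq) (h.diff sn hq), br q hq, bn q hq, zero_smul, zero_add,
      smul_neg, smul_smul]
    congr 2
    rw [eq_inv_of_mul_eq_one_left (a := r q * inner ℝ (n q) (n q)) (b := r q)]
    rw [← rN q hq]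
    ring
  have νν : ∀ q ∈ U, inner ℝ (ν q) (ν q) = (1 : ℝ) := fun q hq => by
    rw [hν, inner_smul_left, inner_smul_right, conj_trivial, ← mul_assoc, rN q hq]
  have νw : ∀ q ∈ U, inner ℝ (ν q) (w q) = (0 : ℝ) := fun q hq => by
    rw [hν, inner_smul_left, nw q hq, mul_zero]
  -- the axis
  obtain ⟨β, hβ0, hβ1⟩ := exists_orthonormalBasis_pair (u := -ν p) (v := w p)
    (by rw [inner_neg_neg, νν p hp]) (ww p hp) (by rw [inner_neg_left, νw p hp, neg_zero])
  obtain ⟨m, hm⟩ : ∃ m, m = β 2 := ⟨_, rfl⟩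
  have mm : inner ℝ m m = (1 : ℝ) := by rw [hm, β.inner_eq_ite]; simp
  -- The combination `⟨w,m⟩² |n|² + ⟨n,m⟩²` is chosen because it is constant along `b` and solves
  -- `a(g) = 2τ g`. It vanishes at `p`, hence everywhere, and being a sum of nonnegative terms it
  -- makes both `⟨w,m⟩` and `⟨n,m⟩` vanish.
  have hg : ∀ q ∈ U, inner ℝ (w q) m * inner ℝ (w q) m * inner ℝ (n q) (n q) +
      inner ℝ (n q) m * inner ℝ (n q) m = (0 : ℝ) := by
    intro q hq
    have swm : ContDiffOn ℝ ∞ (fun q => inner ℝ (w q) m) U := sw.inner ℝ contDiffOn_const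
    have snm : ContDiffOn ℝ ∞ (fun q => inner ℝ (n q) m) U := sn.inner ℝ contDiffOn_const
    have hd : ∀ (c : E 2 → E 2) (q) (_ : q ∈ U), along c (fun q => inner ℝ (w q) m *
        inner ℝ (w q) m * inner ℝ (n q) (n q) + inner ℝ (n q) m * inner ℝ (n q) m) q =
        2 * inner ℝ (w q) m * inner ℝ (along c w q) m * inner ℝ (n q) (n q) +
        inner ℝ (w q) m * inner ℝ (w q) m * along c (fun q => inner ℝ (n q) (n q)) q +
        2 * inner ℝ (n q) m * inner ℝ (along c n q) m := by
      intro c q hq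
      have dwm := h.diff swm hq
      have dnm := h.diff snm hq
      have dww : DifferentiableAt ℝ (fun q => inner ℝ (w q) m * inner ℝ (w q) m) q := dwm.mul dwm
      rw [along_add (F := fun q => inner ℝ (w q) m * inner ℝ (w q) m * inner ℝ (n q) (n q))
        (F' := fun q => inner ℝ (n q) m * inner ℝ (n q) m) (dww.mul (h.diff sN hq))
        (dnm.mul dnm), along_mul dww (h.diff sN hq), along_mul dwm dwm, along_mul dnm dnm,
        along_inner_const (h.diff sw hq), along_inner_const (h.diff sn hq)]
      ring
    refine h.eq_zero_of_along_eq_mul hc (σ := fun q => 2 * inner ℝ (P q) (n q))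
      (((swm.mul swm).mul sN).add (snm.mul snm)) (continuousOn_const.mul cτ)
      (fun q hq => ?_) (fun q hq => ?_) hp ?_ hq
    · refine (hd a q hq).trans ?_
      rw [aw q hq, an q hq, aN q hq, inner_zero_left, inner_smul_left, conj_trivial]
      simp only [mul_zero, zero_mul, zero_add]
      ring
    · refine (hd b q hq).trans ?_
      rw [← hn, bn q hq, bN q hq, inner_neg_left, inner_smul_left, conj_trivial]
      ring
    · have h1 : inner ℝ (w p) m = (0 : ℝ) := by rw [← hβ1, hm, β.inner_eq_ite]; simp
      have h2 : inner ℝ (ν p) m = (0 : ℝ) := by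
        rw [← neg_eq_zero, ← inner_neg_left, ← hβ0, hm, β.inner_eq_ite]; simp
      have h3 : inner ℝ (n p) m = (0 : ℝ) := by
        rw [hν, inner_smul_left] at h2
        exact (mul_eq_zero.1 h2).resolve_left (rpos p hp).ne'
      simp [h1, h3]
  have wm : ∀ q ∈ U, inner ℝ (w q) m = (0 : ℝ) := fun q hq => by
    have h1 := hg q hq
    have h2 := Npos q hq
    by_contra hne
    have : 0 < inner ℝ (w q) m * inner ℝ (w q) m := mul_self_pos.2 hne
    nlinarith [mul_pos this h2, mul_self_nonneg (inner ℝ (n q) m)]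
  have nm : ∀ q ∈ U, inner ℝ (n q) m = (0 : ℝ) := fun q hq => by
    have h1 := hg q hq
    rw [wm q hq] at h1
    simpa using h1
  have νm : ∀ q ∈ U, inner ℝ (ν q) m = (0 : ℝ) := fun q hq => by
    rw [hν, inner_smul_left, nm q hq, mul_zero]
  have Pdec : ∀ q ∈ U, P q = inner ℝ (P q) (ν q) • ν q + inner ℝ (P q) m • m := fun q hq => by
    have := eq_of_orthonormal_triple (ww q hq) (νν q hq) mm
      (by rw [real_inner_comm, νw q hq]) (wm q hq) (νm q hq) (P q)
    rwa [Pw q hq, zero_smul, zero_add] at this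
  have PP : ∀ q ∈ U, inner ℝ (P q) (P q) = inner ℝ (P q) (ν q) ^ 2 + inner ℝ (P q) m ^ 2 :=
    fun q hq => by
      conv_lhs => rw [Pdec q hq]
      simp only [inner_add_left, inner_add_right, inner_smul_left, inner_smul_right, νν q hq, mm,
        νm q hq, real_inner_comm (ν q) m, conj_trivial]
      ring
  -- the height and the centre of the parallels
  obtain ⟨z, hz⟩ : ∃ z : E 2 → ℝ, z = fun q => inner ℝ (X q) m := ⟨_, rfl⟩
  have sz : ContDiffOn ℝ ∞ z U := hz ▸ h.smooth_X.inner ℝ contDiffOn_const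
  have az : ∀ q ∈ U, along a z q = inner ℝ (P q) m := fun q hq => by
    rw [hz, along_inner_const (h.diff h.smooth_X hq), hP]
  have bz : ∀ q ∈ U, along b z q = 0 := fun q hq => by
    rw [hz, along_inner_const (h.diff h.smooth_X hq), ← hw, wm q hq]
  have ar' : ∀ q ∈ U, along a r q = -inner ℝ (P q) (ν q) := fun q hq => by
    rw [ar q hq, hν, inner_smul_right, mul_comm]
  -- `X + r ν` is the centre of the circle through `X`; removing its height along `m` leaves a
  -- constant point of the axis.
  obtain ⟨C, hC⟩ : ∃ C : E 2 → E 3, C = fun q => X q + r q • ν q - z q • m := ⟨_, rfl⟩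
  have hdC : ∀ (c : E 2 → E 2) (q) (_ : q ∈ U), along c C q =
      along c X q + (along c r q • ν q + r q • along c ν q) - along c z q • m := by
    intro c q hq
    have dX := h.diff h.smooth_X hq
    have dr := h.diff sr hq
    have dν := h.diff sν hq
    have dz := h.diff sz hq
    have drν : DifferentiableAt ℝ (fun y => r y • ν y) q := dr.smul dν
    have dzm : DifferentiableAt ℝ (fun y => z y • m) q := dz.smul_const m
    rw [hC, along_sub (F := fun q => X q + r q • ν q) (dX.add drν) dzm, along_add dX drν,
      along_smul dr dν, along_smul dz (differentiableAt_const m), along_const, smul_zero, add_zero]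
  have hCp : ∀ q ∈ U, C q = C p := fun q hq => by
    refine h.eq_of_along_eq_zero hc (F := C) ?_ (fun q hq => ?_) (fun q hq => ?_) hp hq
    · rw [hC]
      exact (h.smooth_X.add (sr.smul sν)).sub (sz.smul contDiffOn_const)
    · rw [hdC a q hq, ← hP, ar' q hq, aν q hq, az q hq]
      conv_lhs => enter [1, 1]; rw [Pdec q hq]
      module
    · rw [hdC b q hq, ← hw, br q hq, bν q hq, bz q hq, smul_neg, smul_smul,
        mul_inv_cancel₀ (rpos q hq).ne']
      module
  -- the angle
  obtain ⟨cs, hcs⟩ : ∃ cs : E 2 → ℝ, cs = fun q => inner ℝ (-ν q) (β 0) := ⟨_, rfl⟩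
  obtain ⟨sn', hsn⟩ : ∃ sn' : E 2 → ℝ, sn' = fun q => inner ℝ (-ν q) (β 1) := ⟨_, rfl⟩
  have scs : ContDiffOn ℝ ∞ cs U := hcs ▸ sν.neg.inner ℝ contDiffOn_const
  have ssn : ContDiffOn ℝ ∞ sn' U := hsn ▸ sν.neg.inner ℝ contDiffOn_const
  have νdec : ∀ q ∈ U, -ν q = cs q • β 0 + sn' q • β 1 := fun q hq => by
    have := β.sum_repr' (-ν q)
    have h3 : inner ℝ m (-ν q) = 0 := by rw [inner_neg_right, real_inner_comm, νm q hq, neg_zero]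
    rw [Fin.sum_univ_three, ← hm, h3, zero_smul, add_zero, real_inner_comm (-ν q) (β 0),
      real_inner_comm (-ν q) (β 1)] at this
    rw [hcs, hsn, this]
  have β00 : inner ℝ (β 0) (β 0) = (1 : ℝ) := by rw [β.inner_eq_ite]; simp
  have β11 : inner ℝ (β 1) (β 1) = (1 : ℝ) := by rw [β.inner_eq_ite]; simp
  have β01 : inner ℝ (β 0) (β 1) = (0 : ℝ) := by rw [β.inner_eq_ite]; simp
  have β10 : inner ℝ (β 1) (β 0) = (0 : ℝ) := by rw [β.inner_eq_ite]; simp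
  have hcs2 : ∀ q ∈ U, cs q ^ 2 + sn' q ^ 2 = 1 := fun q hq => by
    rw [← νν q hq, ← inner_neg_neg, νdec q hq]
    simp only [inner_add_left, inner_add_right, inner_smul_left, inner_smul_right, β00, β11, β01,
      β10, conj_trivial]
    ring
  -- Positivity of the cosine makes `arcsin` of the sine the polar angle and keeps it smooth;
  -- positivity of `⟨w, β 1⟩` makes the angle strictly monotone along `b`. Both hold at `p` by the
  -- choice of `β`.
  let V : Set (E 2) := (U ∩ cs ⁻¹' Set.Ioi 0) ∩ (U ∩ (fun q => inner ℝ (w q) (β 1)) ⁻¹' Set.Ioi 0)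
  have hVU : V ⊆ U := fun q hq => hq.1.1
  have hVo : IsOpen V := (scs.continuousOn.isOpen_inter_preimage h.isOpen isOpen_Ioi).inter
    ((sw.inner ℝ contDiffOn_const).continuousOn.isOpen_inter_preimage h.isOpen isOpen_Ioi)
  have hpV : p ∈ V := by
    refine ⟨⟨hp, ?_⟩, hp, ?_⟩
    · change 0 < cs p
      rw [hcs]
      change 0 < inner ℝ (-ν p) (β 0)
      rw [← hβ0, β00]
      exact one_pos
    · change 0 < inner ℝ (w p) (β 1)
      rw [← hβ1, β11]
      exact one_pos
  have hsn1 : ∀ q ∈ V, sn' q ^ 2 < 1 := fun q hq => by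
    have h1 := hcs2 q (hVU hq)
    have h2 : 0 < cs q := hq.1.2
    nlinarith
  have hsnl : ∀ q ∈ V, -1 < sn' q ∧ sn' q < 1 := fun q hq => by
    rw [← abs_lt, ← sq_lt_one_iff_abs_lt_one]
    exact hsn1 q hq
  obtain ⟨θ, hθ⟩ : ∃ θ : E 2 → ℝ, θ = fun q => Real.arcsin (sn' q) := ⟨_, rfl⟩
  have hsin : ∀ q ∈ V, Real.sin (θ q) = sn' q := fun q hq => by
    rw [hθ, Real.sin_arcsin (hsnl q hq).1.le (hsnl q hq).2.le]
  have hcos : ∀ q ∈ V, Real.cos (θ q) = cs q := fun q hq => by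
    have h2 : 0 < cs q := hq.1.2
    rw [hθ, Real.cos_arcsin, ← hcs2 q (hVU hq), add_sub_cancel_right, Real.sqrt_sq h2.le]
  have dθ : ∀ (c : E 2 → E 2) (q) (_ : q ∈ V), along c θ q =
      1 / √(1 - sn' q ^ 2) * inner ℝ (-along c ν q) (β 1) := by
    intro c q hq
    have hd := Real.differentiableAt_arcsin.2 ⟨(hsnl q hq).1.ne', (hsnl q hq).2.ne⟩
    have hdn : DifferentiableAt ℝ (fun y => -ν y) q := (h.diff sν (hVU hq)).neg
    rw [hθ, along_comp hd (h.diff ssn (hVU hq)), Real.deriv_arcsin]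
    congr 1
    rw [hsn, along_inner_const hdn]
    congr 1
    simp [along, fderiv_fun_neg]
  -- The profile equations are the components of the minimality equation along `ν` and `m`; `ν` and
  -- `m` are constant along `a`, so second derivatives of `r` and `z` are components of `a(P)`.
  have aar : ∀ q ∈ U, along a (along a r) q = -inner ℝ (along a P q) (ν q) := fun q hq => by
    rw [along_congr h.isOpen ar' hq]
    have h1 := along_inner (a := a) (h.diff sP hq) (h.diff sν hq)
    rw [aν q hq, inner_zero_right, add_zero] at h1
    rw [← h1, along, along]
    simp [fderiv_fun_neg]
  have aaz : ∀ q ∈ U, along a (along a z) q = inner ℝ (along a P q) m := fun q hq => by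
    rw [along_congr h.isOpen az hq, along_inner_const (h.diff sP hq)]
  have nν : ∀ q ∈ U, inner ℝ (n q) (ν q) = (r q)⁻¹ := fun q hq => by
    rw [hν, inner_smul_right]
    refine eq_inv_of_mul_eq_one_left ?_
    rw [← rN q hq]
    ring
  have hL : ∀ q ∈ U, inner ℝ (P q) (P q) = along a r q ^ 2 + along a z q ^ 2 := fun q hq => by
    rw [PP q hq, ar' q hq, az q hq, neg_sq]
  refine ⟨V, hVU, hVo, hpV, β, C p, r, z, θ, ⟨sr.mono hVU, sz.mono hVU, ?_,
    fun q hq => rpos q (hVU hq), fun q hq => ?_, fun q hq => br q (hVU hq),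
    fun q hq => bz q (hVU hq), fun q hq => ?_, fun q hq => ?_, fun q hq => ?_, fun q hq => ?_,
    fun q hq => ?_⟩, ?_⟩
  · intro q hq
    rw [hθ]
    exact ((Real.contDiffAt_arcsin (hsnl q hq).1.ne' (hsnl q hq).2.ne).comp q
      (ssn.contDiffAt (h.isOpen.mem_nhds (hVU hq)))).contDiffWithinAt
  · rw [hcos q hq, hsin q hq, ← hCp q (hVU hq), hC, ← hm, mul_smul, mul_smul]
    have h1 := νdec q (hVU hq)
    have h2 : X q + r q • ν q - z q • m + r q • cs q • β 0 + r q • sn' q • β 1 + z q • m =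
        X q + r q • ν q + r q • (cs q • β 0 + sn' q • β 1) := by module
    rw [h2, ← h1]
    module
  · rw [dθ a q hq, aν q (hVU hq), neg_zero, inner_zero_left, mul_zero]
  · rw [dθ b q hq, bν q (hVU hq), neg_neg, inner_smul_left, conj_trivial]
    have h1 : 0 < inner ℝ (w q) (β 1) := hq.2.2
    have h2 : 0 < √(1 - sn' q ^ 2) := Real.sqrt_pos.2 (by linarith [hsn1 q hq])
    have h3 := rpos q (hVU hq)
    positivity
  · rw [← hL q (hVU hq)]
    exact hsp q (hVU hq)
  · have hq' := hVU hq
    have hf0' := hf0 _ (h.mem q hq')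
    have h3 := (rpos q hq').ne'
    rw [← hL q hq', aar q hq', aP q hq', inner_sub_left, inner_smul_left, inner_smul_left,
      nν q hq', ar' q hq', conj_trivial, conj_trivial]
    field_simp
    ring
  · have hq' := hVU hq
    have hf0' := hf0 _ (h.mem q hq')
    rw [← hL q hq', aaz q hq', aP q hq', inner_sub_left, inner_smul_left, inner_smul_left,
      nm q hq', az q hq', conj_trivial, conj_trivial]
    field_simp
    ring
  · rw [hθ, hsn]
    change Real.arcsin (inner ℝ (-ν p) (β 1)) = 0
    rw [← hβ0, β01, Real.arcsin_zero]

/-! ### Construction of the adapted frame -/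

theorem contDiffOn_vec2 {F : Type*} [NormedAddCommGroup F] [NormedSpace ℝ F] {n : WithTop ℕ∞}
    {u v : F → ℝ} {U : Set F} (hu : ContDiffOn ℝ n u U) (hv : ContDiffOn ℝ n v U) :
    ContDiffOn ℝ n (fun s => (!₂[u s, v s] : E 2)) U := by
  rw [contDiffOn_euclidean]
  intro i
  fin_cases i
  exacts [hu, hv]

theorem along_prod {V : Type*} [NormedAddCommGroup V] [NormedSpace ℝ V] {t : V → ℝ}
    {X : V → E 3} {c : V → V} {q : V} (ht : DifferentiableAt ℝ t q) (hX : DifferentiableAt ℝ X q) :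
    along c (fun y => (t y, X y)) q = (along c t q, along c X q) := by
  rw [along, (ht.hasFDerivAt.prodMk hX.hasFDerivAt).fderiv]
  rfl

/-- `T ≠ 0` means that the coordinate gradient of `t` does not vanish. Its rotation by a right
angle, normalized, gives `b`; the gradient divided by its squared length, with the component along
`b` removed, gives `a`. -/
theorem exists_fields {f : ℝ → ℝ} {U : Set (E 2)} {t : E 2 → ℝ} {X : E 2 → E 3}
    {x : E 2 → W} (hxtX : x = fun q => (t q, X q)) (hU : IsOpen U)
    (st : ContDiffOn ℝ ∞ t U) (sX : ContDiffOn ℝ ∞ X U) (hsp : ∀ q ∈ U, IsSpacelikeAt f x q)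
    (hA : ∀ q ∈ U, IsClassAAt f x q) :
    ∃ a b : E 2 → E 2, ContDiffOn ℝ ∞ a U ∧ ContDiffOn ℝ ∞ b U ∧ ∀ q ∈ U,
      along a t q = 1 ∧ along b t q = 0 ∧
      inner ℝ (along b X q) (along b X q) = (1 : ℝ) ∧
      inner ℝ (along a X q) (along b X q) = (0 : ℝ) := by
  have hdx : ∀ q ∈ U, ∀ v, fderiv ℝ x q v = (fderiv ℝ t q v, fderiv ℝ X q v) := fun q hq v => by
    rw [hxtX]
    exact along_prod (c := fun _ => v) (differentiableAt_of_contDiffOn hU st hq)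
      (differentiableAt_of_contDiffOn hU sX hq)
  have s0 : ContDiffOn ℝ ∞ (along (fun _ => EuclideanSpace.single 0 1) t) U :=
    contDiffOn_along hU contDiffOn_const st
  have s1 : ContDiffOn ℝ ∞ (along (fun _ => EuclideanSpace.single 1 1) t) U :=
    contDiffOn_along hU contDiffOn_const st
  obtain ⟨t₀, ht₀⟩ : ∃ t₀, t₀ = along (fun _ => EuclideanSpace.single (0 : Fin 2) (1 : ℝ)) t :=
    ⟨_, rfl⟩
  obtain ⟨t₁, ht₁⟩ : ∃ t₁, t₁ = along (fun _ => EuclideanSpace.single (1 : Fin 2) (1 : ℝ)) t :=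
    ⟨_, rfl⟩
  rw [← ht₀] at s0
  rw [← ht₁] at s1
  have hdt : ∀ q v, fderiv ℝ t q v = v 0 * t₀ q + v 1 * t₁ q := fun q v => by
    conv_lhs => rw [eq_single_add_single v]
    rw [map_add, map_smul, map_smul, ht₀, ht₁]
    rfl
  have hgrad : ∀ q ∈ U, 0 < t₀ q ^ 2 + t₁ q ^ 2 := fun q hq => by
    by_contra hneg
    have h0 : t₀ q = 0 := by nlinarith [sq_nonneg (t₀ q), sq_nonneg (t₁ q)]
    have h1 : t₁ q = 0 := by nlinarith [sq_nonneg (t₀ q), sq_nonneg (t₁ q)]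
    refine (hA q hq).1 (eq_tangentPart (hsp q hq).isNondegenerateAt fun w => ?_)
    rw [metric_dt, hdx q hq, hdt, h0, h1]
    simp [inducedMetric, metric]
  let b₀ : E 2 → E 2 := fun q => !₂[-t₁ q, t₀ q]
  have sb₀ : ContDiffOn ℝ ∞ b₀ U := contDiffOn_vec2 s1.neg s0
  -- Both components of the image of `b₀` would vanish, contradicting that the surface is
  -- space-like.
  have hb₀ : ∀ q ∈ U, along b₀ X q ≠ 0 := fun q hq h0 => by
    have hb : b₀ q ≠ 0 := by
      intro hb
      have h1 : -t₁ q = 0 := congrArg (fun v : E 2 => v 0) hb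
      have h2 : t₀ q = 0 := congrArg (fun v : E 2 => v 1) hb
      have := hgrad q hq
      rw [h2, neg_eq_zero.1 h1] at this
      simp at this
    have := hsp q hq _ hb
    rw [inducedMetric, hdx q hq, hdt, show fderiv ℝ X q (b₀ q) = 0 from h0] at this
    simp [metric, b₀] at this
    have h2 : -(t₁ q * t₀ q) + t₀ q * t₁ q = 0 := by ring
    rw [h2] at this
    simp at this
  have sXb₀ : ContDiffOn ℝ ∞ (along b₀ X) U := contDiffOn_along hU sb₀ sX
  let b : E 2 → E 2 := fun q => ‖along b₀ X q‖⁻¹ • b₀ q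
  have sb : ContDiffOn ℝ ∞ b U :=
    ((sXb₀.norm ℝ hb₀).inv fun q hq => norm_ne_zero_iff.2 (hb₀ q hq)).smul sb₀
  have hbX : ∀ q, along b X q = ‖along b₀ X q‖⁻¹ • along b₀ X q := fun q => map_smul _ _ _
  have sXb : ContDiffOn ℝ ∞ (along b X) U := contDiffOn_along hU sb sX
  let c : E 2 → E 2 := fun q => (t₀ q ^ 2 + t₁ q ^ 2)⁻¹ • !₂[t₀ q, t₁ q]
  have sc : ContDiffOn ℝ ∞ c U :=
    (((s0.pow 2).add (s1.pow 2)).inv fun q hq => (hgrad q hq).ne').smul (contDiffOn_vec2 s0 s1)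
  have sXc : ContDiffOn ℝ ∞ (along c X) U := contDiffOn_along hU sc sX
  have hbt : ∀ q, fderiv ℝ t q (b q) = 0 := fun q => by
    rw [hdt]
    simp [b, b₀]
    ring
  have hbb : ∀ q ∈ U, inner ℝ (along b X q) (along b X q) = (1 : ℝ) := fun q hq => by
    rw [hbX, inner_smul_left, inner_smul_right, real_inner_self_eq_norm_sq, conj_trivial]
    have := norm_ne_zero_iff.2 (hb₀ q hq)
    field_simp
  refine ⟨fun q => c q - inner ℝ (along c X q) (along b X q) • b q, b,
    sc.sub ((sXc.inner ℝ sXb).smul sb), sb, fun q hq => ⟨?_, hbt q, hbb q hq, ?_⟩⟩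
  · change fderiv ℝ t q (c q - inner ℝ (along c X q) (along b X q) • b q) = 1
    rw [map_sub, (fderiv ℝ t q).map_smul _ (b q), hbt, smul_zero, sub_zero, hdt]
    have := (hgrad q hq).ne'
    simp [c]
    field_simp
  · have h1 : along (fun q => c q - inner ℝ (along c X q) (along b X q) • b q) X q =
        along c X q - inner ℝ (along c X q) (along b X q) • along b X q := by
      change fderiv ℝ X q (c q - inner ℝ (along c X q) (along b X q) • b q) = _
      rw [map_sub, (fderiv ℝ X q).map_smul _ (b q)]
      rfl
    rw [h1, inner_sub_left, inner_smul_left, hbb q hq, conj_trivial, mul_one, sub_self]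

/-- Tangent vectors have the form `(α, α P + β w)`. In each of the two tangency conditions the time
component determines `α` and the inner product with `w` determines `β`; what remains of the spatial
component is `a(w) = 0` and the minimality equation, respectively. -/
theorem exists_isAdaptedFrame {f : ℝ → ℝ} {I : Set ℝ} {U : Set (E 2)} {t : E 2 → ℝ}
    {X : E 2 → E 3} {x : E 2 → W} (hxtX : x = fun q => (t q, X q)) (hf0 : ∀ t ∈ I, f t ≠ 0)
    (hU : IsOpen U) (st : ContDiffOn ℝ ∞ t U) (sX : ContDiffOn ℝ ∞ X U)
    (hI : ∀ q ∈ U, x q ∈ spacetime I) (hsp : ∀ q ∈ U, IsSpacelikeAt f x q)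
    (hH : ∀ q ∈ U, meanCurvature f x q = 0) (hA : ∀ q ∈ U, IsClassAAt f x q) :
    ∃ a b, IsAdaptedFrame f I U t X a b := by
  obtain ⟨a, b, sa, sb, hab⟩ := exists_fields hxtX hU st sX hsp hA
  have hx : ContDiffOn ℝ ∞ x U := hxtX ▸ st.prodMk sX
  have h1 : ∀ c : E 2 → E 2, ∀ q ∈ U, fderiv ℝ x q (c q) = (along c t q, along c X q) := by
    intro c q hq
    rw [hxtX]
    exact along_prod (differentiableAt_of_contDiffOn hU st hq)
      (differentiableAt_of_contDiffOn hU sX hq)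
  have h2 : ∀ c d : E 2 → E 2, ContDiffOn ℝ ∞ d U → ∀ q ∈ U, along c (along d x) q =
      (along c (along d t) q, along c (along d X) q) := by
    intro c d hd q hq
    rw [along_congr (F := along d x) hU (h1 d) hq]
    exact along_prod (differentiableAt_of_contDiffOn hU (contDiffOn_along hU hd st) hq)
      (differentiableAt_of_contDiffOn hU (contDiffOn_along hU hd sX) hq)
  have hat : ∀ q ∈ U, along a t q = 1 := fun q hq => (hab q hq).1
  have hbt : ∀ q ∈ U, along b t q = 0 := fun q hq => (hab q hq).2.1
  have hww : ∀ q ∈ U, inner ℝ (along b X q) (along b X q) = (1 : ℝ) :=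
    fun q hq => (hab q hq).2.2.1
  have hPw : ∀ q ∈ U, inner ℝ (along a X q) (along b X q) = (0 : ℝ) :=
    fun q hq => (hab q hq).2.2.2
  have hacc : ∀ c d : E 2 → E 2, ContDiffOn ℝ ∞ d U → ∀ q ∈ U,
      accel f x q (c q) (d q) = (along c (along d t) q, along c (along d X) q) +
        christoffel f (x q) (along c t q, along c X q) (along d t q, along d X q) -
          fderiv ℝ x q (fderiv ℝ d q (c q)) := by
    intro c d hd q hq
    have h3 := along_along (a := c) (differentiableAt_of_contDiffOn hU hd hq)
      ((hx.contDiffAt (hU.mem_nhds hq)).of_le two_le_infty)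
    rw [h2 c d hd q hq] at h3
    rw [accel, h1 c q hq, h1 d q hq, h3]
    abel
  have haa0 : ∀ q ∈ U, a q ≠ 0 := fun q hq h0 => by
    have := hat q hq
    simp [along, h0] at this
  have hbb0 : ∀ q ∈ U, b q ≠ 0 := fun q hq h0 => by
    have := hww q hq
    simp [along, h0] at this
  have hg : ∀ c d : E 2 → E 2, ∀ q ∈ U, inducedMetric f x q (c q) (d q) =
      -(along c t q * along d t q) + f (t q) ^ 2 * inner ℝ (along c X q) (along d X q) :=
    fun c d q hq => by rw [inducedMetric, h1 c q hq, h1 d q hq, metric, hxtX]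
  have hgab : ∀ q ∈ U, inducedMetric f x q (a q) (b q) = 0 := fun q hq => by
    rw [hg a b q hq, hbt q hq, hPw q hq]; simp
  have htan : ∀ q ∈ U, ∀ v, ∃ α β : ℝ, fderiv ℝ x q v =
      (α, α • along a X q + β • along b X q) := fun q hq v => by
    obtain ⟨α, β, h⟩ := exists_add_smul_eq
      (det_ne_zero_of_orthogonal (hsp q hq) (haa0 q hq) (hbb0 q hq) (hgab q hq)) v
    refine ⟨α, β, ?_⟩
    rw [← h, map_add, map_smul, map_smul, h1 a q hq, h1 b q hq, hat q hq, hbt q hq]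
    ext1 <;> simp
  have hxq : ∀ q, (x q).1 = t q := fun q => by rw [hxtX]
  have hf : ∀ q ∈ U, f (t q) ≠ 0 := fun q hq => by
    rw [← hxq]; exact hf0 _ (hI q hq)
  have dw : ∀ q ∈ U, DifferentiableAt ℝ (along b X) q := fun q hq =>
    differentiableAt_of_contDiffOn hU (contDiffOn_along hU sb sX) hq
  have dP : ∀ q ∈ U, DifferentiableAt ℝ (along a X) q := fun q hq =>
    differentiableAt_of_contDiffOn hU (contDiffOn_along hU sa sX) hq
  have hwd : ∀ c : E 2 → E 2, ∀ q ∈ U, inner ℝ (along c (along b X) q) (along b X q) = (0 : ℝ) := by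
    intro c q hq
    have h3 := along_eq_zero_of_const (a := c) hU hww hq
    rw [along_inner (dw q hq) (dw q hq), real_inner_comm (along c (along b X) q)] at h3
    linarith
  -- Here `α = 0` and `β = f'/f`, which is exactly the Christoffel term `(f'/f) w`, so nothing is
  -- left for `a(w)`.
  have hAA : ∀ q ∈ U, along a (along b X) q = 0 := by
    intro q hq
    obtain ⟨v, hv⟩ := (isClassAAt_iff (by rw [hxq]; exact hf q hq) (hsp q hq)
      (by rw [h1 a q hq, hat q hq]; exact one_ne_zero) (by rw [h1 b q hq, hbt q hq]) (hbb0 q hq)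
      (hgab q hq)).1 (hA q hq)
    rw [hacc a b sb q hq, eq_sub_iff_add_eq, ← map_add] at hv
    obtain ⟨α, β, h⟩ := htan q hq (v + fderiv ℝ b q (a q))
    rw [h, along_eq_zero_of_const hU hbt hq, hat q hq, hbt q hq, christoffel] at hv
    have e1 := congrArg Prod.fst hv
    have e2 := congrArg Prod.snd hv
    simp only [Prod.fst_add, Prod.snd_add, Prod.smul_fst, Prod.smul_snd, hPw q hq, mul_zero,
      smul_zero, add_zero, one_smul, zero_smul] at e1 e2
    rw [e1, zero_smul, zero_add] at e2
    have e3 := congrArg (fun Y => inner ℝ Y (along b X q)) e2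
    simp only [inner_add_left, inner_smul_left, hww q hq, hwd a q hq, conj_trivial, mul_one,
      zero_add] at e3
    rw [e3] at e2
    exact right_eq_add.1 e2
  have hE : ∀ q ∈ U, 0 < f (t q) ^ 2 * inner ℝ (along a X q) (along a X q) - 1 := fun q hq => by
    have h3 := hsp q hq _ (haa0 q hq)
    rw [hg a a q hq, hat q hq] at h3
    linarith
  refine ⟨a, b, hU, st, sX, sa, sb, fun q hq => hxq q ▸ hI q hq, hat, hbt, hww, hPw,
    fun q hq => by linarith [hE q hq], hAA, fun q hq => ?_⟩
  obtain ⟨v, hv⟩ := (meanCurvature_eq_zero_iff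
    (((hx.contDiffAt (hU.mem_nhds hq)).of_le two_le_infty).isSymmSndFDerivAt (by simp)) (hsp q hq)
    (haa0 q hq) (hbb0 q hq) (hgab q hq)).1 (hH q hq)
  obtain ⟨α, β, h⟩ := htan q hq (v + ((inducedMetric f x q (a q) (a q))⁻¹ • fderiv ℝ a q (a q) +
    (inducedMetric f x q (b q) (b q))⁻¹ • fderiv ℝ b q (b q)))
  rw [map_add, map_add, map_smul, map_smul, hv, hacc a a sa q hq, hacc b b sb q hq, hg a a q hq,
    hg b b q hq, along_eq_zero_of_const hU hat hq, along_eq_zero_of_const hU hbt hq, hat q hq,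
    hbt q hq, hww q hq, christoffel, christoffel, hxq] at h
  set L : ℝ := inner ℝ (along a X q) (along a X q) with hLdef
  have hEq := hE q hq
  have hfq := hf q hq
  set d := f (t q) ^ 2 * L - 1 with hd
  have hd' : -(1 * 1) + f (t q) ^ 2 * L = d := by rw [hd]; ring
  have hG : -(0 * 0) + f (t q) ^ 2 * 1 = f (t q) ^ 2 := by ring
  rw [hd', hG] at h
  have e1 := congrArg Prod.fst h
  have e2 := congrArg Prod.snd h
  simp only [Prod.fst_add, Prod.snd_add, Prod.fst_sub, Prod.snd_sub, Prod.smul_fst, Prod.smul_snd,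
    smul_eq_mul, zero_smul, one_smul, add_zero, zero_add, hww q hq] at e1 e2
  have hα : α = deriv f (t q) / f (t q) * (f (t q) ^ 2 * L / d + 1) := by
    rw [← e1]
    field_simp
    ring
  have hPa : inner ℝ (along a (along a X) q) (along b X q) = (0 : ℝ) := by
    have h3 := along_eq_zero_of_const (a := a) hU hPw hq
    rwa [along_inner (dP q hq) (dw q hq), hAA q hq, inner_zero_right, add_zero] at h3
  have e4 : d⁻¹ • (along a (along a X) q + (deriv f (t q) / f (t q)) •
      (along a X q + along a X q)) + (f (t q) ^ 2)⁻¹ • along b (along b X) q =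
      α • along a X q + β • along b X q := by
    rw [← e2]
    simp only [smul_zero, add_zero]
    module
  -- All other terms are orthogonal to `w`: for `a(P)` this follows by differentiating `⟨P, w⟩ = 0`
  -- along `a` and using `a(w) = 0`.
  have hβ : β = 0 := by
    have e5 := congrArg (fun Y => inner ℝ Y (along b X q)) e4
    simp only [inner_add_left, inner_smul_left, hww q hq, hwd b q hq, hPa, hPw q hq] at e5
    simpa using e5.symm
  rw [hβ, zero_smul, add_zero] at e4
  have e6 : along a (along a X) q = d • (α • along a X q) - (2 * (deriv f (t q) / f (t q))) •
      along a X q - (d * (f (t q) ^ 2)⁻¹) • along b (along b X) q := by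
    rw [← e4, smul_add, smul_smul, mul_inv_cancel₀ hEq.ne']
    module
  have e7 : L - (f (t q) ^ 2)⁻¹ = d * (f (t q) ^ 2)⁻¹ := by
    rw [hd]; field_simp
  have e8 : deriv f (t q) / f (t q) * (2 * f (t q) ^ 2 * L - 3) =
      d * α - 2 * (deriv f (t q) / f (t q)) := by
    rw [hα]
    field_simp
    rw [hd]
    ring
  rw [e6, e7, e8]
  module

/-! ### Products with planes are totally geodesic -/

/-- The parametrization is affine, so only the Christoffel term contributes, and it maps pairs of
vectors of `ℝ × span(β 0, β 1)` into the same space. -/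
theorem isTotallyGeodesicHypersurface_plane {f : ℝ → ℝ} {I : Set ℝ} (hI : IsOpen I)
    (hf0 : ∀ t ∈ I, f t ≠ 0) (β : OrthonormalBasis (Fin 3) ℝ (E 3)) (x₀ : E 3) :
    IsTotallyGeodesicHypersurface f I {q | q 0 ∈ I}
      fun q => (q 0, x₀ + (q 1 • β 0 + q 2 • β 1)) := by
  let L : E 3 →L[ℝ] W := (EuclideanSpace.proj (0 : Fin 3) : E 3 →L[ℝ] ℝ).prod
    ((EuclideanSpace.proj (1 : Fin 3) : E 3 →L[ℝ] ℝ).smulRight (β 0) +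
      (EuclideanSpace.proj (2 : Fin 3) : E 3 →L[ℝ] ℝ).smulRight (β 1))
  have hL : ∀ v : E 3, L v = (v 0, v 1 • β 0 + v 2 • β 1) := fun v => rfl
  have hin : ∀ c d c' d' : ℝ, inner ℝ (c • β 0 + d • β 1) (c' • β 0 + d' • β 1) = c * c' + d * d' :=
    fun c d c' d' => by
      simp [inner_add_left, inner_add_right, inner_smul_left, inner_smul_right, β.inner_eq_ite,
        -inner_self_eq_norm_sq_to_K]
      ring
  have hy : (fun q : E 3 => ((q 0, x₀ + (q 1 • β 0 + q 2 • β 1)) : W)) =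
      fun q => ((0, x₀) : W) + L q := by
    funext q
    rw [hL]
    ext1 <;> simp
  have hD : ∀ q, fderiv ℝ (fun q => ((0, x₀) : W) + L q) q = L := fun q =>
    (L.hasFDerivAt.const_add _).fderiv
  have hD2 : ∀ q, fderiv ℝ (fderiv ℝ (fun q => ((0, x₀) : W) + L q)) q = 0 := fun q => by
    rw [show fderiv ℝ (fun q => ((0, x₀) : W) + L q) = fun _ => L from funext hD]
    simp
  have hnd : ∀ q ∈ {q : E 3 | q 0 ∈ I},
      IsNondegenerateAt f (fun q => ((0, x₀) : W) + L q) q := by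
    intro q hq v hv
    have hfq : f (q 0) ≠ 0 := hf0 _ hq
    -- Pairing `v` with its time reflection turns the Lorentzian form into the positive definite
    -- one.
    have h := hv !₂[-v 0, v 1, v 2]
    rw [inducedMetric, hD, metric, hL v, hL !₂[-v 0, v 1, v 2], hin] at h
    simp [hL] at h
    have hpos : 0 < f (q 0) ^ 2 := by positivity
    have h0 : v 0 = 0 := by
      nlinarith [mul_self_nonneg (v 0), mul_nonneg hpos.le (mul_self_nonneg (v 1)),
        mul_nonneg hpos.le (mul_self_nonneg (v 2))]
    rw [h0] at h
    have h12 : v 1 * v 1 + v 2 * v 2 = 0 := by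
      have : f (q 0) ^ 2 * (v 1 * v 1 + v 2 * v 2) = 0 := by linarith
      exact (mul_eq_zero.1 this).resolve_left hpos.ne'
    have h1 : v 1 = 0 := by nlinarith [mul_self_nonneg (v 1), mul_self_nonneg (v 2)]
    have h2 : v 2 = 0 := by nlinarith [mul_self_nonneg (v 1), mul_self_nonneg (v 2)]
    ext i
    fin_cases i
    exacts [h0, h1, h2]
  rw [hy]
  refine ⟨hI.preimage (contDiff_coord 0 0).continuous,
    (contDiff_const.add L.contDiff).contDiffOn, fun q hq => ?_, hnd, fun q hq v w => ?_⟩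
  · simpa [spacetime, hL] using hq
  · rw [secondFundamentalForm_eq_zero_iff (hnd q hq)]
    obtain ⟨k, hk⟩ : ∃ k, k = deriv f (q 0) / f (q 0) := ⟨_, rfl⟩
    refine ⟨!₂[k * (f (q 0) ^ 2 * (v 1 * w 1 + v 2 * w 2)), k * (v 0 * w 1 + w 0 * v 1),
      k * (v 0 * w 2 + w 0 * v 2)], ?_⟩
    rw [accel, hD2, hD, hL, hL, hL, christoffel]
    simp only [Prod.fst_add, hL, zero_add, zero_apply, ← hk]
    ext1
    · simp [hin]
    · simp
      module

theorem mem_contDiffGroupoid {H : OpenPartialHomeomorph (E 2) (E 2)}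
    (h : ContDiffOn ℝ ∞ H H.source) (h' : ContDiffOn ℝ ∞ H.symm H.target) :
    H ∈ contDiffGroupoid ∞ (𝓡 2) := by
  rw [contDiffGroupoid, mem_groupoid_of_pregroupoid]
  exact ⟨by simpa [contDiffPregroupoid] using h, by simpa [contDiffPregroupoid] using h'⟩

/-! ### Charts by time and angle -/

/-- Only the derivative in the one direction `q' - q` has to vanish. The lemma is used to slide
points parallel to the angle axis. -/
theorem eq_of_fderiv_eq_zero_of_convex {V : Type*} [NormedAddCommGroup V] [NormedSpace ℝ V]
    {B : Set V} (hB : IsOpen B) (hc : Convex ℝ B) {ρ : V → ℝ} (hρ : DifferentiableOn ℝ ρ B)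
    {q q' : V} (hq : q ∈ B) (hq' : q' ∈ B) (h : ∀ y ∈ B, fderiv ℝ ρ y (q' - q) = 0) :
    ρ q' = ρ q := by
  let γ : ℝ → V := fun s => q + s • (q' - q)
  have hγB : ∀ s ∈ Set.Icc (0 : ℝ) 1, γ s ∈ B := fun s hs => hc.add_smul_sub_mem hq hq' hs
  have hd : ∀ s ∈ Set.Icc (0 : ℝ) 1, HasDerivAt (fun s => ρ (γ s)) 0 s := fun s hs => by
    have h0 := ((hasDerivAt_id s).smul_const (q' - q)).const_add q
    rw [one_smul] at h0
    have h1 := (hρ.differentiableAt (hB.mem_nhds (hγB s hs))).hasFDerivAt.comp_hasDerivAt s h0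
    rw [h _ (hγB s hs)] at h1
    exact h1
  have := constant_of_has_deriv_right_zero (f := fun s => ρ (γ s)) (a := 0) (b := 1)
    (fun s hs => (hd s hs).continuousAt.continuousWithinAt)
    (fun s hs => (hd s (Set.Ico_subset_Icc_self hs)).hasDerivWithinAt) 1 (by simp)
  simpa [γ] using this

set_option maxHeartbeats 1000000 in
-- The map `(t, θ)` is a local diffeomorphism because `b(t) = 0`, `a(t) = 1` and `b(θ) ≠ 0`. In
-- these coordinates `b` points along the angle axis, so `r` and `z` depend on time only; the
-- profile functions are their restrictions to the axis `θ = 0`.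
theorem exists_chart {f : ℝ → ℝ} {I : Set ℝ} {V : Set (E 2)} {t : E 2 → ℝ} {X : E 2 → E 3}
    {a b : E 2 → E 2} {β : OrthonormalBasis (Fin 3) ℝ (E 3)} {x₀ : E 3} {r z θ : E 2 → ℝ}
    (h : IsAdaptedFrame f I V t X a b) (hcyl : IsCylindrical f V t X a b β x₀ r z θ) {p : E 2}
    (hp : p ∈ V) (hθp : θ p = 0) :
    ∃ (H : OpenPartialHomeomorph (E 2) (E 2)) (J : Set ℝ) (ζ₁ ζ₂ : ℝ → ℝ),
      H ∈ contDiffGroupoid ∞ (𝓡 2) ∧ p ∈ H.source ∧ H.source ⊆ V ∧ IsMinimalProfile f I J ζ₁ ζ₂ ∧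
      ∀ q ∈ H.source, H q 0 ∈ J ∧ t q = H q 0 ∧ θ q = H q 1 ∧ r q = ζ₁ (H q 0) ∧
        z q = ζ₂ (H q 0) := by
  let ψ : E 2 → E 2 := fun q => !₂[t q, θ q]
  have sψ : ContDiffOn ℝ ∞ ψ V := contDiffOn_vec2 h.smooth_t hcyl.smooth_θ
  have hV := h.isOpen
  have cψ : ∀ q ∈ V, ContDiffAt ℝ ∞ ψ q := fun q hq => sψ.contDiffAt (hV.mem_nhds hq)
  have dψ : ∀ q ∈ V, DifferentiableAt ℝ ψ q := fun q hq => (cψ q hq).differentiableAt (by simp)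
  have hψv : ∀ q ∈ V, ∀ v, fderiv ℝ ψ q v = !₂[fderiv ℝ t q v, fderiv ℝ θ q v] := by
    intro q hq v
    have hd0 := ((EuclideanSpace.proj (0 : Fin 2) : E 2 →L[ℝ] ℝ).hasFDerivAt.comp q
      (dψ q hq).hasFDerivAt).fderiv
    have hd1 := ((EuclideanSpace.proj (1 : Fin 2) : E 2 →L[ℝ] ℝ).hasFDerivAt.comp q
      (dψ q hq).hasFDerivAt).fderiv
    ext i
    fin_cases i
    · exact (congrArg (fun l : E 2 →L[ℝ] ℝ => l v) hd0).symm
    · exact (congrArg (fun l : E 2 →L[ℝ] ℝ => l v) hd1).symm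
  have hψb : ∀ q ∈ V, fderiv ℝ ψ q (b q) = along b θ q • EuclideanSpace.single 1 1 := by
    intro q hq
    have := h.along_b_t q hq
    rw [along] at this
    rw [hψv q hq, this]
    ext i
    fin_cases i <;> simp [along]
  have hinv : ∀ q ∈ V, ∃ A : E 2 ≃L[ℝ] E 2, HasFDerivAt ψ (A : E 2 →L[ℝ] E 2) q := by
    intro q hq
    have hinj : Function.Injective (fderiv ℝ ψ q : E 2 →ₗ[ℝ] E 2) := by
      rw [injective_iff_map_eq_zero]
      intro v hv
      obtain ⟨s, hs⟩ := h.exists_coeff hq v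
      have hv' : fderiv ℝ ψ q v = 0 := hv
      have h0 : fderiv ℝ t q v = 0 := by
        have := congrArg (fun y : E 2 => y 0) hv'
        rw [hψv q hq] at this
        exact this
      rw [h0, zero_smul, zero_add] at hs
      rw [hs, map_smul, hψb q hq, smul_smul] at hv'
      have h1 : s * along b θ q = 0 := by simpa using congrArg (fun y : E 2 => y 1) hv'
      rw [hs, (mul_eq_zero.1 h1).resolve_right (hcyl.along_b_θ q hq), zero_smul]
    refine ⟨(LinearEquiv.ofInjectiveEndo _ hinj).toContinuousLinearEquiv, ?_⟩
    convert (dψ q hq).hasFDerivAt using 1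
    exact ContinuousLinearMap.ext fun v => rfl
  obtain ⟨A, hA⟩ := hinv p hp
  obtain ⟨H₀, hH₀, hH₀V, hpH₀⟩ : ∃ H₀ : OpenPartialHomeomorph (E 2) (E 2),
      ⇑H₀ = ψ ∧ H₀.source ⊆ V ∧ p ∈ H₀.source :=
    ⟨((cψ p hp).toOpenPartialHomeomorph ψ hA (by simp)).restrOpen V hV, rfl, fun q hq => hq.2,
      (cψ p hp).mem_toOpenPartialHomeomorph_source hA (by simp), hp⟩
  have hψV : ∀ q ∈ H₀.source, H₀.symm (ψ q) = q := fun q hq => hH₀ ▸ H₀.left_inv hq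
  have hψB : ∀ y ∈ H₀.target, ψ (H₀.symm y) = y := fun y hy => hH₀ ▸ H₀.right_inv hy
  obtain ⟨ε, hε, hball⟩ := Metric.isOpen_iff.1 H₀.open_target (ψ p) (hH₀ ▸ H₀.map_source hpH₀)
  have hsymm : ∀ y ∈ H₀.target, ContDiffAt ℝ ∞ H₀.symm y := fun y hy => by
    obtain ⟨A, hA⟩ := hinv _ (hH₀V (H₀.map_target hy))
    exact H₀.contDiffAt_symm hy (hH₀ ▸ hA) (hH₀ ▸ cψ _ (hH₀V (H₀.map_target hy)))
  -- A ball is convex and, since `θ p = 0`, is centred on the axis; hence it contains the projection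
  -- of each of its points to the axis.
  let B := Metric.ball (ψ p) ε
  have hBconv : Convex ℝ B := convex_ball _ _
  have hdist : ∀ y : E 2, dist y (ψ p) = √((y 0 - t p) ^ 2 + (y 1) ^ 2) := fun y => by
    rw [EuclideanSpace.dist_eq, Fin.sum_univ_two, Real.dist_eq, Real.dist_eq, sq_abs, sq_abs]
    simp [ψ, hθp]
  have hproj : ∀ y ∈ B, (!₂[y 0, 0] : E 2) ∈ B := fun y hy => by
    rw [Metric.mem_ball, hdist] at hy ⊢
    refine lt_of_le_of_lt (Real.sqrt_le_sqrt ?_) hy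
    simp
    positivity
  have hline : ∀ u : ℝ, (!₂[u, 0] : E 2) ∈ B ↔ u ∈ Set.Ioo (t p - ε) (t p + ε) := fun u => by
    rw [Metric.mem_ball, hdist]
    simp only [Matrix.cons_val_zero, Matrix.cons_val_one, Matrix.cons_val_fin_one,
      ne_eq, OfNat.ofNat_ne_zero, not_false_eq_true, zero_pow, add_zero, Real.sqrt_sq_eq_abs]
    rw [abs_lt, Set.mem_Ioo]
    constructor <;> rintro ⟨h1, h2⟩ <;> constructor <;> linarith
  have hdepends : ∀ ρ : E 2 → ℝ, ContDiffOn ℝ ∞ ρ V → (∀ q ∈ V, along b ρ q = 0) →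
      ∀ q ∈ H₀.source, ψ q ∈ B → ρ q = ρ (H₀.symm !₂[t q, 0]) := by
    intro ρ hρ hbρ q hq hqB
    have hρd : ∀ y ∈ B, DifferentiableAt ℝ (ρ ∘ H₀.symm) y := fun y hy =>
      DifferentiableAt.comp y (h.diff hρ (hH₀V (H₀.map_target (hball hy))))
        ((hsymm y (hball hy)).differentiableAt (by simp))
    have key := eq_of_fderiv_eq_zero_of_convex Metric.isOpen_ball hBconv (ρ := ρ ∘ H₀.symm)
      (fun y hy => (hρd y hy).differentiableWithinAt) hqB (hproj _ hqB) (fun y hy => ?_)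
    · have h1 : H₀.symm (ψ q) = q := hψV q hq
      simp only [Function.comp_apply, h1] at key
      exact key.symm
    · have hyt := hball hy
      have hys := H₀.map_target hyt
      have hyV := hH₀V hys
      have hyy : ψ (H₀.symm y) = y := hψB y hyt
      have heq : (ρ ∘ H₀.symm) ∘ ψ =ᶠ[𝓝 (H₀.symm y)] ρ := by
        filter_upwards [H₀.open_source.mem_nhds hys] with q hq
        exact congrArg ρ (hψV q hq)
      have h1 := fderiv_comp (H₀.symm y) (g := ρ ∘ H₀.symm) (f := ψ) (by rw [hyy]; exact hρd y hy)
        (dψ _ hyV)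
      rw [heq.fderiv_eq, hyy] at h1
      have h2 := hbρ _ hyV
      rw [along, h1, ContinuousLinearMap.comp_apply, hψb _ hyV, map_smul, smul_eq_mul] at h2
      have h3 := (mul_eq_zero.1 h2).resolve_left (hcyl.along_b_θ _ hyV)
      have h4 : (!₂[ψ q 0, 0] : E 2) - ψ q = (-(ψ q 1)) • EuclideanSpace.single 1 1 := by
        ext i
        fin_cases i <;> simp
      rw [h4, map_smul, h3, smul_zero]
  let J : Set ℝ := Set.Ioo (t p - ε) (t p + ε)
  have hζs : ∀ ρ : E 2 → ℝ, ContDiffOn ℝ ∞ ρ V →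
      ContDiffOn ℝ ∞ (fun u => ρ (H₀.symm !₂[u, 0])) J := by
    intro ρ hρ u hu
    have hy := hball ((hline u).2 hu)
    have h1 : ContDiffAt ℝ ∞ (fun u : ℝ => (!₂[u, 0] : E 2)) u :=
      (contDiffOn_vec2 (U := Set.univ) contDiffOn_id contDiffOn_const).contDiffAt univ_mem
    have h2 : ContDiffAt ℝ ∞ ρ (H₀.symm !₂[u, 0]) :=
      hρ.contDiffAt (hV.mem_nhds (hH₀V (H₀.map_target hy)))
    exact ((h2.comp _ (hsymm _ hy)).comp u h1).contDiffWithinAt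
  -- The chart is cut down so that its image is exactly the ball.
  obtain ⟨H, hHψ, hHs, hHt, hHsymm⟩ : ∃ H : OpenPartialHomeomorph (E 2) (E 2), ⇑H = ψ ∧
      H.source = H₀.source ∩ ψ ⁻¹' B ∧ H.target = B ∧ ⇑H.symm = H₀.symm := by
    refine ⟨H₀ ≫ₕ OpenPartialHomeomorph.ofSet B Metric.isOpen_ball, ?_, ?_, ?_, ?_⟩
    · simp [hH₀]
    · simp [hH₀]
    · simpa using Set.inter_eq_left.2 hball
    · simp
  have hSo : IsOpen H.source := H.open_source
  have hSV : H.source ⊆ V := fun q hq => hH₀V (hHs ▸ hq).1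
  have hval : ∀ ρ : E 2 → ℝ, ContDiffOn ℝ ∞ ρ V → (∀ q ∈ V, along b ρ q = 0) →
      ∀ q ∈ H.source, ρ q = ρ (H₀.symm !₂[t q, 0]) := fun ρ hρ hbρ q hq =>
    hdepends ρ hρ hbρ q (hHs ▸ hq).1 (hHs ▸ hq).2
  have htJ : ∀ q ∈ H.source, t q ∈ J := fun q hq => by
    have := hproj _ ((hHs ▸ hq : q ∈ H₀.source ∩ ψ ⁻¹' B).2)
    exact (hline _).1 this
  have hder : ∀ ρ : E 2 → ℝ, ContDiffOn ℝ ∞ ρ V → (∀ q ∈ V, along b ρ q = 0) →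
      (∀ q ∈ H.source, along a ρ q = deriv (fun u => ρ (H₀.symm !₂[u, 0])) (t q)) ∧
      ∀ q ∈ H.source, along a (along a ρ) q =
        deriv (deriv (fun u => ρ (H₀.symm !₂[u, 0]))) (t q) := by
    intro ρ hρ hbρ
    have hζ := hζs ρ hρ
    have hJ : IsOpen J := isOpen_Ioo
    have h1 : ∀ q ∈ H.source,
        along a ρ q = deriv (fun u => ρ (H₀.symm !₂[u, 0])) (t q) := fun q hq => by
      rw [along_congr hSo (hval ρ hρ hbρ) hq, along_comp (g := fun u => ρ (H₀.symm !₂[u, 0]))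
        ((hζ.contDiffAt (hJ.mem_nhds (htJ q hq))).differentiableAt (by simp))
        (h.diff h.smooth_t (hSV hq)), h.along_a_t q (hSV hq), mul_one]
    refine ⟨h1, fun q hq => ?_⟩
    rw [along_congr hSo h1 hq, along_comp (((hζ.deriv_of_isOpen (m := ∞) hJ le_rfl).contDiffAt
      (hJ.mem_nhds (htJ q hq))).differentiableAt (by simp)) (h.diff h.smooth_t (hSV hq)),
      h.along_a_t q (hSV hq), mul_one]
  -- Every parameter in `J` is the time of a surface point on the axis, where the equations in
  -- `a`-derivatives become the equations for the profile.
  have hpt : ∀ u ∈ J, ∃ q ∈ H.source, t q = u ∧ q = H₀.symm !₂[u, 0] := fun u hu => by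
    have hy := (hline u).2 hu
    have h1 : ψ (H₀.symm !₂[u, 0]) = !₂[u, 0] := hψB _ (hball hy)
    refine ⟨H₀.symm !₂[u, 0], ?_, congrArg (fun y : E 2 => y 0) h1, rfl⟩
    rw [hHs]
    refine ⟨H₀.map_target (hball hy), ?_⟩
    rw [Set.mem_preimage, h1]
    exact hy
  obtain ⟨r₁, r₂⟩ := hder r hcyl.smooth_r hcyl.along_b_r
  obtain ⟨z₁, z₂⟩ := hder z hcyl.smooth_z hcyl.along_b_z
  refine ⟨H, J, fun u => r (H₀.symm !₂[u, 0]), fun u => z (H₀.symm !₂[u, 0]), ?_, ?_, hSV,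
    ⟨isOpen_Ioo, Set.ordConnected_Ioo, fun u hu => ?_, hζs r hcyl.smooth_r, hζs z hcyl.smooth_z,
      fun u hu => ?_, fun u hu => ?_, fun u hu => ?_, fun u hu => ?_⟩, fun q hq => ?_⟩
  · refine mem_contDiffGroupoid (hHψ ▸ sψ.mono hSV) fun y hy => ?_
    rw [hHt] at hy
    rw [hHsymm]
    exact (hsymm y (hball hy)).contDiffWithinAt
  · rw [hHs]
    exact ⟨hpH₀, (Metric.mem_ball_self hε : ψ p ∈ B)⟩
  · obtain ⟨q, hq, rfl, -⟩ := hpt u hu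
    exact h.mem q (hSV hq)
  · obtain ⟨q, hq, -, rfl⟩ := hpt u hu
    exact hcyl.pos _ (hSV hq)
  · obtain ⟨q, hq, rfl, -⟩ := hpt u hu
    rw [← r₁ q hq, ← z₁ q hq]
    exact hcyl.spacelike q (hSV hq)
  · obtain ⟨q, hq, rfl, hq'⟩ := hpt u hu
    rw [← r₁ q hq, ← z₁ q hq, ← r₂ q hq, ← hq']
    exact hcyl.ode_r q (hSV hq)
  · obtain ⟨q, hq, rfl, hq'⟩ := hpt u hu
    rw [← r₁ q hq, ← z₁ q hq, ← z₂ q hq]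
    exact hcyl.ode_z q (hSV hq)
  · rw [hHψ]
    exact ⟨htJ q hq, rfl, rfl, hval r hcyl.smooth_r hcyl.along_b_r q hq,
      hval z hcyl.smooth_z hcyl.along_b_z q hq⟩

/-! ### Congruences and charts of the manifold -/

theorem isCongruence_affine (f : ℝ → ℝ) (I : Set ℝ) (β : OrthonormalBasis (Fin 3) ℝ (E 3))
    (x₀ : E 3) : IsCongruence f I fun P => (P.1, β.repr (P.2 - x₀)) := by
  have hd : ∀ P : W, HasFDerivAt (fun P : W => ((P.1, β.repr (P.2 - x₀)) : W))
      ((ContinuousLinearMap.fst ℝ ℝ (E 3)).prod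
        ((β.repr.toContinuousLinearEquiv : E 3 →L[ℝ] E 3).comp (ContinuousLinearMap.snd ℝ ℝ (E 3))))
      P := fun P =>
    hasFDerivAt_fst.prodMk ((β.repr.toContinuousLinearEquiv : E 3 →L[ℝ] E 3).hasFDerivAt.comp P
      (hasFDerivAt_snd.sub_const x₀))
  have hD : ∀ P X : W, fderiv ℝ (fun P : W => ((P.1, β.repr (P.2 - x₀)) : W)) P X =
      (X.1, β.repr X.2) := fun P X => by
    rw [(hd P).fderiv]; rfl
  refine ⟨⟨fun P hP => hP, fun P _ Q _ h => ?_, fun P hP => ?_⟩, ?_, fun P _ X Y => ?_,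
    fun P _ => ?_⟩
  · have h1 := congrArg Prod.fst h
    have h2 := β.repr.injective (congrArg Prod.snd h)
    exact Prod.ext h1 (sub_left_injective h2)
  · refine ⟨(P.1, β.repr.symm P.2 + x₀), hP, ?_⟩
    simp
  · exact (contDiff_fst.prodMk (β.repr.toContinuousLinearEquiv.contDiff.comp
      (contDiff_snd.sub contDiff_const))).contDiffOn
  · rw [hD, hD, metric, metric, β.repr.inner_map_map]
  · rw [hD]
    simp [dt]

theorem trans_mem_maximalAtlas {M : Type*} [TopologicalSpace M] [ChartedSpace (E 2) M]
    [IsManifold (𝓡 2) ∞ M] {e : OpenPartialHomeomorph M (E 2)}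
    (he : e ∈ IsManifold.maximalAtlas (𝓡 2) ∞ M) {H : OpenPartialHomeomorph (E 2) (E 2)}
    (hH : H ∈ contDiffGroupoid ∞ (𝓡 2)) : e ≫ₕ H ∈ IsManifold.maximalAtlas (𝓡 2) ∞ M := by
  rw [IsManifold.mem_maximalAtlas_iff, mem_maximalAtlas_iff]
  intro e' he'
  have he'' := IsManifold.subset_maximalAtlas (I := 𝓡 2) (n := ∞) he'
  constructor
  · rw [OpenPartialHomeomorph.trans_symm_eq_symm_trans_symm, OpenPartialHomeomorph.trans_assoc]
    exact (contDiffGroupoid ∞ (𝓡 2)).trans ((contDiffGroupoid ∞ (𝓡 2)).symm hH)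
      (IsManifold.compatible_of_mem_maximalAtlas he he'')
  · rw [← OpenPartialHomeomorph.trans_assoc]
    exact (contDiffGroupoid ∞ (𝓡 2)).trans (IsManifold.compatible_of_mem_maximalAtlas he'' he) hH

/-! ### Minimal surfaces of class `𝒜` are rotational -/

section Main

variable {M : Type*} [TopologicalSpace M] {f : ℝ → ℝ} {I : Set ℝ} {φ : M → W}

theorem hasTotallyGeodesicPart_of_plane (hI : IsOpen I) (hf0 : ∀ t ∈ I, f t ≠ 0)
    (hφ : ∀ p, φ p ∈ spacetime I) (e : OpenPartialHomeomorph M (E 2)) {U : Set (E 2)}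
    (hU : IsOpen U) {p : M} (hpe : p ∈ e.source) (hp : e p ∈ U)
    (β : OrthonormalBasis (Fin 3) ℝ (E 3)) (x₀ : E 3)
    (h : ∀ q ∈ e.source, e q ∈ U → inner ℝ (φ q).2 (β 2) = inner ℝ x₀ (β 2)) :
    HasTotallyGeodesicPart f I φ := by
  refine ⟨e.source ∩ e ⁻¹' U, e.isOpen_inter_preimage hU, ⟨p, hpe, hp⟩, _, _,
    isTotallyGeodesicHypersurface_plane hI hf0 β x₀, ?_⟩
  rintro _ ⟨q, ⟨hqe, hqU⟩, rfl⟩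
  refine ⟨!₂[(φ q).1, inner ℝ (β 0) ((φ q).2 - x₀), inner ℝ (β 1) ((φ q).2 - x₀)], hφ q, ?_⟩
  have h1 := β.sum_repr' ((φ q).2 - x₀)
  have h2 : inner ℝ (β 2) ((φ q).2 - x₀) = 0 := by
    rw [real_inner_comm, inner_sub_left, h q hqe hqU, sub_self]
  rw [Fin.sum_univ_three, h2, zero_smul, add_zero] at h1
  refine Prod.ext rfl ?_
  change x₀ + (inner ℝ (β 0) ((φ q).2 - x₀) • β 0 + inner ℝ (β 1) ((φ q).2 - x₀) • β 1) = _
  rw [h1]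
  abel

theorem isLocallyRotationalMinimal_of_isMinimal_of_isClassA [ChartedSpace (E 2) M]
    [IsManifold (𝓡 2) ∞ M]
    (hI : IsOpen I) (hf : ContDiffOn ℝ ∞ f I) (hf0 : ∀ t ∈ I, f t ≠ 0)
    (hφ : IsSpacelikeSurface f I φ) (hng : ¬ HasTotallyGeodesicPart f I φ)
    (hH : IsMinimal f φ) (hA : IsClassA f φ) : IsLocallyRotationalMinimal f I φ := by
  intro p
  have he : chartAt (E 2) p ∈ IsManifold.maximalAtlas (𝓡 2) ∞ M :=
    IsManifold.chart_mem_maximalAtlas p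
  have hpe : p ∈ (chartAt (E 2) p).source := mem_chart_source _ p
  generalize chartAt (E 2) p = e at he hpe
  -- A ball in the chart supplies the convex domain on which the linear equations propagate.
  obtain ⟨ε, hε, hball⟩ := Metric.isOpen_iff.1 e.open_target (e p) (e.map_source hpe)
  have hxs : ContDiffOn ℝ ∞ (φ ∘ e.symm) (Metric.ball (e p) ε) := fun q hq =>
    (hφ.contDiffAt he (hball hq)).contDiffWithinAt
  obtain ⟨a, b, hab⟩ := exists_isAdaptedFrame (x := φ ∘ e.symm)
    (t := fun q => ((φ ∘ e.symm) q).1) (X := fun q => ((φ ∘ e.symm) q).2) rfl hf0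
    Metric.isOpen_ball (contDiff_fst.comp_contDiffOn hxs) (contDiff_snd.comp_contDiffOn hxs)
    (fun q _ => hφ.mem _) (fun q hq => hφ.spacelike e he q (hball hq))
    (fun q hq => hH e he q (hball hq)) (fun q hq => hA e he q (hball hq))
  have hpB := Metric.mem_ball_self (x := e p) hε
  -- The curvature of the level curve through `p` decides: straight lines lead to the excluded
  -- totally geodesic part, circles to cylindrical coordinates.
  by_cases h0 : along b (along b fun q => ((φ ∘ e.symm) q).2) (e p) = 0
  · obtain ⟨β, hβ⟩ := hab.exists_plane hI hf hf0 (convex_ball _ _) hpB h0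
    refine absurd (hasTotallyGeodesicPart_of_plane hI hf0 hφ.mem e Metric.isOpen_ball hpe hpB β
      ((φ ∘ e.symm) (e p)).2 fun q hq hqU => ?_) hng
    have := hβ (e q) hqU
    rwa [Function.comp_apply, e.left_inv hq] at this
  · obtain ⟨V, hVB, hV, hpV, β, x₀, r, z, θ, hcyl, hθ⟩ :=
      hab.exists_isCylindrical hI hf hf0 (convex_ball _ _) hpB h0
    obtain ⟨H, J, ζ₁, ζ₂, hH, hpH, hHV, hζ, hval⟩ := exists_chart (hab.mono hV hVB) hcyl hpV hθ
    refine ⟨e ≫ₕ H, trans_mem_maximalAtlas he hH, by simp [hpe, hpH], J, ζ₁, ζ₂, _, hζ,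
      isCongruence_affine f I β x₀, fun q hq => ?_⟩
    have hqH : q ∈ H.target := by
      rw [OpenPartialHomeomorph.trans_target] at hq
      exact hq.1
    have hy := H.map_target hqH
    obtain ⟨h1, h2, h3, h4, h5⟩ := hval _ hy
    have h6 := hcyl.eq _ (hHV hy)
    rw [H.right_inv hqH] at h1 h2 h3 h4 h5
    refine ⟨h1, ?_⟩
    rw [h3, h4, h5] at h6
    refine Prod.ext h2 ?_
    change β.repr (((φ ∘ e.symm) (H.symm q)).2 - x₀) = _
    rw [h6]
    ext i
    fin_cases i <;>
      simp [rotational]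

end Main

end RobertsonWalker

end

theorem mainTheorem4 (I : Set ℝ) (hIopen : IsOpen I) (hIconn : I.OrdConnected)
    (f : ℝ → ℝ) (hf : ContDiffOn ℝ ∞ f I) (hf0 : ∀ t ∈ I, f t ≠ 0)
    {M : Type*} [TopologicalSpace M] [ChartedSpace (EuclideanSpace ℝ (Fin 2)) M]
    [IsManifold (𝓡 2) ∞ M] (φ : M → ℝ × EuclideanSpace ℝ (Fin 3))
    (hφ : RobertsonWalker.IsSpacelikeSurface f I φ)
    (hng : ¬ RobertsonWalker.HasTotallyGeodesicPart f I φ) :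
    (RobertsonWalker.IsMinimal f φ ∧ RobertsonWalker.IsClassA f φ) ↔
      RobertsonWalker.IsLocallyRotationalMinimal f I φ := by
  constructor
  · rintro ⟨hH, hA⟩
    exact RobertsonWalker.isLocallyRotationalMinimal_of_isMinimal_of_isClassA hIopen hf hf0 hφ hng
      hH hA
  · intro h
    have key := fun e he q hq =>
      RobertsonWalker.isMinimal_and_isClassA_of_isLocallyRotationalMinimal hIopen hf hf0 hφ h
        (e := e) he (q := q) hq
    exact ⟨fun e he q hq => (key e he q hq).1, fun e he q hq => (key e he q hq).2⟩
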